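/- **Setting.** Let $\vec\ell_1,\vec\ell_2\in\mathbb R^2$ be linearly independent, $\vec G_1,\vec G_2$ the reciprocal basis ($\vec G_i\cdot\vec\ell_j=2\pi\delta_{ij}$), $L\ge 1$ an integer, $\Lambda_L$ the torus $\{n_1\vec\ell_1+n_2\vec\ell_2:\ 0\le n_i<L\}$ with periodic boundary conditions, $I$ a finite set, $\vec r_\sigma\in\mathbb R^2$ ($\sigma\in I$), $\mu\in\mathbb R$ and $\beta>0$. Set $\mathcal D_L=\{\frac{n_1}{L}\vec G_1+\frac{n_2}{L}\vec G_2:\ n_i\in\mathbb Z\}$ and $\mathcal B_L=\{\frac{n_1}{L}\vec G_1+\frac{n_2}{L}\vec G_2:\ n_i\in\mathbb Z,\ 0\le n_i<L\}$. Let $\psi^\pm_{\vec x,\sigma}$ ($\vec x\in\Lambda_L$, $\sigma\in I$) be the fermionic creation and annihilation operators on Fock space, and $n^\sigma_{\vec x}=\psi^+_{\vec x,\sigma}\psi^-_{\vec x,\sigma}$. Let $H^{(0)}_{\sigma\sigma'}:\Lambda_L\to\mathbb C$ and $v_{\sigma\sigma'}:\Lambda_L\to\mathbb R$ satisfy $\overline{H^{(0)}_{\sigma\sigma'}(\vec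 x)}=H^{(0)}_{\sigma'\sigma}(-\vec x)$, $v_{\sigma\sigma'}(\vec x)=v_{\sigma'\sigma}(-\vec x)$ and $v_{\sigma\sigma}(\vec 0)=0$. Put $$\mathcal H^{(0)}_L=\sum_{\vec x,\vec y,\sigma,\sigma'}\psi^+_{\vec x,\sigma}H^{(0)}_{\sigma\sigma'}(\vec x-\vec y)\psi^-_{\vec y,\sigma'},\qquad \mathcal V_L=\sum_{\vec x,\vec y,\sigma,\sigma'}n^\sigma_{\vec x}\,v_{\sigma\sigma'}(\vec x-\vec y)\,n^{\sigma'}_{\vec y},\qquad \mathcal N_L=\sum_{\vec x,\sigma}n^\sigma_{\vec x},$$ and $\hat v_{\sigma\sigma'}(\vec p)=\sum_{\vec x\in\Lambda_L}e^{i\vec p\cdot\vec x}v_{\sigma\sigma'}(\vec x)$. **Observables.** Let $\vec x_\sigma=\vec x+\vec r_\sigma$, and let $\vec y_{\sigma'}-\vec x_\sigma$ denote $(\vec y-\vec x)_L+\vec r_{\sigma'}-\vec r_\sigma$, where $(n_1\vec\ell_1+n_2\vec\ell_2)_L=\{n_1\}_L\vec\ell_1+\{n_2\}_L\vec\ell_2$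 and $\{n\}_L=n-L\lfloor \frac nL+\frac12\rfloor$. Set $$J^{\sigma\sigma'}_{\vec x\vec y}=i\big[\psi^+_{\vec x,\sigma}H^{(0)}_{\sigma\sigma'}(\vec x-\vec y)\psi^-_{\vec y,\sigma'}-\psi^+_{\vec y,\sigma'}H^{(0)}_{\sigma'\sigma}(\vec y-\vec x)\psi^-_{\vec x,\sigma}\big],\qquad \eta^{\sigma\sigma'}_{\vec x\vec y}(\vec p)=\frac{1-e^{-i\vec p\cdot(\vec y_{\sigma'}-\vec x_\sigma)}}{i\,\vec p\cdot(\vec y_{\sigma'}-\vec x_\sigma)}$$ (with $\eta=1$ if $\vec p\cdot(\vec y_{\sigma'}-\vec x_\sigma)=0$ and $\vec y_{\sigma'}\ne\vec x_\sigma$, and $\eta=0$ if $\vec y_{\sigma'}=\vec x_\sigma$). For $\vec p\in\mathcal D_L$ the current and density observables are, for $i\in\{1,2\}$ and $\sigma\in I$, $$\tilde J_{i,\vec p}=\tfrac12\sum_{\vec x,\vec y\in\Lambda_L}\sum_{\tau,\tau'\in I}e^{-i\vec p\cdot\vec x_\tau}(\vec y_{\tau'}-\vec x_\tau)_i\,\eta^{\tau\tau'}_{\vec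 x\vec y}(\vec p)\,J^{\tau\tau'}_{\vec x\vec y},\qquad \tilde J_{\sigma,\vec p}=\sum_{\vec x\in\Lambda_L}e^{-i\vec p\cdot\vec x}n^\sigma_{\vec x}.$$ **Correlations.** Let $O_t=e^{t(\mathcal H^{(0)}_L-\mu\mathcal N_L)}Oe^{-t(\mathcal H^{(0)}_L-\mu\mathcal N_L)}$, let $\langle O\rangle=\mathrm{Tr}(e^{-\beta(\mathcal H^{(0)}_L-\mu\mathcal N_L)}O)/\mathrm{Tr}\,e^{-\beta(\mathcal H^{(0)}_L-\mu\mathcal N_L)}$, let $\mathbf T$ order even observables by decreasing imaginary time from left to right, and let $$\langle\mathbf T\,O^{(1)}_{t_1};\cdots;O^{(n)}_{t_n}\rangle=\frac{\partial^n}{\partial\lambda_1\cdots\partial\lambda_n}\log\Big\{1+\sum_{\emptyset\ne P\subseteq\{1,\dots,n\}}\Big(\prod_{i\in P}\lambda_i\Big)\Big\langle\mathbf T\prod_{i\in P}O^{(i)}_{t_i}\Big\rangle\Big\}\Big|_{\lambda=0}.$$ For $n\ge 1$, $k\ge 0$, $\alpha_1,\dots,\alpha_n\in\{1,2\}\cup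 I$ and $\mathbf p_a=(\omega_a,\vec p_a)\in\frac{2\pi}\beta\mathbb Z\times\mathcal D_L$ ($a=1,\dots,n-1$), set $\mathbf p_n=-\mathbf p_1-\cdots-\mathbf p_{n-1}$ and define the order-$k$ coefficient $$\widehat K^{\beta,L,(k)}_{\alpha_1,\dots,\alpha_n}(\mathbf p_1,\dots,\mathbf p_{n-1})=\frac1{\beta L^2}\int_{[0,\beta)^{n+k}}dt_1\cdots dt_n\,ds_1\cdots ds_k\;e^{-i\sum_{a}\omega_at_a}\big\langle\mathbf T\,(\tilde J_{\alpha_1,\vec p_1})_{t_1};\cdots;(\tilde J_{\alpha_n,\vec p_n})_{t_n};(\mathcal V_L)_{s_1};\cdots;(\mathcal V_L)_{s_k}\big\rangle .$$ **Proposition (Schwinger–Dyson equation).** For all $k\ge1$, all $i,j\in\{1,2\}$ and all $\mathbf p=(\omega,\vec p)\in\frac{2\pi}{\beta}\mathbb Z\times\mathcal D_L$, $$\begin{aligned}\widehat K^{\beta,L,(k)}_{i,j}(\mathbf p)={}&\frac1{\beta L^2}\sum_{\mathbf q=(\omega',\vec q)\in\frac{2\pi}\beta\mathbb Z\times\mathcal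 B_L}\ \sum_{\sigma,\sigma'\in I}\hat v_{\sigma\sigma'}(\vec q)\,\widehat K^{\beta,L,(k-1)}_{i,j,\sigma,\sigma'}(\mathbf p,-\mathbf p,\mathbf q)\\&+2\sum_{m=0}^{k-1}\binom{k-1}m\sum_{\sigma,\sigma'\in I}\hat v_{\sigma\sigma'}(\vec 0)\,\widehat K^{\beta,L,(m)}_{i,j,\sigma}(\mathbf p,-\mathbf p)\,\widehat K^{\beta,L,(k-1-m)}_{\sigma'}\\&+2\sum_{m=0}^{k-1}\binom{k-1}m\sum_{\sigma,\sigma'\in I}\hat v_{\sigma\sigma'}(-\vec p)\,\widehat K^{\beta,L,(m)}_{i,\sigma}(\mathbf p)\,\widehat K^{\beta,L,(k-1-m)}_{j,\sigma'}(-\mathbf p),\end{aligned}$$ where the sum over $\mathbf q$ of the $\sigma,\sigma'$-summed terms converges absolutely. -/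

import Mathlib

open scoped Matrix

noncomputable section

/-! ### Fermionic Fock space over a finite set of modes -/

/-- Operators on the fermionic Fock space over the finite set of modes `M`, written as matrices in
the orthonormal occupation-number basis, which is indexed by the sets `S` of occupied modes. -/
abbrev FockOp (M : Type*) : Type _ := Matrix (Finset M) (Finset M) ℂ

/-- The creation operator of the mode `m`, for a fixed enumeration of the modes:
it maps the basis vector `T` to `(-1)^{#{m' ∈ T, m' before m}}` times the basis vector
`T ∪ {m}` if `m ∉ T`, and to `0` otherwise. -/
def fockCreate {M : Type*} [Fintype M] [DecidableEq M] (m : M) : FockOp M :=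
  Matrix.of fun S T =>
    if m ∉ T ∧ S = insert m T then
      (-1 : ℂ) ^ (T.filter fun m' => Fintype.equivFin M m' < Fintype.equivFin M m).card
    else 0

/-- The annihilation operator of the mode `m`, the adjoint of the creation operator. -/
def fockAnnihilate {M : Type*} [Fintype M] [DecidableEq M] (m : M) : FockOp M :=
  (fockCreate m)ᴴ

/-! ### Imaginary time evolution, Gibbs state, time ordering and cumulants

Here `A` stands for the grand-canonical generator `ℋ - μ 𝒩`, and operators are matrices over an
arbitrary finite index type `F` (a basis of the Fock space). -/

section Thermal

variable {F : Type*} [Fintype F] [DecidableEq F]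

/-- The imaginary time evolution `O_t = e^{tA} O e^{-tA}`. -/
def imagEvolve (A O : Matrix F F ℂ) (t : ℝ) : Matrix F F ℂ :=
  NormedSpace.exp ((t : ℂ) • A) * O * NormedSpace.exp (-(t : ℂ) • A)

/-- The Gibbs average `Tr (e^{-βA} O) / Tr e^{-βA}`. -/
def gibbsAvg (A : Matrix F F ℂ) (β : ℝ) (O : Matrix F F ℂ) : ℂ :=
  Matrix.trace (NormedSpace.exp (-(β : ℂ) • A) * O) /
    Matrix.trace (NormedSpace.exp (-(β : ℂ) • A))

open scoped Classical in
/-- The time-ordered product `𝐓 ∏_{i ∈ P} O^{(i)}_{t_i}` of even observables: the factors are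
multiplied in the order of decreasing times, latest time on the left (no sign arises, since even
observables are reordered). Coinciding times, which form a null set and are irrelevant below because
every time is integrated, are ordered by the label. -/
def timeOrderedProd (A : Matrix F F ℂ) {n : ℕ} (O : Fin n → Matrix F F ℂ) (t : Fin n → ℝ)
    (P : Finset (Fin n)) : Matrix F F ℂ :=
  (((P.sort (· ≤ ·)).insertionSort (fun i j => t j ≤ t i)).map
    fun i => imagEvolve A (O i) (t i)).prod

/-- The iterated partial derivative `∂/∂λ_{i₁} ⋯ ∂/∂λ_{iₘ} f` for the list `[i₁, …, iₘ]`. -/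
def mixedPartial {n : ℕ} (l : List (Fin n)) (f : (Fin n → ℝ) → ℂ) : (Fin n → ℝ) → ℂ :=
  l.foldr (fun i g x => lineDeriv ℝ g x (Pi.single i 1)) f

/-- The truncated time-ordered correlation (cumulant) of even observables,
`∂ⁿ/∂λ₁⋯∂λₙ log {1 + ∑_{∅ ≠ P ⊆ {1,…,n}} λ(P) ⟨𝐓 O(P)⟩}` at `λ = 0`,
with `λ(P) = ∏_{i ∈ P} λᵢ` and `O(P) = ∏_{i ∈ P} O^{(i)}_{t_i}`. -/
def truncatedCorr (A : Matrix F F ℂ) (β : ℝ) {n : ℕ} (O : Fin n → Matrix F F ℂ)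
    (t : Fin n → ℝ) : ℂ :=
  mixedPartial (List.finRange n)
    (fun lam => Complex.log (1 + ∑ P ∈ (Finset.univ : Finset (Finset (Fin n))).erase ∅,
      ((∏ i ∈ P, lam i : ℝ) : ℂ) * gibbsAvg A β (timeOrderedProd A O t P))) 0

/-- The truncated correlation of the time-Fourier transforms
`Ô^{(i)}_{ω_i} = ∫₀^β dt e^{-iω_i t} O^{(i)}_t`, i.e.
`∫_{[0,β)ⁿ} dt₁⋯dtₙ e^{-i(ω₁t₁+⋯+ωₙtₙ)} ⟨𝐓 O^{(1)}_{t₁}; ⋯; O^{(n)}_{tₙ}⟩`. -/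
def truncatedCorrFourier (A : Matrix F F ℂ) (β : ℝ) {n : ℕ} (O : Fin n → Matrix F F ℂ)
    (ω : Fin n → ℝ) : ℂ :=
  ∫ t in Set.univ.pi fun _ : Fin n => Set.Ico (0 : ℝ) β,
    Complex.exp (-Complex.I * ((∑ i, ω i * t i : ℝ) : ℂ)) * truncatedCorr A β O t

end Thermal

/-! ### The lattice model -/

/-- The Euclidean plane. -/
abbrev Plane : Type := EuclideanSpace ℝ (Fin 2)

/-- The sites of the torus `Λ_L = Λ / LΛ`, in lattice coordinates: `(n₁, n₂)` modulo `L`. -/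
abbrev TorusSite (L : ℕ) : Type := Fin 2 → ZMod L

/-- The single-particle modes: a site of the torus and a color. -/
abbrev Mode (L : ℕ) (I : Type*) : Type _ := TorusSite L × I

/-- The data of the model on the torus of side `L` with colors in `I`. -/
structure LatticeModel (L : ℕ) (I : Type*) where
  /-- generators of the Bravais lattice `Λ` -/
  ell : Fin 2 → Plane
  ell_linearIndependent : LinearIndependent ℝ ell
  /-- the reciprocal basis -/
  G : Fin 2 → Plane
  G_dual : ∀ i j, inner ℝ (G i) (ell j) = if i = j then 2 * Real.pi else 0
  /-- the displacements `r_σ` of the physical sites inside the cell -/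
  r : I → Plane
  /-- the hopping function `H⁽⁰⁾_{σσ'}(x)` on the torus -/
  hop : TorusSite L → I → I → ℂ
  hop_selfAdjoint : ∀ x σ σ', starRingEnd ℂ (hop x σ σ') = hop (-x) σ' σ
  /-- the pair interaction `v_{σσ'}(x)` on the torus -/
  v : TorusSite L → I → I → ℝ
  v_diag : ∀ σ, v 0 σ σ = 0
  v_symm : ∀ x σ σ', v x σ σ' = v (-x) σ' σ
  /-- the chemical potential -/
  mu : ℝ

/-- The labels `α ∈ {0, 1, 2} ∪ I` of the observables: the total density (`α = 0`), the
components of the current (`α = 1, 2`, here `i : Fin 2`), the density of the color `σ`. -/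
inductive ObsLabel (I : Type*) where
  | total : ObsLabel I
  | current (i : Fin 2) : ObsLabel I
  | density (σ : I) : ObsLabel I

namespace LatticeModel

variable {L : ℕ} [NeZero L] {I : Type*} [Fintype I] [DecidableEq I] (S : LatticeModel L I)

/-- `ψ⁺_{x,σ}` -/
def psiP (x : TorusSite L) (σ : I) : FockOp (Mode L I) := fockCreate (x, σ)

/-- `ψ⁻_{x,σ}` -/
def psiM (x : TorusSite L) (σ : I) : FockOp (Mode L I) := fockAnnihilate (x, σ)

/-- `n^σ_x = ψ⁺_{x,σ} ψ⁻_{x,σ}` -/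
def num (x : TorusSite L) (σ : I) : FockOp (Mode L I) := psiP x σ * psiM x σ

/-- The free Hamiltonian `ℋ⁽⁰⁾_L`. -/
def freeHam : FockOp (Mode L I) :=
  ∑ x : TorusSite L, ∑ y : TorusSite L, ∑ σ : I, ∑ σ' : I,
    S.hop (x - y) σ σ' • (psiP x σ * psiM y σ')

/-- The many-body interaction `𝒱_L`. -/
def interaction : FockOp (Mode L I) :=
  ∑ x : TorusSite L, ∑ y : TorusSite L, ∑ σ : I, ∑ σ' : I,
    (S.v (x - y) σ σ' : ℂ) • (num x σ * num y σ')

/-- The number operator `𝒩_L`. -/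
def numberOp : FockOp (Mode L I) := ∑ x : TorusSite L, ∑ σ : I, num x σ

/-- The grand-canonical Hamiltonian `ℋ⁽⁰⁾_L + U 𝒱_L - μ 𝒩_L`. -/
def grandHam (U : ℝ) : FockOp (Mode L I) :=
  S.freeHam + (U : ℂ) • S.interaction - (S.mu : ℂ) • numberOp

/-- The representative `n₁ ℓ₁ + n₂ ℓ₂`, `0 ≤ nᵢ < L`, of a site of the torus. -/
def pos (x : TorusSite L) : Plane := ∑ i, ((x i).val : ℝ) • S.ell i

/-- `{n}_L = n - L ⌊n/L + 1/2⌋` -/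
def centered (L : ℕ) (n : ℤ) : ℤ := n - L * ⌊(n : ℝ) / L + 1 / 2⌋

/-- The vector `y_{σ'} - x_σ` on the torus, i.e. `(y - x)_L + r_{σ'} - r_σ`. -/
def disp (x : TorusSite L) (σ : I) (y : TorusSite L) (σ' : I) : Plane :=
  ∑ i, (centered L (((y i).val : ℤ) - ((x i).val : ℤ)) : ℝ) • S.ell i + S.r σ' - S.r σ

/-- The bond current `J^{σσ'}_{xy}`. -/
def bondCurrent (x : TorusSite L) (σ : I) (y : TorusSite L) (σ' : I) : FockOp (Mode L I) :=
  Complex.I • (S.hop (x - y) σ σ' • (psiP x σ * psiM y σ')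
    - S.hop (y - x) σ' σ • (psiP y σ' * psiM x σ))

/-- `η = (1 - e^{-ip·d}) / (i p·d)` with `d = y_{σ'} - x_σ`, extended by continuity to
`p·d = 0`, and equal to `0` if `d = 0`. -/
def eta (p d : Plane) : ℂ :=
  if d = 0 then 0
  else if inner ℝ p d = 0 then 1
  else (1 - Complex.exp (-Complex.I * (inner ℝ p d : ℝ))) / (Complex.I * (inner ℝ p d : ℝ))

/-- The observables at momentum `p` and at time `0`: the total density `J̃_{0,p}`, the current
components `J̃_{1,p}`, `J̃_{2,p}`, and the color densities `ñ^σ_p = ∑_x e^{-ip·x} n^σ_x`. -/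
def obs (p : Plane) : ObsLabel I → FockOp (Mode L I)
  | .total => ∑ x : TorusSite L, ∑ σ : I,
      Complex.exp (-Complex.I * (inner ℝ p (S.pos x + S.r σ) : ℝ)) • num x σ
  | .current i => (1 / 2 : ℂ) • ∑ x : TorusSite L, ∑ y : TorusSite L, ∑ σ : I, ∑ σ' : I,
      (Complex.exp (-Complex.I * (inner ℝ p (S.pos x + S.r σ) : ℝ))
        * (S.disp x σ y σ' i : ℂ) * eta p (S.disp x σ y σ')) • S.bondCurrent x σ y σ'
  | .density σ => ∑ x : TorusSite L,
      Complex.exp (-Complex.I * (inner ℝ p (S.pos x) : ℝ)) • num x σ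

/-- `v̂_{σσ'}(p) = ∑_{x ∈ Λ_L} e^{ip·x} v_{σσ'}(x)` -/
def vHat (σ σ' : I) (p : Plane) : ℂ :=
  ∑ x : TorusSite L, Complex.exp (Complex.I * (inner ℝ p (S.pos x) : ℝ)) * (S.v x σ σ' : ℂ)

/-- The Matsubara frequencies `(2π/β) ℤ`. -/
def matsubara (β : ℝ) : Set ℝ := {ω | ∃ m : ℤ, ω = 2 * Real.pi / β * m}

/-- `𝒟_L = {(n₁/L) G₁ + (n₂/L) G₂ : nᵢ ∈ ℤ}` -/
def momenta : Set Plane := {k | ∃ n : Fin 2 → ℤ, k = ∑ i, ((n i : ℝ) / L) • S.G i}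

/-- The finite-volume Brillouin zone `ℬ_L`, where moreover `0 ≤ nᵢ < L`. -/
def brillouin : Set Plane :=
  {k | ∃ n : Fin 2 → ℤ, (∀ i, 0 ≤ n i ∧ n i < L) ∧ k = ∑ i, ((n i : ℝ) / L) • S.G i}

/-- The coefficient of order `k`
`K̂^{β,L,(k)}_{α₁,…,αₙ₊₁}(𝐩₁,…,𝐩ₙ)
  = (βL²)⁻¹ ⟨𝐓 Ĵ_{α₁,𝐩₁}; …; Ĵ_{αₙ,𝐩ₙ}; Ĵ_{αₙ₊₁,-𝐩₁-⋯-𝐩ₙ}; 𝒱̃_L; …; 𝒱̃_L⟩⁽⁰⁾`,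
with `𝒱̃_L = ∫₀^β (𝒱_L)_t dt` repeated `k` times; the Gibbs state and the evolution are those at
`U = 0`. Momenta are pairs `𝐩 = (ω, p)` of a frequency and a spatial momentum. For `n = 0` this
is the coefficient of the one-point function. -/
def KHat (β : ℝ) (k : ℕ) {n : ℕ} (α : Fin (n + 1) → ObsLabel I) (pp : Fin n → ℝ × Plane) : ℂ :=
  let full : Fin (n + 1) → ℝ × Plane := Fin.snoc (α := fun _ => ℝ × Plane) pp (-∑ i, pp i)
  1 / ((β : ℂ) * (L : ℂ) ^ 2) *
    truncatedCorrFourier (S.grandHam 0) β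
      (Fin.append (fun i => S.obs (full i).2 (α i)) (fun _ : Fin k => S.interaction))
      (Fin.append (fun i => (full i).1) (fun _ : Fin k => (0 : ℝ)))

end LatticeModel

end

/-! One of the `k` interaction vertices is opened. In momentum space it reads L⁻² ∑ v̂_{σσ'}(q)
n^σ_q n^{σ'}_{-q}, a sum of products of two densities at one time. Such an equal-time product is the
value at u = 0 of the correlation in which the two densities sit at times differing by u, all other
times being integrated. The Fourier coefficients in u of that function are the correlations with
frequencies ω' and -ω' at the two densities, so the sum over ω' is its Fourier series at 0.

The analytic point is convergence. A time-ordered correlation may jump when noncommuting observables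
exchange their order. The two densities commute, so nothing jumps when they cross each other; and
when u moves by h, crossing any other observable has probability O(h), because the time of that
observable is integrated. Hence the function is Lipschitz on the time circle
(`exists_pairMoment_lipschitz`), and Bernstein's theorem (`summable_fourierCoeff_of_lipschitz`)
makes its Fourier series absolutely convergent. This gives the equation for moments
(`hasSum_fourierMoment`).

The passage to cumulants is combinatorial. Cumulants are used only through the linked cluster
recursion `IsCumulant`, which survives time integration because distinct labels have independent
times (`isCumulant_fourierCumulant`). Expanding a moment with two marked labels into clusters, and
cancelling the common factor of the unmarked labels, leaves the cumulant joining both marked labels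
plus all products of a cluster of one and a cluster of the other
(`hasSum_cumulant_of_hasSum_moment`). In such a product the two currents can be distributed in four
ways, and the remaining `k - 1` vertices with binomial multiplicity.

Finally, rotations of the time circle (the KMS condition) and lattice translations, implemented on
Fock space by signed permutations of the occupied sets, force each cumulant to conserve frequency
and momentum (`perturbedCumulant_eq_zero_of_sum_ne`). In each product only one transferred momentum
survives: 0 if both currents are on the same side, ±𝐩 if they are separated. The symmetry
v̂_{σσ'}(q) = v̂_{σ'σ}(-q) identifies the four contributions in pairs, whence the two factors 2. -/

noncomputable section

open Filter Topology

/-! ### Mixed partial derivatives over sets of coordinates. -/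

section MixedPartials

variable {n : ℕ}

/-- The partial derivative in the direction of the `a`-th coordinate. -/
def partialDir (a : Fin n) (f : (Fin n → ℝ) → ℂ) : (Fin n → ℝ) → ℂ :=
  fun x => lineDeriv ℝ f x (Pi.single a 1)

/-- `lineDeriv` takes a default value where the derivative does not exist, so it is identified with
the Fréchet derivative only near an analytic point. The identities below are equalities of germs for
the same reason: they have to be differentiated again. -/
theorem AnalyticAt.partialDir_eventuallyEq {f : (Fin n → ℝ) → ℂ} {x : Fin n → ℝ}
    (hf : AnalyticAt ℝ f x) (a : Fin n) :
    partialDir a f =ᶠ[𝓝 x] fun y => fderiv ℝ f y (Pi.single a 1) := by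
  filter_upwards [hf.eventually_analyticAt] with y hy
  exact hy.differentiableAt.lineDeriv_eq_fderiv

theorem AnalyticAt.fderiv_dir {f : (Fin n → ℝ) → ℂ} {x : Fin n → ℝ}
    (hf : AnalyticAt ℝ f x) (v : Fin n → ℝ) :
    AnalyticAt ℝ (fun y => fderiv ℝ f y v) x :=
  ((ContinuousLinearMap.apply ℝ ℂ v).analyticAt _).comp hf.fderiv

theorem AnalyticAt.partialDir {f : (Fin n → ℝ) → ℂ} {x : Fin n → ℝ}
    (hf : AnalyticAt ℝ f x) (a : Fin n) : AnalyticAt ℝ (partialDir a f) x :=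
  (hf.fderiv_dir _).congr (hf.partialDir_eventuallyEq a).symm

theorem Filter.EventuallyEq.partialDir {f g : (Fin n → ℝ) → ℂ} {x : Fin n → ℝ}
    (h : f =ᶠ[𝓝 x] g) (a : Fin n) : partialDir a f =ᶠ[𝓝 x] partialDir a g := by
  filter_upwards [eventually_eventually_nhds.2 h] with y hy
  exact Filter.EventuallyEq.lineDeriv_eq hy

/-- Both sides are the second Fréchet derivative on two basis vectors, which is symmetric at
analytic points. -/
theorem partialDir_comm {f : (Fin n → ℝ) → ℂ} {x : Fin n → ℝ} (hf : AnalyticAt ℝ f x)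
    (a b : Fin n) : partialDir a (partialDir b f) =ᶠ[𝓝 x] partialDir b (partialDir a f) := by
  have key : ∀ a b : Fin n, partialDir a (partialDir b f) =ᶠ[𝓝 x]
      fun y => fderiv ℝ (fderiv ℝ f) y (Pi.single a 1) (Pi.single b 1) := by
    intro a b
    refine ((hf.partialDir_eventuallyEq b).partialDir a).trans ?_
    refine ((hf.fderiv_dir _).partialDir_eventuallyEq a).trans ?_
    filter_upwards [hf.eventually_analyticAt] with y hy
    have h1 : HasFDerivAt (fderiv ℝ f) (fderiv ℝ (fderiv ℝ f) y) y :=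
      hy.fderiv.differentiableAt.hasFDerivAt
    have h2 := h1.clm_apply (hasFDerivAt_const (Pi.single b (1 : ℝ) : Fin n → ℝ) y)
    rw [h2.fderiv]
    simp
  refine (key a b).trans (EventuallyEq.trans ?_ (key b a).symm)
  filter_upwards [hf.eventually_analyticAt] with y hy
  exact (hy.contDiffAt (n := ⊤)).isSymmSndFDerivAt (by simp) _ _

theorem partialDir_mul {f g : (Fin n → ℝ) → ℂ} {x : Fin n → ℝ} (hf : AnalyticAt ℝ f x)
    (hg : AnalyticAt ℝ g x) (a : Fin n) :
    partialDir a (f * g) =ᶠ[𝓝 x] partialDir a f * g + f * partialDir a g := by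
  filter_upwards [hf.eventually_analyticAt, hg.eventually_analyticAt] with y hy hy'
  have := (hy.differentiableAt.hasFDerivAt.mul hy'.differentiableAt.hasFDerivAt).hasLineDerivAt
    (Pi.single a 1)
  simp only [partialDir, Pi.add_apply, Pi.mul_apply]
  rw [hy.differentiableAt.lineDeriv_eq_fderiv, hy'.differentiableAt.lineDeriv_eq_fderiv]
  rw [HasLineDerivAt.lineDeriv this]
  simp
  ring

theorem AnalyticAt.mixedPartial {f : (Fin n → ℝ) → ℂ} {x : Fin n → ℝ}
    (hf : AnalyticAt ℝ f x) (l : List (Fin n)) : AnalyticAt ℝ (mixedPartial l f) x := by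
  induction l with
  | nil => exact hf
  | cons a l ih => exact ih.partialDir a

theorem Filter.EventuallyEq.mixedPartial {f g : (Fin n → ℝ) → ℂ} {x : Fin n → ℝ}
    (h : f =ᶠ[𝓝 x] g) (l : List (Fin n)) : mixedPartial l f =ᶠ[𝓝 x] mixedPartial l g := by
  induction l with
  | nil => exact h
  | cons a l ih => exact ih.partialDir a

theorem mixedPartial_perm {f : (Fin n → ℝ) → ℂ} {x : Fin n → ℝ} (hf : AnalyticAt ℝ f x)
    {l l' : List (Fin n)} (h : l.Perm l') : mixedPartial l f =ᶠ[𝓝 x] mixedPartial l' f := by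
  induction h with
  | nil => rfl
  | cons a _ ih => exact ih.partialDir a
  | swap a b l => exact partialDir_comm (hf.mixedPartial l) b a
  | trans _ _ ih ih' => exact ih.trans ih'

theorem mixedPartial_partialDir {f : (Fin n → ℝ) → ℂ} {x : Fin n → ℝ} (hf : AnalyticAt ℝ f x)
    (a : Fin n) (l : List (Fin n)) :
    mixedPartial l (partialDir a f) =ᶠ[𝓝 x] mixedPartial (a :: l) f := by
  -- `foldr` applies the last entry of the list first, so a derivative already taken of `f` sits at
  -- the end.
  have : mixedPartial l (partialDir a f) = mixedPartial (l ++ [a]) f := by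
    simp only [mixedPartial, List.foldr_append, List.foldr_cons, List.foldr_nil]
    rfl
  rw [this]
  exact mixedPartial_perm hf (by simp)

theorem partialDir_add {f g : (Fin n → ℝ) → ℂ} {x : Fin n → ℝ} (hf : AnalyticAt ℝ f x)
    (hg : AnalyticAt ℝ g x) (a : Fin n) :
    partialDir a (f + g) =ᶠ[𝓝 x] partialDir a f + partialDir a g := by
  filter_upwards [hf.eventually_analyticAt, hg.eventually_analyticAt] with y hy hy'
  have := (hy.differentiableAt.hasFDerivAt.add hy'.differentiableAt.hasFDerivAt).hasLineDerivAt
    (Pi.single a 1)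
  simp only [partialDir, Pi.add_apply]
  rw [hy.differentiableAt.lineDeriv_eq_fderiv, hy'.differentiableAt.lineDeriv_eq_fderiv]
  rw [HasLineDerivAt.lineDeriv this]
  simp

theorem mixedPartial_add {f g : (Fin n → ℝ) → ℂ} {x : Fin n → ℝ} (hf : AnalyticAt ℝ f x)
    (hg : AnalyticAt ℝ g x) (l : List (Fin n)) :
    mixedPartial l (f + g) =ᶠ[𝓝 x] mixedPartial l f + mixedPartial l g := by
  induction l with
  | nil => rfl
  | cons a l ih =>
    exact (ih.partialDir a).trans (partialDir_add (hf.mixedPartial l) (hg.mixedPartial l) a)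

/-- The mixed partial derivative in the directions of a finite set of coordinates. -/
def setPartial (S : Finset (Fin n)) (f : (Fin n → ℝ) → ℂ) (x : Fin n → ℝ) : ℂ :=
  mixedPartial (S.sort (· ≤ ·)) f x

theorem sort_insert_perm {a : Fin n} {S : Finset (Fin n)} (ha : a ∉ S) :
    ((insert a S).sort (· ≤ ·)).Perm (a :: S.sort (· ≤ ·)) := by
  rw [← Multiset.coe_eq_coe, ← Multiset.cons_coe, Finset.sort_eq, Finset.sort_eq,
    Finset.insert_val_of_notMem ha]

/-- Taking the new derivative innermost allows induction on `S` with the function generalized; the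
sorted list in the definition only fixes an order that is immaterial at analytic points. -/
theorem setPartial_insert {f : (Fin n → ℝ) → ℂ} {x : Fin n → ℝ} (hf : AnalyticAt ℝ f x)
    {a : Fin n} {S : Finset (Fin n)} (ha : a ∉ S) :
    setPartial (insert a S) f x = setPartial S (partialDir a f) x :=
  ((mixedPartial_perm hf (sort_insert_perm ha)).trans
    (mixedPartial_partialDir hf a _).symm).self_of_nhds

theorem setPartial_congr {f g : (Fin n → ℝ) → ℂ} {x : Fin n → ℝ} (h : f =ᶠ[𝓝 x] g)
    (S : Finset (Fin n)) : setPartial S f x = setPartial S g x :=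
  (h.mixedPartial _).self_of_nhds

theorem setPartial_empty (f : (Fin n → ℝ) → ℂ) (x : Fin n → ℝ) : setPartial ∅ f x = f x := by
  simp [setPartial, mixedPartial]

/-- The Leibniz rule for mixed partial derivatives. -/
theorem setPartial_mul {x : Fin n → ℝ} (S : Finset (Fin n)) {f g : (Fin n → ℝ) → ℂ}
    (hf : AnalyticAt ℝ f x) (hg : AnalyticAt ℝ g x) :
    setPartial S (f * g) x = ∑ T ∈ S.powerset, setPartial T f x * setPartial (S \ T) g x := by
  induction S using Finset.induction_on generalizing f g with
  | empty => simp [setPartial_empty]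
  | insert a S ha ih =>
    rw [setPartial_insert (hf.mul hg) ha, setPartial_congr (partialDir_mul hf hg a),
      Finset.sum_powerset_insert ha]
    have hadd := (mixedPartial_add ((hf.partialDir a).mul hg) (hf.mul (hg.partialDir a))
      (S.sort (· ≤ ·))).self_of_nhds
    have hadd' : setPartial S (partialDir a f * g + f * partialDir a g) x =
      setPartial S (partialDir a f * g) x + setPartial S (f * partialDir a g) x := hadd
    rw [hadd', ih (hf.partialDir a) hg, ih hf (hg.partialDir a), add_comm]
    congr 1
    · refine Finset.sum_congr rfl fun T hT => ?_
      have haT : a ∉ T := fun h => ha (Finset.mem_powerset.1 hT h)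
      have : insert a S \ T = insert a (S \ T) := Finset.insert_sdiff_of_notMem _ haT
      rw [this, setPartial_insert hg (by simp [ha])]
    · refine Finset.sum_congr rfl fun T hT => ?_
      have haT : a ∉ T := fun h => ha (Finset.mem_powerset.1 hT h)
      have : insert a S \ insert a T = S \ T := by
        ext b; simp only [Finset.mem_sdiff, Finset.mem_insert]
        by_cases hb : b = a
        · subst hb; simp [ha]
        · simp [hb]
      rw [this, setPartial_insert hf haT]

end MixedPartials

/-! ### Cumulants and the linked cluster recursion. -/

section Cumulants

variable {n : ℕ}

/-- The moment generating function `1 + ∑_{P ≠ ∅} λ(P) m(P)`. -/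
def momentGen (m : Finset (Fin n) → ℂ) (lam : Fin n → ℝ) : ℂ :=
  1 + ∑ P ∈ (Finset.univ : Finset (Finset (Fin n))).erase ∅, ((∏ i ∈ P, lam i : ℝ) : ℂ) * m P

/-- The cumulant of the labels `S`, for the moments `m`. -/
def cumulant (m : Finset (Fin n) → ℂ) (S : Finset (Fin n)) : ℂ :=
  setPartial S (fun lam => Complex.log (momentGen m lam)) 0

theorem truncatedCorr_eq_cumulant {F : Type*} [Fintype F] [DecidableEq F] (A : Matrix F F ℂ)
    (β : ℝ) (O : Fin n → Matrix F F ℂ) (t : Fin n → ℝ) :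
    truncatedCorr A β O t =
      cumulant (fun P => gibbsAvg A β (timeOrderedProd A O t P)) Finset.univ := by
  have : (Finset.univ : Finset (Fin n)).sort (· ≤ ·) = List.finRange n := Fin.sort_univ n
  simp only [truncatedCorr, cumulant, setPartial, this]
  rfl

theorem cumulant_congr {m m' : Finset (Fin n) → ℂ} (h : ∀ P, P ≠ ∅ → m P = m' P) :
    cumulant m = cumulant m' := by
  have : momentGen m = momentGen m' := by
    funext lam
    unfold momentGen
    congr 1
    refine Finset.sum_congr rfl fun P hP => ?_
    rw [h P (Finset.ne_of_mem_erase hP)]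
  unfold cumulant
  rw [this]

/-- The polynomial `∑_{P ⊇ S} λ(P ∖ S) m(P)`. -/
def shiftedGen (m : Finset (Fin n) → ℂ) (S : Finset (Fin n)) (lam : Fin n → ℝ) : ℂ :=
  ∑ P ∈ Finset.univ.filter (S ⊆ ·), ((∏ i ∈ P \ S, lam i : ℝ) : ℂ) * m P

theorem analyticAt_shiftedGen (m : Finset (Fin n) → ℂ) (S : Finset (Fin n)) (x : Fin n → ℝ) :
    AnalyticAt ℝ (shiftedGen m S) x := by
  unfold shiftedGen
  refine Finset.analyticAt_fun_sum _ fun P _ => AnalyticAt.mul ?_ analyticAt_const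
  refine (Complex.ofRealCLM.analyticAt _).comp ?_
  refine Finset.analyticAt_fun_prod _ fun i _ => ?_
  exact (ContinuousLinearMap.proj (R := ℝ) (φ := fun _ : Fin n => ℝ) i).analyticAt x

theorem hasLineDerivAt_prod (Q : Finset (Fin n)) (a : Fin n) (x : Fin n → ℝ) :
    HasLineDerivAt ℝ (fun lam : Fin n → ℝ => ((∏ i ∈ Q, lam i : ℝ) : ℂ))
      (if a ∈ Q then ((∏ i ∈ Q.erase a, x i : ℝ) : ℂ) else 0) x (Pi.single a 1) := by
  unfold HasLineDerivAt
  split_ifs with h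
  · have : (fun t : ℝ => ((∏ i ∈ Q, (x + t • (Pi.single a 1 : Fin n → ℝ)) i : ℝ) : ℂ)) =
        fun t : ℝ => (((x a + t) * ∏ i ∈ Q.erase a, x i : ℝ) : ℂ) := by
      funext t
      rw [← Finset.mul_prod_erase _ _ h]
      congr 2
      · simp
      · refine Finset.prod_congr rfl fun i hi => ?_
        simp [Finset.ne_of_mem_erase hi]
    rw [this]
    have h1 : HasDerivAt (fun t : ℝ => (x a + t) * ∏ i ∈ Q.erase a, x i)
        (1 * ∏ i ∈ Q.erase a, x i) 0 := ((hasDerivAt_id (0 : ℝ)).const_add (x a)).mul_const _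
    simpa using h1.ofReal_comp
  · have : (fun t : ℝ => ((∏ i ∈ Q, (x + t • (Pi.single a 1 : Fin n → ℝ)) i : ℝ) : ℂ)) =
        fun _ : ℝ => ((∏ i ∈ Q, x i : ℝ) : ℂ) := by
      funext t
      congr 1
      refine Finset.prod_congr rfl fun i hi => ?_
      have : i ≠ a := fun e => h (e ▸ hi)
      simp [this]
    rw [this]
    exact hasDerivAt_const _ _

/-- The polynomial is affine in each variable: differentiation strips λ_a from the monomials that
contain it and kills the others. -/
theorem partialDir_shiftedGen (m : Finset (Fin n) → ℂ) {S : Finset (Fin n)} {a : Fin n}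
    (ha : a ∉ S) : partialDir a (shiftedGen m S) = shiftedGen m (insert a S) := by
  funext x
  have h : HasLineDerivAt ℝ (shiftedGen m S)
      (∑ P ∈ Finset.univ.filter (S ⊆ ·),
        (if a ∈ P \ S then ((∏ i ∈ (P \ S).erase a, x i : ℝ) : ℂ) else 0) * m P) x
      (Pi.single a 1) := by
    unfold HasLineDerivAt shiftedGen
    exact HasDerivAt.fun_sum fun P _ => (hasLineDerivAt_prod (P \ S) a x).mul_const (m P)
  unfold partialDir
  rw [h.lineDeriv]
  unfold shiftedGen
  rw [← Finset.sum_filter_add_sum_filter_not (Finset.univ.filter (S ⊆ ·)) (a ∈ ·)]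
  rw [Finset.filter_filter]
  have h2 : ∀ P ∈ (Finset.univ.filter (S ⊆ ·)).filter (fun P => ¬ a ∈ P),
      (if a ∈ P \ S then ((∏ i ∈ (P \ S).erase a, x i : ℝ) : ℂ) else 0) * m P = 0 := by
    intro P hP
    have := (Finset.mem_filter.1 hP).2
    simp [this]
  rw [Finset.sum_eq_zero h2, add_zero]
  have h3 : Finset.univ.filter (fun P => S ⊆ P ∧ a ∈ P) =
      (Finset.univ : Finset (Finset (Fin n))).filter (insert a S ⊆ ·) := by
    ext P; simp [Finset.insert_subset_iff, and_comm]
  rw [h3]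
  refine Finset.sum_congr rfl fun P hP => ?_
  have : a ∈ P := (Finset.mem_filter.1 hP).2 (Finset.mem_insert_self _ _)
  rw [if_pos (by simp [this, ha])]
  congr 4
  ext b; simp only [Finset.mem_erase, Finset.mem_sdiff, Finset.mem_insert]; tauto

/-- Each derivative moves a label into the second argument, and at λ = 0 only the constant term is
left. With `T = ∅` this reads the moments off the generating polynomial. -/
theorem setPartial_shiftedGen (m : Finset (Fin n) → ℂ) (S T : Finset (Fin n))
    (h : Disjoint S T) : setPartial S (shiftedGen m T) 0 = m (S ∪ T) := by
  induction S using Finset.induction_on generalizing T with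
  | empty =>
    rw [setPartial_empty, shiftedGen, Finset.empty_union]
    rw [Finset.sum_eq_single_of_mem T (by simp)]
    · simp
    · intro P hP hPT
      have hne : (P \ T).Nonempty := by
        rw [Finset.nonempty_iff_ne_empty]
        intro he
        exact hPT (Finset.Subset.antisymm (Finset.sdiff_eq_empty_iff_subset.1 he)
          (Finset.mem_filter.1 hP).2)
      obtain ⟨i, hi⟩ := hne
      rw [Finset.prod_eq_zero hi (by simp)]
      simp
  | insert a S ha ih =>
    have haT : a ∉ T := Finset.disjoint_left.1 h (Finset.mem_insert_self _ _)
    have hST : Disjoint S T := h.mono_left (Finset.subset_insert _ _)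
    rw [setPartial_insert (analyticAt_shiftedGen m T 0) ha, partialDir_shiftedGen m haT,
      ih (insert a T) (Finset.disjoint_insert_right.2 ⟨ha, hST⟩)]
    congr 1
    ext b; simp only [Finset.mem_union, Finset.mem_insert]; tauto

theorem momentGen_eq_shiftedGen {m : Finset (Fin n) → ℂ} (hm : m ∅ = 1) :
    momentGen m = shiftedGen m ∅ := by
  funext x
  have : (Finset.univ : Finset (Finset (Fin n))).filter (∅ ⊆ ·) = Finset.univ := by simp
  rw [shiftedGen, this, ← Finset.add_sum_erase _ _ (Finset.mem_univ ∅), momentGen]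
  simp [hm]

/-- `κ` are the cumulants of the moments `m`: the linked cluster recursion, where `a` is a marked
label. -/
def IsCumulant {ι : Type*} [DecidableEq ι] (m κ : Finset ι → ℂ) : Prop :=
  ∀ (S : Finset ι) (a : ι), a ∉ S →
    m (insert a S) = ∑ T ∈ S.powerset, κ (insert a T) * m (S \ T)

/-- For the generating polynomial G, ∂_a G = (∂_a log G) · G near 0, where G is close to 1 and the
principal logarithm is analytic. Applying ∂_S and the Leibniz rule gives the recursion. -/
theorem isCumulant_cumulant {m : Finset (Fin n) → ℂ} (hm : m ∅ = 1) :
    IsCumulant m (cumulant m) := by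
  intro S a ha
  have hF : AnalyticAt ℝ (momentGen m) 0 := by
    rw [momentGen_eq_shiftedGen hm]; exact analyticAt_shiftedGen m ∅ 0
  have hF0 : momentGen m 0 = 1 := by
    rw [momentGen_eq_shiftedGen hm, ← setPartial_empty (shiftedGen m ∅) 0,
      setPartial_shiftedGen m ∅ ∅ (by simp)]
    simpa using hm
  have hslit : momentGen m 0 ∈ Complex.slitPlane := by rw [hF0]; simp
  have hG : AnalyticAt ℝ (fun lam => Complex.log (momentGen m lam)) 0 := by
    have h1 : AnalyticAt ℝ Complex.log (momentGen m 0) :=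
      (analyticAt_clog hslit).restrictScalars
    exact h1.comp hF
  have hD : partialDir a (momentGen m) =ᶠ[𝓝 0]
      partialDir a (fun lam => Complex.log (momentGen m lam)) * momentGen m := by
    have hopen : ∀ᶠ y in 𝓝 (0 : Fin n → ℝ), momentGen m y ∈ Complex.slitPlane :=
      hF.continuousAt.eventually (Complex.isOpen_slitPlane.mem_nhds hslit)
    filter_upwards [hF.eventually_analyticAt, hopen] with y hy hys
    have h1 := hy.differentiableAt.lineDifferentiableAt (v := Pi.single a 1) |>.hasLineDerivAt
    have h2 : HasLineDerivAt ℝ (fun lam => Complex.log (momentGen m lam))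
        (lineDeriv ℝ (momentGen m) y (Pi.single a 1) / momentGen m y) y (Pi.single a 1) := by
      unfold HasLineDerivAt at h1 ⊢
      have := h1.clog_real (by simpa using hys)
      simpa using this
    simp only [Pi.mul_apply, partialDir]
    rw [h2.lineDeriv, div_mul_cancel₀ _ (Complex.slitPlane_ne_zero hys)]
  have h1 : m (insert a S) = setPartial S (partialDir a (momentGen m)) 0 := by
    rw [← setPartial_insert hF ha, momentGen_eq_shiftedGen hm,
      setPartial_shiftedGen m _ ∅ (by simp), Finset.union_empty]
  rw [h1, setPartial_congr hD, setPartial_mul S (hG.partialDir a) hF]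
  refine Finset.sum_congr rfl fun T hT => ?_
  have haT : a ∉ T := fun h => ha (Finset.mem_powerset.1 hT h)
  rw [← setPartial_insert hG haT]
  congr 1
  rw [momentGen_eq_shiftedGen hm, setPartial_shiftedGen m _ ∅ (by simp), Finset.union_empty]

end Cumulants
end

noncomputable section

/-! ### Consequences of the linked cluster recursion. -/

theorem insert_ssubset_insert_of_ssubset {ι : Type*} [DecidableEq ι] {a : ι} {S T : Finset ι}
    (ha : a ∉ S) (h : T ⊂ S) : insert a T ⊂ insert a S := by
  refine Finset.ssubset_iff_subset_ne.2 ⟨Finset.insert_subset_insert _ h.subset, fun e => h.ne ?_⟩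
  have haT : a ∉ T := fun h' => ha (h.subset h')
  rw [← Finset.erase_insert haT, e, Finset.erase_insert ha]

namespace IsCumulant

variable {ι : Type*} [DecidableEq ι]

/-- In the recursion for `insert a R` the top cumulant has coefficient `m ∅ = 1`, and all others
belong to smaller sets, so moments determine cumulants triangularly. The empty set is excluded
because `κ ∅` never enters the recursion. -/
theorem eq_of_subset {m m' κ κ' : Finset ι → ℂ} (hm : m ∅ = 1) (h : IsCumulant m κ)
    (h' : IsCumulant m' κ') (S : Finset ι) (hS : S.Nonempty) (hmm : ∀ P ⊆ S, m P = m' P) :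
    κ S = κ' S := by
  induction S using Finset.strongInduction with
  | H S ih =>
    obtain ⟨a, ha⟩ := hS
    obtain ⟨R, haR, rfl⟩ : ∃ R, a ∉ R ∧ insert a R = S :=
      ⟨S.erase a, Finset.notMem_erase _ _, Finset.insert_erase ha⟩
    have e1 := h R a haR
    rw [hmm _ subset_rfl, h' R a haR, ← Finset.add_sum_erase _ _ (Finset.mem_powerset_self R),
      ← Finset.add_sum_erase _ _ (Finset.mem_powerset_self R)] at e1
    have e2 : ∑ T ∈ R.powerset.erase R, κ' (insert a T) * m' (R \ T) =
        ∑ T ∈ R.powerset.erase R, κ (insert a T) * m (R \ T) := by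
      refine Finset.sum_congr rfl fun T hT => ?_
      obtain ⟨hTR, hT⟩ := Finset.mem_erase.1 hT
      have hss : T ⊂ R := lt_of_le_of_ne (Finset.mem_powerset.1 hT) hTR
      have hss' : insert a T ⊂ insert a R := insert_ssubset_insert_of_ssubset haR hss
      rw [ih (insert a T) hss' (Finset.insert_nonempty _ _) fun P hP =>
        hmm P (hP.trans hss'.subset), hmm (R \ T) (Finset.sdiff_subset.trans
          (Finset.subset_insert _ _))]
    have hm' : m' ∅ = 1 := by rw [← hmm ∅ (Finset.empty_subset _), hm]
    rw [e2, add_left_inj] at e1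
    simpa [hm, hm'] using e1.symm

theorem unique {m κ κ' : Finset ι → ℂ} (hm : m ∅ = 1) (h : IsCumulant m κ)
    (h' : IsCumulant m κ') (S : Finset ι) (hS : S.Nonempty) : κ S = κ' S :=
  eq_of_subset hm h h' S hS fun _ _ => rfl

theorem insert_eq_sub {m κ : Finset ι → ℂ} (hm : m ∅ = 1) (h : IsCumulant m κ) {S : Finset ι}
    {a : ι} (ha : a ∉ S) :
    κ (insert a S) = m (insert a S) - ∑ T ∈ S.powerset.erase S, κ (insert a T) * m (S \ T) := by
  rw [h S a ha, ← Finset.add_sum_erase _ _ (Finset.mem_powerset_self S)]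
  simp [hm]

theorem scale {m κ : Finset ι → ℂ} (h : IsCumulant m κ) (c : ι → ℂ) :
    IsCumulant (fun S => (∏ i ∈ S, c i) * m S) (fun S => (∏ i ∈ S, c i) * κ S) := by
  intro S a ha
  simp only
  rw [h S a ha, Finset.mul_sum]
  refine Finset.sum_congr rfl fun T hT => ?_
  have hTS := Finset.mem_powerset.1 hT
  rw [Finset.prod_insert ha, Finset.prod_insert (fun h => ha (hTS h)),
    ← Finset.prod_sdiff hTS]
  ring

/-- Cumulants inherit the symmetries of the moments. -/
theorem eq_prod_mul {m κ : Finset ι → ℂ} (hm : m ∅ = 1) (h : IsCumulant m κ) (c : ι → ℂ)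
    (hc : ∀ S, m S = (∏ i ∈ S, c i) * m S) (S : Finset ι) (hS : S.Nonempty) :
    κ S = (∏ i ∈ S, c i) * κ S := by
  have h' := h.scale c
  have : (fun S => (∏ i ∈ S, c i) * m S) = m := funext fun S => (hc S).symm
  rw [this] at h'
  exact unique hm h h' S hS

theorem comap {ι' : Type*} [DecidableEq ι'] {m κ : Finset ι → ℂ} (h : IsCumulant m κ)
    (e : ι' ↪ ι) : IsCumulant (fun S => m (S.map e)) (fun S => κ (S.map e)) := by
  intro S a ha
  simp only [Finset.map_insert]
  rw [h (S.map e) (e a) (by simpa using ha)]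
  symm
  refine Finset.sum_bij (fun T _ => T.map e) ?_ ?_ ?_ ?_
  · intro T hT
    exact Finset.mem_powerset.2 (Finset.map_subset_map.2 (Finset.mem_powerset.1 hT))
  · intro T _ T' _ hTT'
    exact Finset.map_injective e hTT'
  · intro T hT
    obtain ⟨U, hU, rfl⟩ := Finset.subset_map_iff.1 (Finset.mem_powerset.1 hT)
    exact ⟨U, Finset.mem_powerset.2 hU, rfl⟩
  · intro T hT
    congr 2
    ext b
    simp only [Finset.mem_map, Finset.mem_sdiff]
    constructor
    · rintro ⟨x, ⟨hx, hxT⟩, rfl⟩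
      exact ⟨⟨x, hx, rfl⟩, fun ⟨y, hy, hyx⟩ => hxT (e.injective hyx ▸ hy)⟩
    · rintro ⟨⟨x, hx, rfl⟩, hx'⟩
      exact ⟨x, ⟨hx, fun hxT => hx' ⟨x, hxT, rfl⟩⟩, rfl⟩

/-- The moments with two marked labels `y`, `z`, in terms of cumulants. -/
theorem insert_insert {m κ : Finset ι → ℂ} (h : IsCumulant m κ) {S : Finset ι} {y z : ι}
    (hyz : y ≠ z) (hy : y ∉ S) (hz : z ∉ S) :
    m (insert y (insert z S)) = ∑ A ∈ S.powerset, (κ (insert y (insert z A)) +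
      ∑ B ∈ A.powerset, κ (insert y B) * κ (insert z (A \ B))) * m (S \ A) := by
  -- The cluster of `y` either contains `z`, giving the joint cumulant, or leaves `z` in the moment
  -- factor, which is then expanded with `z` marked.
  rw [h (insert z S) y (by simp [hyz, hy]), Finset.sum_powerset_insert hz, add_comm]
  simp_rw [add_mul, Finset.sum_add_distrib]
  congr 1
  · refine Finset.sum_congr rfl fun T hT => ?_
    congr 2
    ext b; simp only [Finset.mem_sdiff, Finset.mem_insert]
    by_cases hb : b = z
    · subst hb; simp [hz]
    · simp [hb]
  · have h1 : ∀ T ∈ S.powerset, κ (insert y T) * m (insert z S \ T) =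
        ∑ B ∈ (S \ T).powerset, κ (insert y T) * κ (insert z B) * m ((S \ T) \ B) := by
      intro T hT
      have hzT : z ∉ T := fun h => hz (Finset.mem_powerset.1 hT h)
      rw [Finset.insert_sdiff_of_notMem _ hzT, h (S \ T) z (by simp [hz]), Finset.mul_sum]
      simp only [mul_assoc]
    rw [Finset.sum_congr rfl h1]
    simp_rw [Finset.sum_mul]
    rw [Finset.sum_sigma', Finset.sum_sigma']
    -- Disjoint parts `T` (with `y`) and `B` (with `z`) are encoded by their union and its subset
    -- `T`.
    refine Finset.sum_bij' (fun p _ => ⟨p.1 ∪ p.2, p.1⟩) (fun p _ => ⟨p.2, p.1 \ p.2⟩)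
      ?_ ?_ ?_ ?_ ?_
    · rintro ⟨T, B⟩ hp
      simp only [Finset.mem_sigma, Finset.mem_powerset] at hp ⊢
      exact ⟨Finset.union_subset hp.1 (hp.2.trans Finset.sdiff_subset), Finset.subset_union_left⟩
    · rintro ⟨A, B⟩ hp
      simp only [Finset.mem_sigma, Finset.mem_powerset] at hp ⊢
      exact ⟨hp.2.trans hp.1, Finset.sdiff_subset_sdiff hp.1 subset_rfl⟩
    · rintro ⟨T, B⟩ hp
      simp only [Finset.mem_sigma, Finset.mem_powerset] at hp
      have hd : Disjoint B T := Finset.disjoint_left.2 fun b hb hbT =>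
        (Finset.mem_sdiff.1 (hp.2 hb)).2 hbT
      simp only [Finset.union_sdiff_left]
      rw [Finset.sdiff_eq_self_of_disjoint hd]
    · rintro ⟨A, B⟩ hp
      simp only [Finset.mem_sigma, Finset.mem_powerset] at hp
      simp only [Finset.union_sdiff_of_subset hp.2]
    · rintro ⟨T, B⟩ hp
      simp only [Finset.mem_sigma, Finset.mem_powerset] at hp
      have hd : Disjoint B T := Finset.disjoint_left.2 fun b hb hbT =>
        (Finset.mem_sdiff.1 (hp.2 hb)).2 hbT
      simp only [Finset.union_sdiff_left]
      rw [Finset.sdiff_eq_self_of_disjoint hd, sdiff_sdiff_left]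
      rfl

end IsCumulant

/-! ### From identities between moments to identities between cumulants. -/

section Convolution

variable {ι : Type*} [DecidableEq ι]

/-- Deconvolution of a convergent family of set functions. -/
theorem hasSum_of_hasSum_conv {Q : Type*} {M : Finset ι → ℂ} (hM : M ∅ = 1) {R : Finset ι}
    {X W : Q → Finset ι → ℂ} {x w : Finset ι → ℂ}
    (hX : ∀ q, ∀ S ⊆ R, X q S = ∑ A ∈ S.powerset, W q A * M (S \ A))
    (hx : ∀ S ⊆ R, x S = ∑ A ∈ S.powerset, w A * M (S \ A))
    (h : ∀ S ⊆ R, HasSum (fun q => X q S) (x S)) :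
    ∀ S ⊆ R, HasSum (fun q => W q S) (w S) := by
  intro S
  induction S using Finset.strongInduction with
  | H S ih =>
    intro hS
    -- Since `M ∅ = 1`, the term `A = S` can be solved for; the remaining terms converge by
    -- induction.
    have key : ∀ (x w : Finset ι → ℂ), x S = ∑ A ∈ S.powerset, w A * M (S \ A) →
        w S = x S - ∑ A ∈ S.powerset.erase S, w A * M (S \ A) := by
      intro x w h
      rw [h, ← Finset.add_sum_erase _ _ (Finset.mem_powerset_self S)]
      simp [hM]
    rw [key x w (hx S hS), funext fun q => key (X q) (W q) (hX q S hS)]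
    refine (h S hS).sub (hasSum_sum fun A hA => HasSum.mul_right _ ?_)
    obtain ⟨hne, hA⟩ := Finset.mem_erase.1 hA
    have hAS := Finset.mem_powerset.1 hA
    exact ih A (lt_of_le_of_ne hAS hne) (hAS.trans hS)

/-- If the moments satisfy `M_w(S) = ∑_q ∑_l c_l(q) M^{q,l}_{yz}(S)`, then the cumulants satisfy the
same equation up to the products of cumulants which separate `y` from `z`. -/
theorem hasSum_cumulant_of_hasSum_moment {Q Λ : Type*} [Fintype Λ] {M0 Mw Kw : Finset ι → ℂ}
    {M K : Q → Λ → Finset ι → ℂ} {c : Q → Λ → ℂ} {R : Finset ι} {y z : ι} (hyz : y ≠ z)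
    (hy : y ∉ R) (hz : z ∉ R) (hM0 : M0 ∅ = 1) (hw : IsCumulant Mw Kw)
    (hM : ∀ q l, IsCumulant (M q l) (K q l)) (hMw0 : ∀ S ⊆ R, Mw S = M0 S)
    (hMM0 : ∀ q l, ∀ S ⊆ R, M q l S = M0 S)
    (h : ∀ S ⊆ R, HasSum (fun q => ∑ l, c q l * M q l (insert y (insert z S)))
      (Mw (insert z S))) :
    ∀ S ⊆ R, HasSum (fun q => ∑ l, c q l * (K q l (insert y (insert z S)) +
      ∑ B ∈ S.powerset, K q l (insert y B) * K q l (insert z (S \ B)))) (Kw (insert z S)) := by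
  -- Both sides are convolutions with the moments `M0` of the unmarked labels, which do not depend
  -- on `q` or `l`; deconvolution removes them.
  refine hasSum_of_hasSum_conv (M := M0) (w := fun S => Kw (insert z S))
    (x := fun S => Mw (insert z S)) hM0 ?_ ?_ h
  · intro q S hS
    simp_rw [Finset.sum_mul]
    rw [Finset.sum_comm]
    refine Finset.sum_congr rfl fun l _ => ?_
    rw [(hM q l).insert_insert hyz (fun h => hy (hS h)) (fun h => hz (hS h)), Finset.mul_sum]
    refine Finset.sum_congr rfl fun A _ => ?_
    rw [hMM0 q l (S \ A) (Finset.sdiff_subset.trans hS), mul_assoc]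
  · intro S hS
    rw [hw S z (fun h => hz (hS h))]
    refine Finset.sum_congr rfl fun A _ => ?_
    rw [hMw0 _ (Finset.sdiff_subset.trans hS)]

end Convolution
end

noncomputable section

/-! ### Time-ordered products as products along a strict total order. -/

section TimeOrdering

variable {n : ℕ}

/-- The label `a` stands to the left of the label `b` in time-ordered products: it has a later time,
or the same time and a smaller label. -/
def Precedes (t : Fin n → ℝ) (a b : Fin n) : Prop := t b < t a ∨ (t b = t a ∧ a < b)

theorem Precedes.asymm {t : Fin n → ℝ} {a b : Fin n} (h : Precedes t a b) : ¬ Precedes t b a := by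
  unfold Precedes at *
  rintro (h' | h')
  · rcases h with h | h
    · exact lt_asymm h h'
    · exact h'.ne' h.1
  · rcases h with h | h
    · exact h.ne' h'.1
    · exact lt_asymm h.2 h'.2

theorem precedes_or {t : Fin n → ℝ} {a b : Fin n} (hab : a ≠ b) :
    Precedes t a b ∨ Precedes t b a := by
  unfold Precedes
  rcases lt_trichotomy (t a) (t b) with h | h | h
  · exact Or.inr (Or.inl h)
  · rcases lt_or_gt_of_ne hab with h' | h'
    · exact Or.inl (Or.inr ⟨h.symm, h'⟩)
    · exact Or.inr (Or.inr ⟨h, h'⟩)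
  · exact Or.inl (Or.inl h)

instance (t : Fin n → ℝ) : Std.Antisymm (Precedes t) :=
  ⟨fun _ _ h h' => (h.asymm h').elim⟩

instance (t : Fin n → ℝ) : Std.Irrefl (Precedes t) :=
  ⟨fun _ h => h.asymm h⟩

open scoped Classical in
/-- The labels in `P`, in the order of the time-ordered product. -/
def timeList (t : Fin n → ℝ) (P : Finset (Fin n)) : List (Fin n) :=
  (P.sort (· ≤ ·)).insertionSort (fun i j => t j ≤ t i)

theorem mem_timeList {t : Fin n → ℝ} {P : Finset (Fin n)} {a : Fin n} :
    a ∈ timeList t P ↔ a ∈ P := by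
  unfold timeList
  rw [(List.perm_insertionSort _ _).mem_iff, Finset.mem_sort]

/-- Insertion sort is stable, so labels with equal times keep the increasing order of the sorted
list it starts from. -/
theorem pairwise_timeList (t : Fin n → ℝ) (P : Finset (Fin n)) :
    (timeList t P).Pairwise (Precedes t) := by
  classical
  have htot : Std.Total (fun i j : Fin n => t j ≤ t i) := ⟨fun a b => le_total (t b) (t a)⟩
  have htr : IsTrans (Fin n) (fun i j : Fin n => t j ≤ t i) := ⟨fun a b c h h' => h'.trans h⟩
  have hperm : (timeList t P).Perm (P.sort (· ≤ ·)) := List.perm_insertionSort _ _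
  have hnd : (timeList t P).Nodup := hperm.nodup_iff.2 (P.sort_nodup _)
  have hpw : (timeList t P).Pairwise (fun i j : Fin n => t j ≤ t i) :=
    List.pairwise_insertionSort _ _
  refine List.pairwise_of_forall_sublist fun {a b} hab => ?_
  have hne : a ≠ b := by
    have := hnd.sublist hab
    simpa using this
  have hle : t b ≤ t a := hpw.forall_sublist hab
  rcases hle.lt_or_eq with h | h
  · exact Or.inl h
  · refine Or.inr ⟨h, ?_⟩
    by_contra hlt
    have hba : b < a := lt_of_le_of_ne (not_lt.1 hlt) hne.symm
    have ha : a ∈ P := mem_timeList.1 (hab.subset (by simp))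
    have hb : b ∈ P := mem_timeList.1 (hab.subset (by simp))
    have hsub : ([b, a] : List (Fin n)).Sublist (P.sort (· ≤ ·)) := by
      refine List.sublist_of_subperm_of_pairwise (r := (· ≤ ·)) ?_ (by simp [hba.le])
        (P.pairwise_sort _)
      exact List.subperm_of_subset (by simp [hne.symm]) (by simp [List.subset_def, ha, hb])
    have hba' : ([b, a] : List (Fin n)).Sublist (timeList t P) :=
      List.pair_sublist_insertionSort (r := fun i j : Fin n => t j ≤ t i) h.ge hsub
    have hi : (timeList t P).idxOf a < (timeList t P).idxOf b := by
      have := List.pairwise_iff_forall_sublist (l := timeList t P)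
        (R := fun x y => (timeList t P).idxOf x < (timeList t P).idxOf y)
      refine this.1 ?_ hab
      rw [List.pairwise_iff_getElem]
      intro i j hi hj hij
      rwa [hnd.idxOf_getElem, hnd.idxOf_getElem]
    have hi' : (timeList t P).idxOf b < (timeList t P).idxOf a := by
      have := List.pairwise_iff_forall_sublist (l := timeList t P)
        (R := fun x y => (timeList t P).idxOf x < (timeList t P).idxOf y)
      refine this.1 ?_ hba'
      rw [List.pairwise_iff_getElem]
      intro i j hi hj hij
      rwa [hnd.idxOf_getElem, hnd.idxOf_getElem]
    exact lt_asymm hi hi'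

/-- An asymmetric order admits only one sorted list with given members. Splitting and relabelling of
time-ordered products rest on this rather than on the sorting algorithm. -/
theorem timeList_eq_of_pairwise {t : Fin n → ℝ} {P : Finset (Fin n)} {l : List (Fin n)}
    (hl : l.Pairwise (Precedes t)) (h : ∀ a, a ∈ l ↔ a ∈ P) : timeList t P = l :=
  (pairwise_timeList t P).eq_of_mem_iff hl fun a => by rw [mem_timeList, h]

theorem timeList_union {t : Fin n → ℝ} {P Q : Finset (Fin n)}
    (h : ∀ a ∈ P, ∀ b ∈ Q, Precedes t a b) :
    timeList t (P ∪ Q) = timeList t P ++ timeList t Q := by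
  refine timeList_eq_of_pairwise (List.pairwise_append.2
    ⟨pairwise_timeList t P, pairwise_timeList t Q, fun a ha b hb =>
      h a (mem_timeList.1 ha) b (mem_timeList.1 hb)⟩) fun a => ?_
  simp [mem_timeList]

/-- Monotonicity of `e` is needed to respect the breaking of ties by label. -/
theorem timeList_map {n' : ℕ} (e : Fin n' ↪ Fin n) (he : StrictMono e) (t : Fin n → ℝ)
    (P : Finset (Fin n')) : timeList t (P.map e) = (timeList (t ∘ e) P).map e := by
  refine timeList_eq_of_pairwise ?_ fun a => by simp [mem_timeList]
  rw [List.pairwise_map]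
  refine (pairwise_timeList (t ∘ e) P).imp fun {a b} h => ?_
  rcases h with h | ⟨h, hab⟩
  · exact Or.inl h
  · exact Or.inr ⟨h, he hab⟩

/-- Some label comes first in the time order. -/
theorem exists_precedes (t : Fin n → ℝ) (P : Finset (Fin n)) (hP : P.Nonempty) :
    ∃ a ∈ P, ∀ b ∈ P.erase a, Precedes t a b := by
  rcases hl : timeList t P with _ | ⟨a, l⟩
  · obtain ⟨a, ha⟩ := hP
    have := (mem_timeList (t := t)).2 ha
    rw [hl] at this
    simp at this
  · refine ⟨a, mem_timeList.1 (by rw [hl]; simp), fun b hb => ?_⟩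
    obtain ⟨hba, hb⟩ := Finset.mem_erase.1 hb
    have hb' : b ∈ timeList t P := mem_timeList.2 hb
    have hp := pairwise_timeList t P
    rw [hl] at hb' hp
    exact (List.pairwise_cons.1 hp).1 b (by simpa [hba] using hb')

/-- Induction over the time order. -/
theorem timeOrder_induction (t : Fin n → ℝ) {motive : Finset (Fin n) → Prop} (empty : motive ∅)
    (insert : ∀ a P, a ∉ P → (∀ b ∈ P, Precedes t a b) → motive P → motive (insert a P))
    (P : Finset (Fin n)) : motive P := by
  induction P using Finset.strongInduction with
  | H P ih =>
    rcases P.eq_empty_or_nonempty with rfl | hP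
    · exact empty
    · obtain ⟨a, ha, hab⟩ := exists_precedes t P hP
      have := insert a (P.erase a) (Finset.notMem_erase _ _) hab (ih _ (Finset.erase_ssubset ha))
      rwa [Finset.insert_erase ha] at this

variable {F : Type*} [Fintype F] [DecidableEq F] (A : Matrix F F ℂ)

theorem timeOrderedProd_eq (O : Fin n → Matrix F F ℂ) (t : Fin n → ℝ) (P : Finset (Fin n)) :
    timeOrderedProd A O t P = ((timeList t P).map fun i => imagEvolve A (O i) (t i)).prod := rfl

@[simp]
theorem timeOrderedProd_empty (O : Fin n → Matrix F F ℂ) (t : Fin n → ℝ) :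
    timeOrderedProd A O t ∅ = 1 := by
  simp [timeOrderedProd]

@[simp]
theorem timeOrderedProd_singleton (O : Fin n → Matrix F F ℂ) (t : Fin n → ℝ) (a : Fin n) :
    timeOrderedProd A O t {a} = imagEvolve A (O a) (t a) := by
  simp [timeOrderedProd]

theorem timeOrderedProd_union (O : Fin n → Matrix F F ℂ) {t : Fin n → ℝ} {P Q : Finset (Fin n)}
    (h : ∀ a ∈ P, ∀ b ∈ Q, Precedes t a b) :
    timeOrderedProd A O t (P ∪ Q) = timeOrderedProd A O t P * timeOrderedProd A O t Q := by
  simp only [timeOrderedProd_eq, timeList_union h, List.map_append, List.prod_append]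

theorem timeOrderedProd_insert (O : Fin n → Matrix F F ℂ) {t : Fin n → ℝ} {a : Fin n}
    {P : Finset (Fin n)} (h : ∀ b ∈ P, Precedes t a b) :
    timeOrderedProd A O t (insert a P) = imagEvolve A (O a) (t a) * timeOrderedProd A O t P := by
  rw [← timeOrderedProd_singleton, ← timeOrderedProd_union, Finset.insert_eq]
  simpa using h

theorem timeOrderedProd_map {n' : ℕ} (e : Fin n' ↪ Fin n) (he : StrictMono e)
    (O : Fin n → Matrix F F ℂ) (t : Fin n → ℝ) (P : Finset (Fin n')) :
    timeOrderedProd A (O ∘ e) (t ∘ e) P = timeOrderedProd A O t (P.map e) := by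
  simp only [timeOrderedProd_eq, timeList_map e he, List.map_map]
  rfl

theorem timeOrderedProd_congr {O O' : Fin n → Matrix F F ℂ} {t t' : Fin n → ℝ}
    (P : Finset (Fin n)) (hO : ∀ a ∈ P, O a = O' a) (ht : ∀ a ∈ P, t a = t' a) :
    timeOrderedProd A O t P = timeOrderedProd A O' t' P := by
  have : timeList t P = timeList t' P := by
    refine (timeList_eq_of_pairwise ?_ fun a => mem_timeList).symm
    refine (pairwise_timeList t P).imp_of_mem fun {a b} ha hb h => ?_
    unfold Precedes at h ⊢
    rwa [ht a (mem_timeList.1 ha), ht b (mem_timeList.1 hb)] at h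
  rw [timeOrderedProd_eq, timeOrderedProd_eq, this]
  congr 1
  refine List.map_congr_left fun a ha => ?_
  rw [hO a (mem_timeList.1 ha), ht a (mem_timeList.1 ha)]

theorem exp_smul_add (s t : ℂ) : NormedSpace.exp ((s + t) • A) =
    NormedSpace.exp (s • A) * NormedSpace.exp (t • A) := by
  rw [add_smul]
  exact Matrix.exp_add_of_commute _ _ (((Commute.refl A).smul_left s).smul_right t)

theorem exp_smul_mul_exp_neg_smul (s : ℂ) :
    NormedSpace.exp (s • A) * NormedSpace.exp (-s • A) = 1 := by
  rw [← exp_smul_add]; simp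

theorem exp_neg_smul_mul_exp_smul (s : ℂ) :
    NormedSpace.exp (-s • A) * NormedSpace.exp (s • A) = 1 := by
  rw [← exp_smul_add]; simp

theorem imagEvolve_add (O : Matrix F F ℂ) (s t : ℝ) : imagEvolve A O (t + s) =
    NormedSpace.exp ((s : ℂ) • A) * imagEvolve A O t * NormedSpace.exp (-(s : ℂ) • A) := by
  unfold imagEvolve
  have h1 : ((t + s : ℝ) : ℂ) = (s : ℂ) + t := by push_cast; ring
  have h2 : -((t + s : ℝ) : ℂ) = -(t : ℂ) + -s := by push_cast; ring
  rw [h2, h1, exp_smul_add, exp_smul_add]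
  simp only [mul_assoc]

theorem imagEvolve_mul (O O' : Matrix F F ℂ) (t : ℝ) :
    imagEvolve A (O * O') t = imagEvolve A O t * imagEvolve A O' t := by
  unfold imagEvolve
  have := exp_neg_smul_mul_exp_smul A t
  calc _ = NormedSpace.exp ((t : ℂ) • A) * O * 1 * (O' * NormedSpace.exp (-(t : ℂ) • A)) := by
        simp only [mul_assoc, one_mul]
    _ = _ := by rw [← this]; simp only [mul_assoc]

theorem timeOrderedProd_add (O : Fin n → Matrix F F ℂ) (t : Fin n → ℝ) (s : ℝ)
    (P : Finset (Fin n)) : timeOrderedProd A O (fun i => t i + s) P =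
    NormedSpace.exp ((s : ℂ) • A) * timeOrderedProd A O t P *
      NormedSpace.exp (-(s : ℂ) • A) := by
  induction P using timeOrder_induction t with
  | empty => rw [timeOrderedProd_empty, timeOrderedProd_empty, mul_one, exp_smul_mul_exp_neg_smul]
  | insert a P ha hP ih =>
    rw [timeOrderedProd_insert A O hP, timeOrderedProd_insert, ih, imagEvolve_add]
    · have := exp_neg_smul_mul_exp_smul A s
      set E := NormedSpace.exp ((s : ℂ) • A)
      set E' := NormedSpace.exp (-(s : ℂ) • A)
      calc _ = E * imagEvolve A (O a) (t a) * (E' * E) * timeOrderedProd A O t P * E' := by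
            simp only [mul_assoc]
        _ = _ := by rw [this]; simp only [mul_assoc, mul_one]
    · intro b hb
      have := hP b hb
      unfold Precedes at this ⊢
      simpa using this

theorem imagEvolve_intertwine {U O : Matrix F F ℂ} (hU : Commute U A) {c : ℂ}
    (hO : U * O = c • (O * U)) (t : ℝ) :
    U * imagEvolve A O t = c • (imagEvolve A O t * U) := by
  have h1 : ∀ z : ℂ, U * NormedSpace.exp (z • A) = NormedSpace.exp (z • A) * U := by
    intro z
    exact (hU.smul_right z).exp_right
  unfold imagEvolve
  rw [← mul_assoc, ← mul_assoc, h1, mul_assoc (NormedSpace.exp _) U O, hO]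
  simp only [mul_smul_comm, smul_mul_assoc, mul_assoc]
  rw [h1]

/-- Meant for `U` a lattice translation and `c i` the phase of the momentum carried by `O i`. -/
theorem timeOrderedProd_intertwine {U : Matrix F F ℂ} (hU : Commute U A)
    {O : Fin n → Matrix F F ℂ} {c : Fin n → ℂ} {P : Finset (Fin n)}
    (hO : ∀ i ∈ P, U * O i = c i • (O i * U)) (t : Fin n → ℝ) :
    U * timeOrderedProd A O t P = (∏ i ∈ P, c i) • (timeOrderedProd A O t P * U) := by
  induction P using timeOrder_induction t with
  | empty => simp
  | insert a P ha hP ih =>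
    rw [timeOrderedProd_insert A O hP, ← mul_assoc,
      imagEvolve_intertwine A hU (hO a (Finset.mem_insert_self _ _)), smul_mul_assoc, mul_assoc,
      ih fun i hi => hO i (Finset.mem_insert_of_mem hi), Finset.prod_insert ha, mul_smul_comm,
      smul_smul, mul_assoc]

end TimeOrdering
end

noncomputable section

open MeasureTheory

/-! ### Regularity and bounds for evolved operators. -/

section OperatorBounds

open scoped Matrix.Norms.Operator

variable {F : Type*} [Fintype F] [DecidableEq F] (A : Matrix F F ℂ)

theorem contDiff_imagEvolve (O : Matrix F F ℂ) : ContDiff ℝ 1 (imagEvolve A O) := by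
  have h : ∀ c : ℂ, ContDiff ℝ 1 (fun t : ℝ => NormedSpace.exp ((c * (t : ℂ)) • A)) := by
    intro c
    have h1 : ContDiff ℝ 1 (fun X : Matrix F F ℂ => NormedSpace.exp X) :=
      contDiff_iff_contDiffAt.2 fun X => (NormedSpace.exp_analytic (𝕂 := ℝ) X).contDiffAt
    refine h1.comp ?_
    exact (contDiff_const.mul Complex.ofRealCLM.contDiff).smul contDiff_const
  unfold imagEvolve
  have e1 := h 1
  have e2 := h (-1)
  simp only [one_mul, neg_one_mul] at e1 e2
  exact (e1.mul contDiff_const).mul e2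

theorem exists_norm_imagEvolve_le {n : ℕ} (O : Fin n → Matrix F F ℂ) (β : ℝ) :
    ∃ B : ℝ, 1 ≤ B ∧ ∀ i, ∀ s ∈ Set.Icc 0 β, ‖imagEvolve A (O i) s‖ ≤ B := by
  have h : ∀ i, ∃ B : ℝ, ∀ s ∈ Set.Icc 0 β, ‖imagEvolve A (O i) s‖ ≤ B := fun i =>
    isCompact_Icc.exists_bound_of_continuousOn (contDiff_imagEvolve A (O i)).continuous.continuousOn
  choose B hB using h
  -- The summand 1 makes the bound at least 1, so that shorter products are also bounded by the
  -- `n`-th power.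
  refine ⟨1 + ∑ i, |B i|, le_add_of_nonneg_right (Finset.sum_nonneg fun i _ => abs_nonneg _),
    fun i s hs => (hB i s hs).trans ?_⟩
  have h1 := Finset.single_le_sum (f := fun i => |B i|) (fun i _ => abs_nonneg (B i))
    (Finset.mem_univ i)
  have h2 := le_abs_self (B i)
  linarith

theorem exists_imagEvolve_lipschitz (O : Matrix F F ℂ) (β : ℝ) :
    ∃ K : ℝ, 0 ≤ K ∧ ∀ s ∈ Set.Icc 0 β, ∀ s' ∈ Set.Icc 0 β,
      ‖imagEvolve A O s - imagEvolve A O s'‖ ≤ K * |s - s'| := by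
  obtain ⟨K, hK⟩ := (contDiff_imagEvolve A O).contDiffOn.exists_lipschitzOnWith one_ne_zero
    (convex_Icc 0 β) isCompact_Icc
  refine ⟨K, K.2, fun s hs s' hs' => ?_⟩
  have := hK.dist_le_mul s hs s' hs'
  rwa [dist_eq_norm, Real.dist_eq] at this

theorem norm_timeOrderedProd_le {n : ℕ} {O : Fin n → Matrix F F ℂ} {B : ℝ} (hB1 : 1 ≤ B)
    {t : Fin n → ℝ} (hB : ∀ i, ‖imagEvolve A (O i) (t i)‖ ≤ B) (P : Finset (Fin n)) :
    ‖timeOrderedProd A O t P‖ ≤ ‖(1 : Matrix F F ℂ)‖ * B ^ n := by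
  have h : ‖timeOrderedProd A O t P‖ ≤ ‖(1 : Matrix F F ℂ)‖ * B ^ P.card := by
    induction P using timeOrder_induction t with
    | empty => simp
    | insert a P ha hP ih =>
      rw [timeOrderedProd_insert A O hP, Finset.card_insert_of_notMem ha]
      calc _ ≤ ‖imagEvolve A (O a) (t a)‖ * ‖timeOrderedProd A O t P‖ := norm_mul_le _ _
        _ ≤ B * (‖(1 : Matrix F F ℂ)‖ * B ^ P.card) := by
          gcongr
          exact hB a
        _ = _ := by ring
  refine h.trans ?_
  gcongr
  simpa using P.card_le_univ

theorem exists_norm_gibbsAvg_le (β : ℝ) :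
    ∃ C : ℝ, 0 ≤ C ∧ ∀ X, ‖gibbsAvg A β X‖ ≤ C * ‖X‖ := by
  set E := NormedSpace.exp (-(β : ℂ) • A)
  have hentry : ∀ (Y : Matrix F F ℂ) (x : F), ‖Y x x‖ ≤ ‖Y‖ := fun Y x => by
    rw [Matrix.linfty_opNorm_def]
    have h1 : ‖Y x x‖₊ ≤ ∑ y, ‖Y x y‖₊ :=
      Finset.single_le_sum (f := fun y => ‖Y x y‖₊) (fun _ _ => zero_le) (Finset.mem_univ x)
    have h2 : ∑ y, ‖Y x y‖₊ ≤ Finset.univ.sup fun i => ∑ y, ‖Y i y‖₊ :=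
      Finset.le_sup (f := fun i => ∑ y, ‖Y i y‖₊) (Finset.mem_univ x)
    exact_mod_cast h1.trans h2
  -- The partition function need not be shown nonzero: if it vanished, both sides would be 0 by the
  -- convention for division.
  refine ⟨Fintype.card F * ‖E‖ / ‖Matrix.trace E‖, by positivity, fun X => ?_⟩
  have h1 : ‖Matrix.trace (E * X)‖ ≤ Fintype.card F * (‖E‖ * ‖X‖) := by
    refine (norm_sum_le _ _).trans ?_
    rw [← nsmul_eq_mul, ← Finset.card_univ]
    exact Finset.sum_le_card_nsmul _ _ _ fun x _ => (hentry _ x).trans (norm_mul_le _ _)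
  unfold gibbsAvg
  rw [norm_div, div_mul_eq_mul_div, mul_assoc]
  gcongr

end OperatorBounds

/-! ### Linearity, cyclicity and symmetries of the Gibbs state. -/

section GibbsLinear

variable {F : Type*} [Fintype F] [DecidableEq F] (A : Matrix F F ℂ) (β : ℝ)

theorem gibbsAvg_smul (c : ℂ) (X : Matrix F F ℂ) :
    gibbsAvg A β (c • X) = c * gibbsAvg A β X := by
  simp [gibbsAvg, mul_div_assoc]

theorem gibbsAvg_sub (X Y : Matrix F F ℂ) :
    gibbsAvg A β (X - Y) = gibbsAvg A β X - gibbsAvg A β Y := by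
  simp [gibbsAvg, mul_sub, Matrix.trace_sub, sub_div]

theorem gibbsAvg_sum {κ : Type*} (s : Finset κ) (X : κ → Matrix F F ℂ) :
    gibbsAvg A β (∑ l ∈ s, X l) = ∑ l ∈ s, gibbsAvg A β (X l) := by
  simp [gibbsAvg, Finset.mul_sum, Matrix.trace_sum, Finset.sum_div]

/-- The Kubo–Martin–Schwinger condition: moving the left factor of a product to the right and
shifting its time by `β`. -/
theorem gibbsAvg_shift_cyclic (X Y : Matrix F F ℂ) (s : ℝ) :
    gibbsAvg A β ((NormedSpace.exp ((s : ℂ) • A) * Y * NormedSpace.exp (-(s : ℂ) • A)) *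
      (NormedSpace.exp (((s - β : ℝ) : ℂ) • A) * X *
        NormedSpace.exp (-((s - β : ℝ) : ℂ) • A))) = gibbsAvg A β (X * Y) := by
  unfold gibbsAvg
  congr 1
  have h1 : NormedSpace.exp (-(s : ℂ) • A) * NormedSpace.exp (((s - β : ℝ) : ℂ) • A) =
      NormedSpace.exp (-(β : ℂ) • A) := by
    rw [← exp_smul_add]; congr 2; push_cast; ring
  have h2 : NormedSpace.exp (-((s - β : ℝ) : ℂ) • A) * (NormedSpace.exp (-(β : ℂ) • A) *
      NormedSpace.exp ((s : ℂ) • A)) = 1 := by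
    rw [← exp_smul_add, ← exp_smul_add]
    have : (-((s - β : ℝ) : ℂ) + (-(β : ℂ) + s)) = 0 := by push_cast; ring
    rw [this]; simp
  set E := NormedSpace.exp ((s : ℂ) • A)
  set E' := NormedSpace.exp (-(s : ℂ) • A)
  set D := NormedSpace.exp (((s - β : ℝ) : ℂ) • A)
  set D' := NormedSpace.exp (-((s - β : ℝ) : ℂ) • A)
  set G := NormedSpace.exp (-(β : ℂ) • A)
  calc Matrix.trace (G * (E * Y * E' * (D * X * D')))
      = Matrix.trace ((G * E * Y * (E' * D) * X) * D') := by simp only [mul_assoc]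
    _ = Matrix.trace (D' * (G * E) * Y * (E' * D) * X) := by
        rw [Matrix.trace_mul_comm]; simp only [mul_assoc]
    _ = Matrix.trace (Y * G * X) := by rw [h1, h2, one_mul]
    _ = Matrix.trace (G * (X * Y)) := by rw [mul_assoc, Matrix.trace_mul_comm, mul_assoc]

/-- Conjugation by `U` fixes the Gibbs weight and the trace, and multiplies `X` by `c`. For `c ≠ 1`
the average must vanish. -/
theorem gibbsAvg_intertwine {U V : Matrix F F ℂ} (hU : Commute U A) (hUV : V * U = 1)
    {X : Matrix F F ℂ} {c : ℂ} (h : U * X = c • (X * U)) :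
    gibbsAvg A β X = c * gibbsAvg A β X := by
  have hUV' : U * V = 1 := mul_eq_one_comm.1 hUV
  have h1 : U * NormedSpace.exp (-(β : ℂ) • A) = NormedSpace.exp (-(β : ℂ) • A) * U :=
    (hU.smul_right _).exp_right
  rw [← gibbsAvg_smul]
  unfold gibbsAvg
  congr 1
  have h2 : c • X = U * X * V := by
    rw [h, smul_mul_assoc, mul_assoc, hUV', mul_one]
  rw [h2]
  calc Matrix.trace (NormedSpace.exp (-(β : ℂ) • A) * X)
      = Matrix.trace (V * U * NormedSpace.exp (-(β : ℂ) • A) * X) := by rw [hUV, one_mul]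
    _ = Matrix.trace (V * (NormedSpace.exp (-(β : ℂ) • A) * U * X)) := by
        rw [mul_assoc V, h1, mul_assoc]
    _ = _ := by rw [Matrix.trace_mul_comm]; simp only [mul_assoc]

end GibbsLinear

/-! ### Representatives of imaginary times on the circle of length `β`. -/

section CircleRep

variable {β : ℝ} [hβ : Fact (0 < β)]

/-- The representative in `[0, β)` of a point of the circle of length `β`. -/
def circleRep (x : AddCircle β) : ℝ := (AddCircle.equivIco β 0 x : ℝ)

theorem circleRep_mem (x : AddCircle β) : circleRep x ∈ Set.Ico 0 β := by
  have h : circleRep x ∈ Set.Ico 0 (0 + β) := (AddCircle.equivIco β 0 x).2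
  rwa [zero_add] at h

theorem circleRep_mem_Icc (x : AddCircle β) : circleRep x ∈ Set.Icc 0 β :=
  Set.Ico_subset_Icc_self (circleRep_mem x)

theorem coe_circleRep (x : AddCircle β) : (circleRep x : AddCircle β) = x :=
  AddCircle.coe_equivIco

theorem circleRep_coe {s : ℝ} (hs : s ∈ Set.Ico 0 β) : circleRep (s : AddCircle β) = s := by
  unfold circleRep
  rw [AddCircle.equivIco_coe_eq (by simpa using hs)]

theorem circleRep_injective : Function.Injective (circleRep (β := β)) := fun x y h => by
  rw [← coe_circleRep x, h, coe_circleRep]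

theorem circleRep_add_of_lt {x : AddCircle β} {s : ℝ} (hs : 0 ≤ s) (h : circleRep x + s < β) :
    circleRep (x + (s : AddCircle β)) = circleRep x + s := by
  conv_lhs => rw [← coe_circleRep x, ← AddCircle.coe_add]
  exact circleRep_coe ⟨add_nonneg (circleRep_mem x).1 hs, h⟩

theorem circleRep_add_of_le {x : AddCircle β} {s : ℝ} (hs : s < β) (h : β ≤ circleRep x + s) :
    circleRep (x + (s : AddCircle β)) = circleRep x + (s - β) := by
  have : x + (s : AddCircle β) = ((circleRep x + (s - β) : ℝ) : AddCircle β) := by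
    conv_lhs => rw [← coe_circleRep x]
    rw [← AddCircle.coe_add, ← add_sub_assoc, AddCircle.coe_sub, AddCircle.coe_period, sub_zero]
  rw [this]
  have := (circleRep_mem x).2
  exact circleRep_coe ⟨by linarith, by linarith⟩

theorem measurable_circleRep : Measurable (circleRep (β := β)) :=
  measurable_subtype_coe.comp (AddCircle.measurableEquivIco β 0).measurable

end CircleRep

/-! ### Moments as functions on the time circle. -/

section CircleMoment

variable {β : ℝ} [hβ : Fact (0 < β)] {n : ℕ} {F : Type*} [Fintype F] [DecidableEq F]
  (A : Matrix F F ℂ)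

/-- The time-ordered moments at times on the circle of length `β`. -/
def circleMoment (O : Fin n → Matrix F F ℂ) (t : Fin n → AddCircle β) (P : Finset (Fin n)) : ℂ :=
  -- Fixing the value 1 at `∅` avoids showing that the partition function is nonzero; the cumulant
  -- generating function does not use the average of the empty product.
  if P = ∅ then 1 else gibbsAvg A β (timeOrderedProd A O (fun i => circleRep (t i)) P)

@[simp]
theorem circleMoment_empty (O : Fin n → Matrix F F ℂ) (t : Fin n → AddCircle β) :
    circleMoment A O t ∅ = 1 := by simp [circleMoment]

theorem circleMoment_congr {O O' : Fin n → Matrix F F ℂ} {t t' : Fin n → AddCircle β}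
    {P : Finset (Fin n)} (hO : ∀ a ∈ P, O a = O' a) (ht : ∀ a ∈ P, t a = t' a) :
    circleMoment A O t P = circleMoment A O' t' P := by
  unfold circleMoment
  rw [timeOrderedProd_congr A P hO fun a ha => by rw [ht a ha]]

/-- Invariance of the moments under translations of the time circle. -/
theorem circleMoment_add (O : Fin n → Matrix F F ℂ) (t : Fin n → AddCircle β) (s : AddCircle β)
    (P : Finset (Fin n)) : circleMoment A O (fun i => t i + s) P = circleMoment A O t P := by
  unfold circleMoment
  split_ifs with hP
  · rfl
  obtain ⟨r, hr, rfl⟩ : ∃ r ∈ Set.Ico 0 β, (r : AddCircle β) = s :=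
    ⟨circleRep s, circleRep_mem s, coe_circleRep s⟩
  classical
  -- `P1` consists of the times that wrap around. They are the latest before the shift and the
  -- earliest after it, so the two blocks exchange places, and KMS compensates.
  set P1 := P.filter fun i => β ≤ circleRep (t i) + r with hP1
  set P2 := P.filter fun i => ¬ β ≤ circleRep (t i) + r with hP2
  have hP12 : P = P1 ∪ P2 := (Finset.filter_union_filter_not_eq _ P).symm
  have h1 : ∀ a ∈ P1, circleRep (t a + (r : AddCircle β)) = circleRep (t a) + (r - β) :=
    fun a ha => circleRep_add_of_le hr.2 (Finset.mem_filter.1 ha).2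
  have h2 : ∀ a ∈ P2, circleRep (t a + (r : AddCircle β)) = circleRep (t a) + r :=
    fun a ha => circleRep_add_of_lt hr.1 (not_le.1 (Finset.mem_filter.1 ha).2)
  have e1 : timeOrderedProd A O (fun i => circleRep (t i)) P =
      timeOrderedProd A O (fun i => circleRep (t i)) P1 *
        timeOrderedProd A O (fun i => circleRep (t i)) P2 := by
    rw [hP12]
    refine timeOrderedProd_union A O fun a ha b hb => Or.inl ?_
    have ha := (Finset.mem_filter.1 ha).2
    have hb := (Finset.mem_filter.1 hb).2
    linarith
  have e2 : timeOrderedProd A O (fun i => circleRep (t i + (r : AddCircle β))) P =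
      timeOrderedProd A O (fun i => circleRep (t i) + r) P2 *
        timeOrderedProd A O (fun i => circleRep (t i) + (r - β)) P1 := by
    rw [hP12, Finset.union_comm, timeOrderedProd_union A O fun a ha b hb => Or.inl ?_]
    · rw [timeOrderedProd_congr A P2 (fun _ _ => rfl) h2,
        timeOrderedProd_congr A P1 (fun _ _ => rfl) h1]
    · rw [h1 b hb, h2 a ha]
      have := (circleRep_mem (t a)).1
      have := (circleRep_mem (t b)).2
      linarith
  rw [e1, e2, timeOrderedProd_add, timeOrderedProd_add]
  exact gibbsAvg_shift_cyclic A β _ _ r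

theorem circleMoment_intertwine {U V : Matrix F F ℂ} (hU : Commute U A) (hVU : V * U = 1)
    {O : Fin n → Matrix F F ℂ} {c : Fin n → ℂ} {P : Finset (Fin n)}
    (hO : ∀ i ∈ P, U * O i = c i • (O i * U)) (t : Fin n → AddCircle β) :
    circleMoment A O t P = (∏ i ∈ P, c i) * circleMoment A O t P := by
  unfold circleMoment
  split_ifs with hP
  · simp [hP]
  · exact gibbsAvg_intertwine A β hU hVU (timeOrderedProd_intertwine A hU hO _)

theorem circleMoment_map {n' : ℕ} (e : Fin n' ↪ Fin n) (he : StrictMono e)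
    (O : Fin n → Matrix F F ℂ) (t : Fin n → AddCircle β) (P : Finset (Fin n')) :
    circleMoment A (O ∘ e) (t ∘ e) P = circleMoment A O t (P.map e) := by
  unfold circleMoment
  simp only [Finset.map_eq_empty]
  rw [← timeOrderedProd_map A e he O]
  rfl

open scoped Matrix.Norms.Operator in
theorem exists_norm_circleMoment_le (β : ℝ) [Fact (0 < β)] (O : Fin n → Matrix F F ℂ) :
    ∃ C : ℝ, ∀ (t : Fin n → AddCircle β) P, ‖circleMoment A O t P‖ ≤ C := by
  obtain ⟨B, hB1, hB⟩ := exists_norm_imagEvolve_le A O β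
  obtain ⟨C, hC0, hC⟩ := exists_norm_gibbsAvg_le A β
  refine ⟨max 1 (C * (‖(1 : Matrix F F ℂ)‖ * B ^ n)), fun t P => ?_⟩
  unfold circleMoment
  split_ifs with hP
  · simp
  · refine le_max_of_le_right ((hC _).trans ?_)
    gcongr
    exact norm_timeOrderedProd_le A hB1 (fun i => hB i _ (circleRep_mem_Icc _)) P

/-- The configurations split into measurable sets according to which label comes first; on each, the
first factor comes off and induction applies to the rest. -/
theorem measurable_timeOrderedProd (O : Fin n → Matrix F F ℂ) (P : Finset (Fin n)) (x y : F) :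
    Measurable fun t : Fin n → ℝ => timeOrderedProd A O t P x y := by
  classical
  induction P using Finset.strongInduction generalizing x y with
  | H P ih =>
    rcases P.eq_empty_or_nonempty with rfl | hP
    · simp
    have hset : ∀ a b, MeasurableSet {t : Fin n → ℝ | Precedes t a b} := fun a b =>
      (measurableSet_lt (measurable_pi_apply b) (measurable_pi_apply a)).union
        ((measurableSet_eq_fun (measurable_pi_apply b) (measurable_pi_apply a)).inter
          (MeasurableSet.const (a < b)))
    have hset' : ∀ a, MeasurableSet {t : Fin n → ℝ | ∀ b ∈ P.erase a, Precedes t a b} := fun a => by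
      have : {t : Fin n → ℝ | ∀ b ∈ P.erase a, Precedes t a b} =
          ⋂ b ∈ P.erase a, {t : Fin n → ℝ | Precedes t a b} := by ext; simp
      rw [this]
      exact Finset.measurableSet_biInter _ fun b _ => hset a b
    have hev : ∀ (a : Fin n) x y, Measurable fun t : Fin n → ℝ =>
        imagEvolve A (O a) (t a) x y := fun a x y => by
      have h1 : Continuous fun s : ℝ => imagEvolve A (O a) s x y := by
        open scoped Matrix.Norms.Operator in
        exact (contDiff_imagEvolve A (O a)).continuous.matrix_elem x y
      exact h1.measurable.comp (measurable_pi_apply a)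
    have key : (fun t : Fin n → ℝ => timeOrderedProd A O t P x y) = fun t =>
        ∑ a ∈ P, {t : Fin n → ℝ | ∀ b ∈ P.erase a, Precedes t a b}.indicator (fun t =>
          ∑ z, imagEvolve A (O a) (t a) x z * timeOrderedProd A O t (P.erase a) z y) t := by
      funext t
      obtain ⟨a, ha, hab⟩ := exists_precedes t P hP
      rw [Finset.sum_eq_single_of_mem a ha]
      · rw [Set.indicator_of_mem (by exact hab), ← Matrix.mul_apply, ← timeOrderedProd_insert A O hab,
          Finset.insert_erase ha]
      · intro b hb hba
        refine Set.indicator_of_notMem (fun h => ?_) _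
        exact (hab b (Finset.mem_erase.2 ⟨hba, hb⟩)).asymm
          (h a (Finset.mem_erase.2 ⟨hba.symm, ha⟩))
    rw [key]
    refine Finset.measurable_fun_sum _ fun a ha => Measurable.indicator ?_ (hset' a)
    exact Finset.measurable_fun_sum _ fun z _ =>
      (hev a x z).mul (ih _ (Finset.erase_ssubset ha) z y)

theorem measurable_circleMoment (O : Fin n → Matrix F F ℂ) (P : Finset (Fin n)) :
    Measurable fun t : Fin n → AddCircle β => circleMoment A O t P := by
  unfold circleMoment
  split_ifs with hP
  · exact measurable_const
  · unfold gibbsAvg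
    refine Measurable.div_const ?_ _
    simp only [Matrix.trace, Matrix.diag, Matrix.mul_apply]
    refine Finset.measurable_fun_sum _ fun x _ => Finset.measurable_fun_sum _ fun y _ =>
      Measurable.const_mul ?_ _
    exact (measurable_timeOrderedProd A O P y x).comp
      (measurable_pi_lambda _ fun i => measurable_circleRep.comp (measurable_pi_apply i))

end CircleMoment
end

noncomputable section

open MeasureTheory ProbabilityTheory

/-! ### Independent uniform times. -/

section CircleMeasure

variable {β : ℝ} [hβ : Fact (0 < β)]

/-- The uniform probability measure on tuples of times on the circle. -/
def timeMeasure (β : ℝ) [Fact (0 < β)] (n : ℕ) : Measure (Fin n → AddCircle β) :=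
  Measure.pi fun _ => AddCircle.haarAddCircle

instance (n : ℕ) : IsProbabilityMeasure (timeMeasure β n) := by
  unfold timeMeasure; infer_instance

instance (n : ℕ) : Measure.IsAddRightInvariant (timeMeasure β n) := by
  unfold timeMeasure; infer_instance

variable {n : ℕ}

theorem measurePreserving_comp {n' : ℕ} (e : Fin n' ↪ Fin n) :
    MeasurePreserving (fun t : Fin n → AddCircle β => t ∘ e) (timeMeasure β n)
      (timeMeasure β n') := by
  have hm : ∀ i : Fin n', Measurable fun t : Fin n → AddCircle β => t (e i) :=
    fun i => measurable_pi_apply _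
  refine ⟨measurable_pi_lambda _ hm, ?_⟩
  have h1 : iIndepFun (fun (i : Fin n) (t : Fin n → AddCircle β) => t i) (timeMeasure β n) :=
    iIndepFun_pi (X := fun _ x => x) fun _ => aemeasurable_id
  have h2 := h1.precomp e.injective
  have h3 := (iIndepFun_iff_map_fun_eq_pi_map fun i => (hm i).aemeasurable).1 h2
  have h4 : (fun t : Fin n → AddCircle β => t ∘ e) = fun t i => t (e i) := rfl
  rw [h4, h3]
  unfold timeMeasure
  congr 1
  funext i
  exact (measurePreserving_eval (fun _ : Fin n => (AddCircle.haarAddCircle (T := β))) (e i)).map_eq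

/-- Functions of disjoint sets of times are independent. -/
theorem integral_mul_of_dependsOn {f g : (Fin n → AddCircle β) → ℂ} {S T : Finset (Fin n)}
    (hST : Disjoint S T) (hf : Measurable f) (hg : Measurable g) (hfS : DependsOn f (S : Set (Fin n)))
    (hgT : DependsOn g (T : Set (Fin n))) :
    ∫ t, f t * g t ∂timeMeasure β n =
      (∫ t, f t ∂timeMeasure β n) * ∫ t, g t ∂timeMeasure β n := by
  classical
  have h1 : iIndepFun (fun (i : Fin n) (t : Fin n → AddCircle β) => t i) (timeMeasure β n) :=
    iIndepFun_pi (X := fun _ x => x) fun _ => aemeasurable_id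
  have h2 := h1.indepFun_finset S T hST fun i => measurable_pi_apply i
  -- Padding by zeros writes a function depending only on the times in `S` as a function of the
  -- restricted tuple, to which independence applies.
  let ext : ∀ S : Finset (Fin n), (S → AddCircle β) → Fin n → AddCircle β :=
    fun S x i => if h : i ∈ S then x ⟨i, h⟩ else 0
  have hext : ∀ S, Measurable (ext S) := fun S => by
    refine measurable_pi_lambda _ fun i => ?_
    by_cases h : i ∈ S
    · simp only [ext, dif_pos h]
      exact measurable_pi_apply _
    · simp only [ext, dif_neg h]
      exact measurable_const
  have h3 := h2.comp (hf.comp (hext S)) (hg.comp (hext T))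
  have hf' : ((f ∘ ext S) ∘ fun (t : Fin n → AddCircle β) (i : S) => t i) = f := by
    funext t
    refine hfS fun i hi => ?_
    have hi : i ∈ S := hi
    simp [ext, hi]
  have hg' : ((g ∘ ext T) ∘ fun (t : Fin n → AddCircle β) (i : T) => t i) = g := by
    funext t
    refine hgT fun i hi => ?_
    have hi : i ∈ T := hi
    simp [ext, hi]
  rw [hf', hg'] at h3
  exact h3.integral_mul_eq_mul_integral hf.aestronglyMeasurable hg.aestronglyMeasurable

end CircleMeasure

/-! ### Time-averaged moments and cumulants, and conservation of frequency. -/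

section IntegratedMoments

variable {β : ℝ} [hβ : Fact (0 < β)] {n : ℕ} {F : Type*} [Fintype F] [DecidableEq F]
  (A : Matrix F F ℂ)

/-- The product of the phases `e^{-iω_a t_a}`, `ω_a = 2πw_a/β`, over the labels `a ∈ P`. -/
def timePhase (w : Fin n → ℤ) (t : Fin n → AddCircle β) (P : Finset (Fin n)) : ℂ :=
  ∏ i ∈ P, fourier (-w i) (t i)

theorem norm_fourier_apply {T : ℝ} (m : ℤ) (x : AddCircle T) : ‖fourier m x‖ = 1 := by
  rw [fourier_apply]; exact Circle.norm_coe _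

theorem norm_timePhase {T : ℝ} (w : Fin n → ℤ) (t : Fin n → AddCircle T) (P : Finset (Fin n)) :
    ‖timePhase w t P‖ = 1 := by
  simp only [timePhase, norm_prod, norm_fourier_apply, Finset.prod_const_one]

theorem measurable_timePhase {T : ℝ} (w : Fin n → ℤ) (P : Finset (Fin n)) :
    Measurable fun t : Fin n → AddCircle T => timePhase w t P := by
  unfold timePhase
  exact Finset.measurable_fun_prod _ fun i _ =>
    (ContinuousMap.measurable _).comp (measurable_pi_apply i)

/-- The cumulants at times on the circle. -/
def circleCumulant (O : Fin n → Matrix F F ℂ) (t : Fin n → AddCircle β) (S : Finset (Fin n)) : ℂ :=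
  cumulant (circleMoment A O t) S

theorem isCumulant_circleCumulant (O : Fin n → Matrix F F ℂ) (t : Fin n → AddCircle β) :
    IsCumulant (circleMoment A O t) (circleCumulant A O t) :=
  isCumulant_cumulant (circleMoment_empty A O t)

/-- Through the recursion a cumulant is a polynomial in the moments, so measurability, like the
bound below, needs no control of derivatives of the logarithm. -/
theorem measurable_circleCumulant (O : Fin n → Matrix F F ℂ) (S : Finset (Fin n))
    (hS : S.Nonempty) : Measurable fun t : Fin n → AddCircle β => circleCumulant A O t S := by
  induction S using Finset.strongInduction with
  | H S ih =>
    obtain ⟨a, ha⟩ := hS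
    obtain ⟨R, haR, rfl⟩ : ∃ R, a ∉ R ∧ insert a R = S :=
      ⟨S.erase a, Finset.notMem_erase _ _, Finset.insert_erase ha⟩
    have : (fun t : Fin n → AddCircle β => circleCumulant A O t (insert a R)) = fun t =>
        circleMoment A O t (insert a R) - ∑ T ∈ R.powerset.erase R,
          circleCumulant A O t (insert a T) * circleMoment A O t (R \ T) := funext fun t =>
      (isCumulant_circleCumulant A O t).insert_eq_sub (circleMoment_empty A O t) haR
    rw [this]
    refine (measurable_circleMoment A O _).sub (Finset.measurable_fun_sum _ fun T hT => ?_)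
    obtain ⟨hTR, hT⟩ := Finset.mem_erase.1 hT
    have hss : T ⊂ R := lt_of_le_of_ne (Finset.mem_powerset.1 hT) hTR
    exact (ih (insert a T) (insert_ssubset_insert_of_ssubset haR hss)
      (Finset.insert_nonempty _ _)).mul (measurable_circleMoment A O _)

theorem exists_norm_circleCumulant_le (β : ℝ) [Fact (0 < β)] (O : Fin n → Matrix F F ℂ)
    (S : Finset (Fin n)) (hS : S.Nonempty) :
    ∃ C : ℝ, ∀ t : Fin n → AddCircle β, ‖circleCumulant A O t S‖ ≤ C := by
  obtain ⟨D, hD⟩ := exists_norm_circleMoment_le A β O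
  induction S using Finset.strongInduction with
  | H S ih =>
    obtain ⟨a, ha⟩ := hS
    obtain ⟨R, haR, rfl⟩ : ∃ R, a ∉ R ∧ insert a R = S :=
      ⟨S.erase a, Finset.notMem_erase _ _, Finset.insert_erase ha⟩
    have hb : ∀ T ∈ R.powerset.erase R, ∃ C : ℝ, ∀ t : Fin n → AddCircle β,
        ‖circleCumulant A O t (insert a T)‖ ≤ C := by
      intro T hT
      obtain ⟨hTR, hT⟩ := Finset.mem_erase.1 hT
      have hss : T ⊂ R := lt_of_le_of_ne (Finset.mem_powerset.1 hT) hTR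
      exact ih (insert a T) (insert_ssubset_insert_of_ssubset haR hss)
        (Finset.insert_nonempty _ _)
    choose! C hC using hb
    refine ⟨D + ∑ T ∈ R.powerset.erase R, C T * D, fun t => ?_⟩
    rw [(isCumulant_circleCumulant A O t).insert_eq_sub (circleMoment_empty A O t) haR]
    refine (norm_sub_le _ _).trans (add_le_add (hD t _) ((norm_sum_le _ _).trans
      (Finset.sum_le_sum fun T hT => ?_)))
    rw [norm_mul]
    exact mul_le_mul (hC T hT t) (hD t _) (norm_nonneg _) ((norm_nonneg _).trans (hC T hT t))

/-- The time-averaged moments with the phases of the frequencies `2πw_a/β`. -/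
def fourierMoment (β : ℝ) [Fact (0 < β)] (O : Fin n → Matrix F F ℂ) (w : Fin n → ℤ)
    (P : Finset (Fin n)) : ℂ :=
  ∫ t, timePhase w t P * circleMoment A O t P ∂timeMeasure β n

/-- The time-averaged cumulants with the phases of the frequencies `2πw_a/β`. -/
def fourierCumulant (β : ℝ) [Fact (0 < β)] (O : Fin n → Matrix F F ℂ) (w : Fin n → ℤ)
    (P : Finset (Fin n)) : ℂ :=
  ∫ t, timePhase w t P * circleCumulant A O t P ∂timeMeasure β n

@[simp]
theorem fourierMoment_empty (O : Fin n → Matrix F F ℂ) (w : Fin n → ℤ) :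
    fourierMoment A β O w ∅ = 1 := by
  simp [fourierMoment, timePhase]

theorem fourierMoment_congr {O O' : Fin n → Matrix F F ℂ} {w w' : Fin n → ℤ}
    {P : Finset (Fin n)} (hO : ∀ a ∈ P, O a = O' a) (hw : ∀ a ∈ P, w a = w' a) :
    fourierMoment A β O w P = fourierMoment A β O' w' P := by
  unfold fourierMoment
  congr 1
  funext t
  rw [circleMoment_congr A hO fun _ _ => rfl]
  congr 1
  exact Finset.prod_congr rfl fun a ha => by rw [hw a ha]

theorem integrable_of_bounded {f : (Fin n → AddCircle β) → ℂ} (hf : Measurable f) {C : ℝ}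
    (hC : ∀ t, ‖f t‖ ≤ C) : Integrable f (timeMeasure β n) :=
  Integrable.of_bound hf.aestronglyMeasurable C (Filter.Eventually.of_forall hC)

/-- Each term of the pointwise recursion is a product of functions of disjoint sets of independent
times, and the phases factor over labels; hence its integral is a product of integrals. -/
theorem isCumulant_fourierCumulant (O : Fin n → Matrix F F ℂ) (w : Fin n → ℤ) :
    IsCumulant (fourierMoment A β O w) (fourierCumulant A β O w) := by
  intro S a ha
  obtain ⟨D, hD⟩ := exists_norm_circleMoment_le A β O
  have hmeasK : ∀ T : Finset (Fin n), Measurable fun t : Fin n → AddCircle β =>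
      timePhase w t (insert a T) * circleCumulant A O t (insert a T) := fun T =>
    (measurable_timePhase w _).mul
      (measurable_circleCumulant A O _ (Finset.insert_nonempty _ _))
  have hmeasM : ∀ T : Finset (Fin n), Measurable fun t : Fin n → AddCircle β =>
      timePhase w t T * circleMoment A O t T := fun T =>
    (measurable_timePhase w _).mul (measurable_circleMoment A O _)
  have e1 : ∀ t : Fin n → AddCircle β,
      timePhase w t (insert a S) * circleMoment A O t (insert a S) =
      ∑ T ∈ S.powerset, (timePhase w t (insert a T) * circleCumulant A O t (insert a T)) *
        (timePhase w t (S \ T) * circleMoment A O t (S \ T)) := by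
    intro t
    rw [isCumulant_circleCumulant A O t S a ha, Finset.mul_sum]
    refine Finset.sum_congr rfl fun T hT => ?_
    have hTS := Finset.mem_powerset.1 hT
    have : timePhase w t (insert a S) = timePhase w t (insert a T) * timePhase w t (S \ T) := by
      unfold timePhase
      rw [Finset.prod_insert ha, Finset.prod_insert (fun h => ha (hTS h)),
        ← Finset.prod_sdiff hTS]
      ring
    rw [this]
    ring
  have e2 : ∀ T ∈ S.powerset, ∫ t, (timePhase w t (insert a T) * circleCumulant A O t (insert a T)) *
        (timePhase w t (S \ T) * circleMoment A O t (S \ T)) ∂timeMeasure β n =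
      fourierCumulant A β O w (insert a T) * fourierMoment A β O w (S \ T) := by
    intro T hT
    have hTS := Finset.mem_powerset.1 hT
    refine integral_mul_of_dependsOn (S := insert a T) (T := S \ T) ?_ (hmeasK T) (hmeasM _)
      ?_ ?_
    · rw [Finset.disjoint_insert_left]
      exact ⟨fun h => ha (Finset.mem_sdiff.1 h).1, Finset.disjoint_sdiff⟩
    · intro t t' htt'
      have h1 : timePhase w t (insert a T) = timePhase w t' (insert a T) :=
        Finset.prod_congr rfl fun i hi => by rw [htt' i hi]
      simp only
      -- A cumulant depends only on the moments of subsets of its labels, hence only on their times.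
      rw [h1, (isCumulant_circleCumulant A O t).eq_of_subset (circleMoment_empty A O t)
        (isCumulant_circleCumulant A O t') _ (Finset.insert_nonempty _ _) fun P hP =>
          circleMoment_congr A (fun _ _ => rfl) fun i hi => htt' i (hP hi)]
    · intro t t' htt'
      have h1 : timePhase w t (S \ T) = timePhase w t' (S \ T) :=
        Finset.prod_congr rfl fun i hi => by rw [htt' i hi]
      simp only
      rw [h1, circleMoment_congr A (fun _ _ => rfl) htt']
  unfold fourierMoment
  rw [integral_congr_ae (Filter.Eventually.of_forall e1), integral_finsetSum]
  · exact Finset.sum_congr rfl e2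
  · intro T hT
    obtain ⟨C, hC⟩ := exists_norm_circleCumulant_le A β O (insert a T) (Finset.insert_nonempty _ _)
    refine integrable_of_bounded (C := C * D) ((hmeasK T).mul (hmeasM _)) fun t => ?_
    rw [norm_mul, norm_mul, norm_mul, norm_timePhase, norm_timePhase, one_mul, one_mul]
    exact mul_le_mul (hC t) (hD t _) (norm_nonneg _) ((norm_nonneg _).trans (hC t))

theorem fourierMoment_map {n' : ℕ} (e : Fin n' ↪ Fin n) (he : StrictMono e)
    (O : Fin n → Matrix F F ℂ) (w : Fin n → ℤ) (P : Finset (Fin n')) :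
    fourierMoment A β (O ∘ e) (w ∘ e) P = fourierMoment A β O w (P.map e) := by
  unfold fourierMoment
  rw [← (measurePreserving_comp (β := β) e).map_eq, integral_map]
  · congr 1
    funext t
    rw [circleMoment_map A e he]
    simp [timePhase]
  · exact (measurePreserving_comp e).measurable.aemeasurable
  · exact ((measurable_timePhase _ _).mul (measurable_circleMoment A _ _)).aestronglyMeasurable

theorem fourierCumulant_map {n' : ℕ} (e : Fin n' ↪ Fin n) (he : StrictMono e)
    (O : Fin n → Matrix F F ℂ) (w : Fin n → ℤ) (P : Finset (Fin n')) (hP : P.Nonempty) :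
    fourierCumulant A β (O ∘ e) (w ∘ e) P = fourierCumulant A β O w (P.map e) := by
  have h := (isCumulant_fourierCumulant (β := β) A O w).comap e
  have h' := isCumulant_fourierCumulant (β := β) A (O ∘ e) (w ∘ e)
  rw [funext fun P => fourierMoment_map (β := β) A e he O w P] at h'
  exact h'.unique (by simp) h P hP

/-- Covariance of the time-averaged moments under translations of the time circle. -/
theorem fourierMoment_translate (O : Fin n → Matrix F F ℂ) (w : Fin n → ℤ) (s : AddCircle β)
    (P : Finset (Fin n)) :
    fourierMoment A β O w P = (∏ i ∈ P, fourier (-w i) s) * fourierMoment A β O w P := by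
  unfold fourierMoment
  conv_lhs => rw [← integral_add_right_eq_self _ (fun _ => s)]
  rw [← integral_const_mul]
  congr 1
  funext t
  have h1 : circleMoment A O (t + fun _ => s) P = circleMoment A O t P := circleMoment_add A O t s P
  rw [h1, ← mul_assoc]
  congr 1
  unfold timePhase
  rw [← Finset.prod_mul_distrib]
  refine Finset.prod_congr rfl fun i _ => ?_
  rw [Pi.add_apply, fourier_apply, fourier_apply, fourier_apply, smul_add,
    AddCircle.toCircle_add, Circle.coe_mul, mul_comm]

/-- Conservation of the frequency. -/
theorem fourierCumulant_eq_zero_of_sum_ne (O : Fin n → Matrix F F ℂ) (w : Fin n → ℤ)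
    {P : Finset (Fin n)} (hP : P.Nonempty) (h : ∑ i ∈ P, w i ≠ 0) :
    fourierCumulant A β O w P = 0 := by
  have hprod : ∀ s : AddCircle β, ∏ i ∈ P, fourier (-w i) s = fourier (-∑ i ∈ P, w i) s := by
    intro s
    clear hP h
    induction P using Finset.induction_on with
    | empty => simp
    | insert a P ha ih =>
      rw [Finset.prod_insert ha, Finset.sum_insert ha, ih, neg_add, fourier_add]
  set m := -∑ i ∈ P, w i with hm
  have hm0 : m ≠ 0 := by simpa [hm] using h
  have hβ' : β ≠ 0 := hβ.out.ne'
  -- Translation by β/(2m), with -m the total frequency, produces the phase -1, so the cumulant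
  -- equals its own negative.
  have key := (isCumulant_fourierCumulant (β := β) A O w).eq_prod_mul (by simp)
    (fun i => fourier (-w i) (((β / 2 / m : ℝ)) : AddCircle β))
    (fourierMoment_translate A O w _) P hP
  have : fourier m ((β / 2 / m : ℝ) : AddCircle β) = -1 := by
    rw [fourier_coe_apply]
    have hmC : (m : ℂ) ≠ 0 := by exact_mod_cast hm0
    have hβC : (β : ℂ) ≠ 0 := by exact_mod_cast hβ'
    have : 2 * (Real.pi : ℂ) * Complex.I * m * ((β / 2 / m : ℝ) : ℂ) / β = Real.pi * Complex.I := by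
      push_cast
      field_simp
    rw [this, Complex.exp_pi_mul_I]
  rw [hprod, this] at key
  have : (2 : ℂ) * fourierCumulant A β O w P = 0 := by linear_combination key
  simpa using this

/-- Selection rule coming from a symmetry `U` of the dynamics. -/
theorem fourierCumulant_intertwine {U V : Matrix F F ℂ} (hU : Commute U A) (hVU : V * U = 1)
    {O : Fin n → Matrix F F ℂ} {c : Fin n → ℂ} (hO : ∀ i, U * O i = c i • (O i * U))
    (w : Fin n → ℤ) {P : Finset (Fin n)} (hP : P.Nonempty) :
    fourierCumulant A β O w P = (∏ i ∈ P, c i) * fourierCumulant A β O w P := by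
  refine (isCumulant_fourierCumulant A O w).eq_prod_mul (by simp) c (fun S => ?_) P hP
  unfold fourierMoment
  rw [← integral_const_mul]
  congr 1
  funext t
  conv_lhs => rw [circleMoment_intertwine A hU hVU (fun i _ => hO i) t]
  ring

theorem volume_pi_addCircle (β : ℝ) [Fact (0 < β)] (n : ℕ) :
    (volume : Measure (Fin n → AddCircle β)) = ENNReal.ofReal β ^ n • timeMeasure β n := by
  refine Measure.pi_eq fun s hs => ?_
  rw [Measure.smul_apply, timeMeasure, Measure.pi_pi, smul_eq_mul]
  simp only [AddCircle.volume_eq_smul_haarAddCircle, Measure.smul_apply, smul_eq_mul,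
    Finset.prod_mul_distrib, Finset.prod_const, Finset.card_univ, Fintype.card_fin]

/-- Gluing each interval [0, β) into a circle preserves the integral; the factor β^n normalizes the
measure to a probability. -/
theorem truncatedCorrFourier_eq (O : Fin n → Matrix F F ℂ) (w : Fin n → ℤ) (hn : 0 < n) :
    truncatedCorrFourier A β O (fun i => 2 * Real.pi / β * w i) =
      (β : ℂ) ^ n * fourierCumulant A β O w Finset.univ := by
  have hβ0 := hβ.out
  have huniv : (Finset.univ : Finset (Fin n)).Nonempty := ⟨⟨0, hn⟩, Finset.mem_univ _⟩
  have hmp1 : MeasurePreserving (fun x : ℝ => (x : AddCircle β))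
      (volume.restrict (Set.Ico 0 β)) volume := by
    have := AddCircle.measurePreserving_mk β 0
    rw [zero_add] at this
    rwa [restrict_Ico_eq_restrict_Ioc]
  have hmp : MeasurePreserving (fun (x : Fin n → ℝ) i => (x i : AddCircle β))
      (Measure.pi fun _ : Fin n => (volume : Measure ℝ).restrict (Set.Ico 0 β)) volume :=
    measurePreserving_pi _ _ fun _ => hmp1
  set f : (Fin n → AddCircle β) → ℂ := fun t =>
    timePhase w t Finset.univ * circleCumulant A O t Finset.univ with hf
  have hfm : Measurable f :=
    (measurable_timePhase _ _).mul (measurable_circleCumulant A _ _ huniv)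
  have e1 : ∫ t : Fin n → AddCircle β, f t = (β : ℂ) ^ n * fourierCumulant A β O w Finset.univ := by
    rw [volume_pi_addCircle, integral_smul_measure, ENNReal.toReal_pow,
      ENNReal.toReal_ofReal hβ0.le, Complex.real_smul]
    push_cast
    rfl
  rw [← e1, ← hmp.map_eq, integral_map hmp.measurable.aemeasurable hfm.aestronglyMeasurable]
  unfold truncatedCorrFourier
  rw [volume_pi, ← Measure.restrict_pi_pi]
  have hmem : ∀ᵐ t : Fin n → ℝ ∂((Measure.pi fun _ : Fin n =>
      (volume : Measure ℝ)).restrict (Set.univ.pi fun _ => Set.Ico 0 β)), ∀ i, t i ∈ Set.Ico 0 β := by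
    filter_upwards [ae_restrict_mem (MeasurableSet.univ_pi fun _ => measurableSet_Ico)] with t ht i
    exact ht i (Set.mem_univ i)
  refine integral_congr_ae ?_
  filter_upwards [hmem] with t ht
  simp only [hf]
  congr 1
  · unfold timePhase
    simp only [fourier_coe_apply]
    rw [← Complex.exp_sum]
    congr 1
    push_cast
    rw [Finset.mul_sum]
    refine Finset.sum_congr rfl fun i _ => ?_
    ring
  · rw [truncatedCorr_eq_cumulant]
    unfold circleCumulant
    have : ∀ P, P ≠ ∅ → gibbsAvg A β (timeOrderedProd A O t P) =
        circleMoment A O (fun i => (t i : AddCircle β)) P := by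
      intro P hP
      unfold circleMoment
      rw [if_neg hP]
      congr 2
      funext i
      rw [circleRep_coe (ht i)]
    rw [cumulant_congr this]

end IntegratedMoments
end

noncomputable section

open MeasureTheory ProbabilityTheory

/-! ### Absolute convergence of Fourier series of Lipschitz functions. -/

section Bernstein

variable {T : ℝ} [hT : Fact (0 < T)]

theorem fourier_add_apply {T : ℝ} (n : ℤ) (x y : AddCircle T) :
    fourier n (x + y) = fourier n x * fourier n y := by
  rw [fourier_apply, fourier_apply, fourier_apply, smul_add, AddCircle.toCircle_add,
    Circle.coe_mul]

theorem fourierCoeff_translate_sub (g : C(AddCircle T, ℂ)) (s : AddCircle T) (n : ℤ) :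
    fourierCoeff (fun x => g (x + s) - g x) n = (fourier n s - 1) * fourierCoeff g n := by
  have hint : ∀ f : AddCircle T → ℂ, Continuous f → Integrable f AddCircle.haarAddCircle :=
    fun f hf => hf.integrable_of_hasCompactSupport (HasCompactSupport.of_compactSpace _)
  have hc : Continuous fun x : AddCircle T => fourier (-n) x := ContinuousMap.continuous _
  have h2 : Integrable (fun x => fourier (-n) x * g x) AddCircle.haarAddCircle :=
    hint _ (hc.mul g.continuous)
  have h1 : Integrable (fun x => fourier (-n) x * g (x + s)) AddCircle.haarAddCircle :=
    hint _ (hc.mul (g.continuous.comp (continuous_add_const s)))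
  have e1 : ∫ x, fourier (-n) x * g (x + s) ∂AddCircle.haarAddCircle =
      fourier n s * ∫ x, fourier (-n) x * g x ∂AddCircle.haarAddCircle := by
    rw [← integral_const_mul, ← integral_add_right_eq_self
      (fun x => fourier n s * (fourier (-n) x * g x)) s]
    refine integral_congr_ae (Filter.Eventually.of_forall fun x => ?_)
    have h3 : fourier n s * fourier (-n) s = 1 := by rw [← fourier_add]; simp
    simp only [fourier_add_apply]
    generalize fourier n s = a at *
    generalize fourier (-n) s = b at *
    linear_combination (-fourier (-n) x * g (x + s)) * h3
  unfold fourierCoeff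
  simp only [smul_eq_mul, mul_sub]
  rw [integral_sub h1 h2, sub_mul, one_mul, e1]

/-- **Bernstein's theorem** for Lipschitz functions on the circle: the Fourier coefficients are
absolutely summable. -/
theorem summable_fourierCoeff_of_lipschitz (g : C(AddCircle T, ℂ)) (K : ℝ)
    (h : ∀ x : AddCircle T, ∀ s ∈ Set.Ico 0 T, ‖g (x + (s : AddCircle T)) - g x‖ ≤ K * s) :
    Summable (fourierCoeff g) := by
  have hT0 := hT.out
  -- Bessel's inequality for the increment g(· + s) - g, which is bounded by K s.
  have parseval : ∀ s ∈ Set.Ico 0 T, ∀ J : Finset ℤ,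
      ∑ n ∈ J, ‖(fourier n (s : AddCircle T) - 1) * fourierCoeff g n‖ ^ 2 ≤ (K * s) ^ 2 := by
    intro s hs J
    let d : C(AddCircle T, ℂ) := g.comp (ContinuousMap.addRight (s : AddCircle T)) - g
    have hd : ∀ x, ‖d x‖ ≤ K * s := fun x => h x s hs
    have h1 := hasSum_sq_fourierCoeff (ContinuousMap.toLp 2 AddCircle.haarAddCircle ℂ d)
    have h2 : ∀ n, fourierCoeff (ContinuousMap.toLp 2 AddCircle.haarAddCircle ℂ d) n =
        (fourier n (s : AddCircle T) - 1) * fourierCoeff g n := fun n => by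
      rw [fourierCoeff_toLp]; exact fourierCoeff_translate_sub g s n
    simp only [h2] at h1
    refine (sum_le_hasSum J (fun _ _ => by positivity) h1).trans ?_
    have h3 : ∫ t : AddCircle T, ‖(ContinuousMap.toLp 2 AddCircle.haarAddCircle ℂ d) t‖ ^ 2
        ∂AddCircle.haarAddCircle = ∫ t : AddCircle T, ‖d t‖ ^ 2 ∂AddCircle.haarAddCircle := by
      refine integral_congr_ae ?_
      filter_upwards [ContinuousMap.coeFn_toLp (p := 2) (𝕜 := ℂ) AddCircle.haarAddCircle d] with t ht
      rw [ht]
    rw [h3]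
    have h4 : Integrable (fun t => ‖d t‖ ^ 2) (AddCircle.haarAddCircle (T := T)) :=
      (by fun_prop : Continuous fun t => ‖d t‖ ^ 2).integrable_of_hasCompactSupport
        (HasCompactSupport.of_compactSpace _)
    calc ∫ t : AddCircle T, ‖d t‖ ^ 2 ∂AddCircle.haarAddCircle
        ≤ ∫ t : AddCircle T, (K * s) ^ 2 ∂AddCircle.haarAddCircle := by
          refine integral_mono h4 (integrable_const _) fun t => ?_
          exact pow_le_pow_left₀ (norm_nonneg _) (hd t) 2
      _ = (K * s) ^ 2 := by simp
  -- A Lipschitz function has square-integrable derivative. This is extracted from the increments,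
  -- with a bound uniform in the finite set `J`.
  have hsq : Summable fun n : ℤ => (n : ℝ) ^ 2 * ‖fourierCoeff g n‖ ^ 2 := by
    refine summable_of_sum_le (c := (K * T / 4) ^ 2) (fun n => by positivity) fun J => ?_
    set N : ℕ := 1 + ∑ n ∈ J, n.natAbs with hN
    have hNpos : (0 : ℝ) < N := by rw [hN]; positivity
    have hle : ∀ n ∈ J, |(n : ℝ)| ≤ N := by
      intro n hn
      have h1 : n.natAbs ≤ N := by
        have := Finset.single_le_sum (f := fun n : ℤ => n.natAbs) (fun _ _ => Nat.zero_le _) hn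
        omega
      have : (n.natAbs : ℝ) ≤ N := by exact_mod_cast h1
      rwa [Nat.cast_natAbs, Int.cast_abs] at this
    -- For |n| ≤ N this gives π|n|s/T ≤ π/2, so Jordan's inequality bounds |e^{2πins/T} - 1| below
    -- by 4|n|s/T; dividing (K s)² by (4s/T)² leaves the constant (KT/4)².
    set s : ℝ := T / (2 * N) with hs
    have hs0 : 0 < s := by positivity
    have hsT : s < T := by
      rw [hs, div_lt_iff₀ (by positivity)]
      have : (1 : ℝ) ≤ N := by exact_mod_cast (by omega : 1 ≤ N)
      nlinarith
    have hlow : ∀ n ∈ J, 4 * |(n : ℝ)| * s / T ≤ ‖fourier n (s : AddCircle T) - 1‖ := by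
      intro n hn
      have e1 : fourier n (s : AddCircle T) =
          Complex.exp (Complex.I * ((2 * Real.pi * n * s / T : ℝ) : ℂ)) := by
        rw [fourier_coe_apply]; congr 1; push_cast; ring
      rw [e1, Complex.norm_exp_I_mul_ofReal_sub_one, norm_mul, Real.norm_ofNat, Real.norm_eq_abs]
      have hx : |2 * Real.pi * n * s / T / 2| = Real.pi * |(n : ℝ)| * s / T := by
        rw [show 2 * Real.pi * n * s / T / 2 = Real.pi * n * s / T by ring, abs_div, abs_mul,
          abs_mul, abs_of_pos Real.pi_pos, abs_of_pos hs0, abs_of_pos hT0]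
      have hx2 : |2 * Real.pi * n * s / T / 2| ≤ Real.pi / 2 := by
        rw [hx, hs]
        have : Real.pi * |(n : ℝ)| * (T / (2 * N)) / T = Real.pi / 2 * (|(n : ℝ)| / N) := by
          field_simp
        rw [this]
        exact mul_le_of_le_one_right (by positivity) ((div_le_one hNpos).2 (hle n hn))
      have := Real.mul_abs_le_abs_sin hx2
      rw [hx] at this
      have e2 : 2 / Real.pi * (Real.pi * |(n : ℝ)| * s / T) = 2 * |(n : ℝ)| * s / T := by
        field_simp
      rw [e2] at this
      calc 4 * |(n : ℝ)| * s / T = 2 * (2 * |(n : ℝ)| * s / T) := by ring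
        _ ≤ _ := by gcongr
    have h1 := parseval s ⟨hs0.le, hsT⟩ J
    have h2 : ∑ n ∈ J, (4 * s / T) ^ 2 * ((n : ℝ) ^ 2 * ‖fourierCoeff g n‖ ^ 2) ≤ (K * s) ^ 2 := by
      refine (Finset.sum_le_sum fun n hn => ?_).trans h1
      rw [norm_mul, mul_pow, ← mul_assoc]
      refine mul_le_mul_of_nonneg_right ?_ (by positivity)
      calc (4 * s / T) ^ 2 * (n : ℝ) ^ 2 = (4 * |(n : ℝ)| * s / T) ^ 2 := by
            rw [← sq_abs (n : ℝ)]; ring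
        _ ≤ _ := pow_le_pow_left₀ (by positivity) (hlow n hn) 2
    rw [← Finset.mul_sum] at h2
    have h3 : (4 * s / T) ^ 2 * (K * T / 4) ^ 2 = (K * s) ^ 2 := by field_simp
    rw [← h3] at h2
    exact le_of_mul_le_mul_left h2 (by positivity)
  have hinv : Summable fun n : ℤ => 1 / (n : ℝ) ^ 2 :=
    Real.summable_one_div_int_pow.2 (by norm_num)
  -- For n ≠ 0, 2|c_n| ≤ n²|c_n|² + 1/n².
  refine Summable.of_norm_bounded_eventually (g := fun n : ℤ =>
    (n : ℝ) ^ 2 * ‖fourierCoeff g n‖ ^ 2 + 1 / (n : ℝ) ^ 2) (hsq.add hinv) ?_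
  have : ∀ᶠ n : ℤ in Filter.cofinite, n ≠ 0 := Filter.eventually_cofinite_ne 0
  filter_upwards [this] with n hn
  have hn' : (n : ℝ) ≠ 0 := by exact_mod_cast hn
  set a := ‖fourierCoeff g n‖
  have h0 : 0 ≤ ((n : ℝ) * a - 1 / n) ^ 2 := sq_nonneg _
  have e : ((n : ℝ) * a - 1 / n) ^ 2 = (n : ℝ) ^ 2 * a ^ 2 + 1 / (n : ℝ) ^ 2 - 2 * a := by
    field_simp
    ring
  have ha : 0 ≤ a := norm_nonneg _
  linarith

end Bernstein
end

noncomputable section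

open MeasureTheory ProbabilityTheory

/-! ### Resampling one time and the law of time differences. -/

section Resample

variable {β : ℝ} [hβ : Fact (0 < β)] {n : ℕ}

/-- Replacing one time by an independent one preserves the measure. -/
theorem measurePreserving_update (y : Fin n) :
    MeasurePreserving (fun p : (Fin n → AddCircle β) × AddCircle β => Function.update p.1 y p.2)
      ((timeMeasure β n).prod AddCircle.haarAddCircle) (timeMeasure β n) := by
  have hmeas : Measurable fun p : (Fin n → AddCircle β) × AddCircle β =>
      Function.update p.1 y p.2 := by
    refine measurable_pi_lambda _ fun i => ?_
    by_cases h : i = y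
    · subst h; simpa using measurable_snd
    · simp only [Function.update_of_ne h]
      exact (measurable_pi_apply i).comp measurable_fst
  refine ⟨hmeas, ?_⟩
  refine (Measure.pi_eq fun s hs => ?_).symm
  rw [Measure.map_apply hmeas (MeasurableSet.univ_pi hs)]
  have : (fun p : (Fin n → AddCircle β) × AddCircle β => Function.update p.1 y p.2) ⁻¹'
      Set.univ.pi s = (Set.univ.pi (Function.update s y Set.univ)) ×ˢ s y := by
    ext p
    simp only [Set.mem_preimage, Set.mem_univ_pi, Set.mem_prod]
    constructor
    · intro h
      refine ⟨fun i => ?_, by simpa using h y⟩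
      by_cases hi : i = y
      · subst hi; simp
      · simpa [hi] using h i
    · rintro ⟨h1, h2⟩ i
      by_cases hi : i = y
      · subst hi; simpa using h2
      · simpa [hi] using h1 i
  rw [this, Measure.prod_prod, timeMeasure, Measure.pi_pi]
  rw [← Finset.mul_prod_erase _ _ (Finset.mem_univ y),
    ← Finset.mul_prod_erase Finset.univ (fun i => AddCircle.haarAddCircle (s i)) (Finset.mem_univ y)]
  simp only [Function.update_self, measure_univ, one_mul]
  rw [mul_comm]
  congr 1
  refine Finset.prod_congr rfl fun i hi => ?_
  rw [Function.update_of_ne (Finset.ne_of_mem_erase hi)]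

/-- Integration over one time, measured relative to another one. -/
theorem integral_eq_integral_update {y z : Fin n} {f : (Fin n → AddCircle β) → ℂ}
    (hf : Measurable f) {C : ℝ} (hC : ∀ t, ‖f t‖ ≤ C) :
    ∫ t, f t ∂timeMeasure β n =
      ∫ u, ∫ t, f (Function.update t y (t z + u)) ∂timeMeasure β n ∂AddCircle.haarAddCircle := by
  have hmp := measurePreserving_update (β := β) y
  have hadd : Measurable fun p : (Fin n → AddCircle β) × AddCircle β => (p.1, p.1 z + p.2) :=
    measurable_fst.prodMk (((measurable_pi_apply z).comp measurable_fst).add measurable_snd)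
  have hint : Integrable (fun p : (Fin n → AddCircle β) × AddCircle β =>
      f (Function.update p.1 y p.2)) ((timeMeasure β n).prod AddCircle.haarAddCircle) :=
    Integrable.of_bound (hf.comp hmp.measurable).aestronglyMeasurable C
      (Filter.Eventually.of_forall fun _ => hC _)
  have hint' : Integrable (fun p : (Fin n → AddCircle β) × AddCircle β =>
      f (Function.update p.1 y (p.1 z + p.2))) ((timeMeasure β n).prod AddCircle.haarAddCircle) :=
    Integrable.of_bound ((hf.comp hmp.measurable).comp hadd).aestronglyMeasurable C
      (Filter.Eventually.of_forall fun _ => hC _)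
  rw [← hmp.map_eq, integral_map hmp.measurable.aemeasurable hf.aestronglyMeasurable, hmp.map_eq,
    integral_prod _ hint, ← integral_integral_swap (f := fun t x =>
      f (Function.update t y (t z + x))) hint']
  congr 1
  funext t
  exact (integral_add_left_eq_self (fun x => f (Function.update t y x)) (t z)).symm

theorem measurable_sub_sub {T : ℝ} (i z : Fin n) (x : AddCircle T) :
    Measurable fun t : Fin n → AddCircle T => t i - t z - x :=
  (Measurable.sub (f := fun t : Fin n → AddCircle T => t i) (g := fun t => t z)
    (measurable_pi_apply i) (measurable_pi_apply z)).sub_const x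

/-- The difference of two distinct times is uniformly distributed. -/
theorem timeMeasure_sub_mem {i z : Fin n} (hiz : i ≠ z) (x : AddCircle β) {B : Set (AddCircle β)}
    (hB : MeasurableSet B) :
    timeMeasure β n {t | t i - t z - x ∈ B} = AddCircle.haarAddCircle B := by
  have hmp := measurePreserving_update (β := β) i
  have hset : MeasurableSet {t : Fin n → AddCircle β | t i - t z - x ∈ B} :=
    measurable_sub_sub i z x hB
  rw [← hmp.measure_preimage hset.nullMeasurableSet, Measure.prod_apply (hmp.measurable hset)]
  have : ∀ t : Fin n → AddCircle β, AddCircle.haarAddCircle (Prod.mk t ⁻¹'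
      ((fun p : (Fin n → AddCircle β) × AddCircle β => Function.update p.1 i p.2) ⁻¹'
        {t | t i - t z - x ∈ B})) = AddCircle.haarAddCircle B := by
    intro t
    have : (Prod.mk t ⁻¹' ((fun p : (Fin n → AddCircle β) × AddCircle β =>
        Function.update p.1 i p.2) ⁻¹' {t | t i - t z - x ∈ B})) =
        (fun u : AddCircle β => u + (- t z - x)) ⁻¹' B := by
      ext u
      simp only [Set.mem_preimage, Set.mem_ofPred_eq, Function.update_self,
        Function.update_of_ne hiz.symm]
      rw [show u - t z - x = u + (-t z - x) by abel]
    rw [this, measure_preimage_add_right]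
  rw [lintegral_congr this]
  simp

theorem measurableSet_circleRep_le (h : ℝ) : MeasurableSet {x : AddCircle β | circleRep x ≤ h} :=
  measurableSet_le measurable_circleRep measurable_const

theorem haarAddCircle_circleRep_le {h : ℝ} (hh : 0 ≤ h) :
    AddCircle.haarAddCircle.real {x : AddCircle β | circleRep x ≤ h} ≤ h / β := by
  have hβ0 := hβ.out
  have hmp : MeasurePreserving (fun x : ℝ => (x : AddCircle β))
      (volume.restrict (Set.Ico 0 β)) volume := by
    have := AddCircle.measurePreserving_mk β 0
    rw [zero_add] at this
    rwa [restrict_Ico_eq_restrict_Ioc]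
  have h1 : (volume : Measure (AddCircle β)) {x : AddCircle β | circleRep x ≤ h} ≤
      ENNReal.ofReal h := by
    rw [← hmp.measure_preimage (measurableSet_circleRep_le h).nullMeasurableSet,
      Measure.restrict_apply (hmp.measurable (measurableSet_circleRep_le h))]
    calc _ ≤ volume (Set.Icc 0 h) := by
          refine measure_mono fun x hx => ?_
          have := hx.1
          simp only [Set.mem_preimage, Set.mem_ofPred_eq, circleRep_coe hx.2] at this
          exact ⟨hx.2.1, this⟩
      _ = _ := by simp
  rw [AddCircle.volume_eq_smul_haarAddCircle, Measure.smul_apply, smul_eq_mul] at h1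
  have h2 := ENNReal.toReal_mono ENNReal.ofReal_ne_top h1
  rw [ENNReal.toReal_mul, ENNReal.toReal_ofReal hβ0.le, ENNReal.toReal_ofReal hh] at h2
  rw [le_div_iff₀ hβ0, mul_comm]
  exact h2

/-- The difference of two times is uniform, so it lies within h after 0 with probability at most
h/β; h = 0 gives a null set. -/
theorem ae_ne {i z : Fin n} (hiz : i ≠ z) :
    ∀ᵐ t ∂timeMeasure β n, t i ≠ t z := by
  have h0 : ∀ h : ℝ, 0 ≤ h → (timeMeasure β n).real {t | t i = t z} ≤ h / β := by
    intro h hh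
    have h1 : (timeMeasure β n).real {t : Fin n → AddCircle β | t i - t z - 0 ∈
        {x : AddCircle β | circleRep x ≤ h}} ≤ h / β := by
      rw [measureReal_def, timeMeasure_sub_mem hiz 0 (measurableSet_circleRep_le h)]
      exact haarAddCircle_circleRep_le hh
    refine le_trans (measureReal_mono ?_) h1
    intro t ht
    have ht : t i = t z := ht
    have : circleRep (0 : AddCircle β) = 0 := circleRep_coe (s := 0) ⟨le_rfl, hβ.out⟩
    simp [ht, this, hh]
  have h1 := h0 0 le_rfl
  rw [zero_div] at h1
  have h2 := le_antisymm h1 measureReal_nonneg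
  rw [measureReal_eq_zero_iff] at h2
  rw [ae_iff]
  simpa using h2

end Resample

/-! ### Lipschitz dependence on the time difference of two commuting observables. -/

section PairMoments

open scoped Matrix.Norms.Operator

variable {β : ℝ} [hβ : Fact (0 < β)] {n : ℕ} {F : Type*} [Fintype F] [DecidableEq F]
  (A : Matrix F F ℂ)

theorem timeOrderedProd_update_of_notMem (O : Fin n → Matrix F F ℂ) (t : Fin n → ℝ) {y : Fin n}
    (x : ℝ) {P : Finset (Fin n)} (hy : y ∉ P) :
    timeOrderedProd A O (Function.update t y x) P = timeOrderedProd A O t P :=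
  timeOrderedProd_congr A P (fun _ _ => rfl) fun a ha =>
    Function.update_of_ne (fun h : a = y => hy (h ▸ ha)) _ _

theorem timeOrderedProd_pair (O : Fin n → Matrix F F ℂ) (t : Fin n → ℝ) {y z : Fin n}
    (hyz : y ≠ z) : timeOrderedProd A O t {y, z} =
      imagEvolve A (O y) (t y) * imagEvolve A (O z) (t z) ∨
    timeOrderedProd A O t {y, z} =
      imagEvolve A (O z) (t z) * imagEvolve A (O y) (t y) := by
  rcases precedes_or (t := t) hyz with h | h
  · left
    rw [timeOrderedProd_insert A O (by simpa using h), timeOrderedProd_singleton]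
  · right
    rw [Finset.pair_comm, timeOrderedProd_insert A O (by simpa using h),
      timeOrderedProd_singleton]

theorem commute_imagEvolve {X Y : Matrix F F ℂ} (h : Commute X Y) (t : ℝ) :
    Commute (imagEvolve A X t) (imagEvolve A Y t) := by
  unfold Commute SemiconjBy
  rw [← imagEvolve_mul, ← imagEvolve_mul, h.eq]

/-- If no other time lies in `[0, h]`, then moving a time from `h` to `0` across a commuting
observable changes the time-ordered product by `O(h)`. -/
theorem norm_timeOrderedProd_sub_le {O : Fin n → Matrix F F ℂ} {y z : Fin n} {S : Finset (Fin n)}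
    (hyz : y ≠ z) (hy : y ∉ S) (hz : z ∉ S) (hcomm : Commute (O y) (O z)) {B K : ℝ}
    (hB1 : 1 ≤ B) (hB : ∀ i, ∀ s ∈ Set.Icc 0 β, ‖imagEvolve A (O i) s‖ ≤ B) (hK0 : 0 ≤ K)
    (hK : ∀ s ∈ Set.Icc 0 β, ∀ s' ∈ Set.Icc 0 β,
      ‖imagEvolve A (O y) s - imagEvolve A (O y) s'‖ ≤ K * |s - s'|)
    {t : Fin n → ℝ} (ht : ∀ i, t i ∈ Set.Ico 0 β) {h : ℝ} (hh : h ∈ Set.Ico 0 β)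
    (hS : ∀ i ∈ S, h < t i) :
    ‖timeOrderedProd A O (Function.update t y h) (insert y (insert z S)) -
      timeOrderedProd A O (Function.update t y 0) (insert y (insert z S))‖ ≤
      ‖(1 : Matrix F F ℂ)‖ * B ^ n * (2 * B * K) * h := by
  have hβ0 := hβ.out
  have hB' : ∀ i, ‖imagEvolve A (O i) (t i)‖ ≤ B := fun i =>
    hB i _ (Set.Ico_subset_Icc_self (ht i))
  have h0 : (0 : ℝ) ∈ Set.Icc 0 β := ⟨le_rfl, hβ0.le⟩
  have hhI : h ∈ Set.Icc 0 β := Set.Ico_subset_Icc_self hh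
  have hN := norm_timeOrderedProd_le A hB1 hB'
  rcases lt_or_ge h (t z) with hzh | hzh
  -- Here `y` never meets `z`: it stays the earliest label, and only its own evolution varies.
  · have key : ∀ τ ∈ Set.Icc 0 h, timeOrderedProd A O (Function.update t y τ)
        (insert y (insert z S)) = timeOrderedProd A O t (insert z S) *
          imagEvolve A (O y) τ := by
      intro τ hτ
      have hy' : y ∉ insert z S := by simp [hyz, hy]
      rw [Finset.insert_eq, Finset.union_comm, timeOrderedProd_union A O fun a ha b hb => Or.inl ?_]
      · rw [timeOrderedProd_update_of_notMem A O t τ hy']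
        simp
      · rw [Finset.mem_singleton.1 hb, Function.update_self,
          Function.update_of_ne (fun h : a = y => hy' (h ▸ ha))]
        rcases Finset.mem_insert.1 ha with rfl | ha
        · exact hτ.2.trans_lt hzh
        · exact hτ.2.trans_lt (hS a ha)
    rw [key h ⟨hh.1, le_rfl⟩, key 0 ⟨le_rfl, hh.1⟩, ← mul_sub]
    calc _ ≤ ‖timeOrderedProd A O t (insert z S)‖ *
          ‖imagEvolve A (O y) h - imagEvolve A (O y) 0‖ := norm_mul_le _ _
      _ ≤ (‖(1 : Matrix F F ℂ)‖ * B ^ n) * (K * |h - 0|) := by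
          gcongr
          · exact hN _
          · exact hK _ hhI _ h0
      _ = (‖(1 : Matrix F F ℂ)‖ * B ^ n) * (1 * K) * h := by
          rw [sub_zero, abs_of_nonneg hh.1]; ring
      _ ≤ (‖(1 : Matrix F F ℂ)‖ * B ^ n) * (2 * B * K) * h := by
          have := hh.1
          gcongr
          linarith
  -- Here `y` may cross `z`, and both lie in the window. Either order is compared with the product
  -- at the common time `r`, where the factors commute; the two comparisons account for the factor 2
  -- in the constant.
  · set r := t z with hr
    have hrI : r ∈ Set.Icc 0 β := Set.Ico_subset_Icc_self (ht z)
    set C := imagEvolve A (O y) r * imagEvolve A (O z) r with hC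
    have hC' : C = imagEvolve A (O z) r * imagEvolve A (O y) r :=
      (commute_imagEvolve A hcomm r).eq
    have key : ∀ τ ∈ Set.Icc 0 h, timeOrderedProd A O (Function.update t y τ)
        (insert y (insert z S)) = timeOrderedProd A O t S *
          timeOrderedProd A O (Function.update t y τ) {y, z} := by
      intro τ hτ
      have : insert y (insert z S) = S ∪ {y, z} := by
        ext; simp only [Finset.mem_insert, Finset.mem_union, Finset.mem_singleton]; tauto
      rw [this, timeOrderedProd_union A O fun a ha b hb => Or.inl ?_]
      · rw [timeOrderedProd_update_of_notMem A O t τ hy]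
      · rw [Function.update_of_ne (fun h : a = y => hy (h ▸ ha))]
        rcases Finset.mem_insert.1 hb with rfl | hb
        · rw [Function.update_self]
          exact hτ.2.trans_lt (hS a ha)
        · rw [Finset.mem_singleton.1 hb, Function.update_of_ne hyz.symm]
          exact hzh.trans_lt (hS a ha)
    have hpair : ∀ τ ∈ Set.Icc 0 h,
        ‖timeOrderedProd A O (Function.update t y τ) {y, z} - C‖ ≤ B * K * h := by
      intro τ hτ
      have hτI : τ ∈ Set.Icc 0 β := ⟨hτ.1, hτ.2.trans hhI.2⟩
      have hd : ‖imagEvolve A (O y) τ - imagEvolve A (O y) r‖ ≤ K * h := by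
        refine (hK τ hτI r hrI).trans ?_
        gcongr
        rw [abs_le]
        have := hτ.1; have := hτ.2; have := hrI.1
        constructor <;> linarith
      have hBK : ‖imagEvolve A (O z) r‖ ≤ B := hB' z
      rcases timeOrderedProd_pair A O (Function.update t y τ) hyz with e | e
      · rw [e, Function.update_self, Function.update_of_ne hyz.symm, hC, ← sub_mul]
        calc _ ≤ ‖imagEvolve A (O y) τ - imagEvolve A (O y) r‖ * ‖imagEvolve A (O z) r‖ :=
              norm_mul_le _ _
          _ ≤ (K * h) * B := by
              have := hh.1
              gcongr
          _ = B * K * h := by ring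
      · rw [e, Function.update_self, Function.update_of_ne hyz.symm, hC', ← mul_sub]
        calc _ ≤ ‖imagEvolve A (O z) r‖ * ‖imagEvolve A (O y) τ - imagEvolve A (O y) r‖ :=
              norm_mul_le _ _
          _ ≤ B * (K * h) := by
              gcongr
          _ = B * K * h := by ring
    have e1 := hpair h ⟨hh.1, le_rfl⟩
    have e2 := hpair 0 ⟨le_rfl, hh.1⟩
    rw [key h ⟨hh.1, le_rfl⟩, key 0 ⟨le_rfl, hh.1⟩, ← mul_sub]
    calc _ ≤ ‖timeOrderedProd A O t S‖ * ‖timeOrderedProd A O (Function.update t y h) {y, z} -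
          timeOrderedProd A O (Function.update t y 0) {y, z}‖ := norm_mul_le _ _
      _ ≤ (‖(1 : Matrix F F ℂ)‖ * B ^ n) * (B * K * h + B * K * h) := by
          gcongr
          · exact hN _
          · refine (norm_sub_le_norm_sub_add_norm_sub _ C _).trans (add_le_add e1 ?_)
            rwa [norm_sub_rev]
      _ = _ := by ring

theorem circleRep_update (t : Fin n → AddCircle β) (y : Fin n) (x : AddCircle β) :
    (fun i => circleRep (Function.update t y x i)) =
      Function.update (fun i => circleRep (t i)) y (circleRep x) := by
  funext i
  by_cases h : i = y
  · subst h; simp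
  · simp [h]

/-- Rotation of the time circle brings `u` to 0, so a window straddling the cut of the circle needs
no separate treatment. -/
theorem exists_norm_circleMoment_sub_le (β : ℝ) [hβ : Fact (0 < β)] {O : Fin n → Matrix F F ℂ}
    {y z : Fin n} {S : Finset (Fin n)}
    (hyz : y ≠ z) (hy : y ∉ S) (hz : z ∉ S) (hcomm : Commute (O y) (O z)) :
    ∃ K : ℝ, 0 ≤ K ∧ ∀ (t : Fin n → AddCircle β) (u : AddCircle β) (h : ℝ), h ∈ Set.Ico 0 β →
      (∀ i ∈ S, h < circleRep (t i - u)) →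
      ‖circleMoment A O (Function.update t y (u + (h : AddCircle β))) (insert y (insert z S)) -
        circleMoment A O (Function.update t y u) (insert y (insert z S))‖ ≤ K * h := by
  obtain ⟨B, hB1, hB⟩ := exists_norm_imagEvolve_le A O β
  obtain ⟨K, hK0, hK⟩ := exists_imagEvolve_lipschitz A (O y) β
  obtain ⟨C, hC0, hC⟩ := exists_norm_gibbsAvg_le A β
  refine ⟨C * (‖(1 : Matrix F F ℂ)‖ * B ^ n * (2 * B * K)), by positivity,
    fun t u h hh hS => ?_⟩
  have e : ∀ x : AddCircle β,
      circleMoment A O (Function.update t y (u + x)) (insert y (insert z S)) =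
      gibbsAvg A β (timeOrderedProd A O (Function.update (fun i => circleRep (t i - u)) y
        (circleRep x)) (insert y (insert z S))) := by
    intro x
    rw [← circleMoment_add A O _ (-u), circleMoment, if_neg (Finset.insert_ne_empty _ _)]
    have : (fun i => Function.update t y (u + x) i + -u) =
        Function.update (fun i => t i - u) y x := by
      funext i
      by_cases hi : i = y
      · subst hi; simp
      · simp [hi, sub_eq_add_neg]
    have h2 : (fun i => circleRep (Function.update t y (u + x) i + -u)) =
        Function.update (fun i => circleRep (t i - u)) y (circleRep x) := by
      rw [← circleRep_update (fun i => t i - u) y x, ← this]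
    rw [h2]
  have e0 := e 0
  rw [add_zero, show circleRep (0 : AddCircle β) = 0 from
    circleRep_coe (s := 0) ⟨le_rfl, hβ.out⟩] at e0
  rw [e0, e, circleRep_coe hh, ← gibbsAvg_sub]
  refine (hC _).trans ?_
  rw [mul_assoc]
  gcongr
  exact norm_timeOrderedProd_sub_le A hyz hy hz hcomm hB1 hB hK0 hK
    (fun i => circleRep_mem _) hh hS

/-- The moment as a function of the time difference of the labels `y` and `z`, averaged over all
the other times. -/
def pairMoment (O : Fin n → Matrix F F ℂ) (w : Fin n → ℤ) (y z : Fin n) (S : Finset (Fin n))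
    (u : AddCircle β) : ℂ :=
  ∫ t, timePhase w t S *
    circleMoment A O (Function.update t y (t z + u)) (insert y (insert z S)) ∂timeMeasure β n

theorem measurable_update_add (y z : Fin n) (u : AddCircle β) :
    Measurable fun t : Fin n → AddCircle β => Function.update t y (t z + u) :=
  (measurePreserving_update (β := β) y).measurable.comp
    (measurable_id.prodMk (Measurable.add_const (f := fun t : Fin n → AddCircle β => t z)
      (measurable_pi_apply z) u))

/-- The integrand changes by O(h) unless another label lies in the window swept by `y`. For each
label that has probability at most h/β, and the change is then bounded by 2D, so the exceptional set
also contributes O(h). -/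
theorem exists_pairMoment_lipschitz (β : ℝ) [hβ : Fact (0 < β)] {O : Fin n → Matrix F F ℂ}
    (w : Fin n → ℤ) {y z : Fin n} {S : Finset (Fin n)} (hyz : y ≠ z) (hy : y ∉ S) (hz : z ∉ S)
    (hcomm : Commute (O y) (O z)) :
    ∃ K : ℝ, 0 ≤ K ∧ ∀ (u : AddCircle β) (h : ℝ), h ∈ Set.Ico 0 β →
      ‖pairMoment A O w y z S (u + (h : AddCircle β)) - pairMoment A O w y z S u‖ ≤ K * h := by
  obtain ⟨K, hK0, hK⟩ := exists_norm_circleMoment_sub_le A β hyz hy hz hcomm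
  obtain ⟨D, hD⟩ := exists_norm_circleMoment_le A β O
  have hD0 : 0 ≤ D := (norm_nonneg _).trans (hD 0 ∅)
  have hβ0 := hβ.out
  refine ⟨K + ∑ i ∈ S, 2 * D / β, by positivity, fun u h hh => ?_⟩
  have hmeas : ∀ u : AddCircle β, Measurable fun t : Fin n → AddCircle β => timePhase w t S *
      circleMoment A O (Function.update t y (t z + u)) (insert y (insert z S)) := fun u =>
    (measurable_timePhase w S).mul
      ((measurable_circleMoment A O _).comp (measurable_update_add y z u))
  have hint : ∀ u : AddCircle β, Integrable (fun t : Fin n → AddCircle β => timePhase w t S *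
      circleMoment A O (Function.update t y (t z + u)) (insert y (insert z S)))
      (timeMeasure β n) := fun u => by
    refine integrable_of_bounded (C := D) (hmeas u) fun t => ?_
    rw [norm_mul, norm_timePhase, one_mul]
    exact hD _ _
  let B : Fin n → Set (Fin n → AddCircle β) := fun i =>
    {t | t i - t z - u ∈ {x : AddCircle β | circleRep x ≤ h}}
  have hBm : ∀ i, MeasurableSet (B i) := fun i =>
    measurable_sub_sub i z u (measurableSet_circleRep_le h)
  have hbound : ∀ t : Fin n → AddCircle β,
      ‖timePhase w t S * circleMoment A O (Function.update t y (t z + (u + (h : AddCircle β))))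
          (insert y (insert z S)) -
        timePhase w t S * circleMoment A O (Function.update t y (t z + u))
          (insert y (insert z S))‖ ≤
      K * h + ∑ i ∈ S, (B i).indicator (fun _ => 2 * D) t := by
    intro t
    rw [← mul_sub, norm_mul, norm_timePhase, one_mul, ← add_assoc]
    have hnn : 0 ≤ ∑ i ∈ S, (B i).indicator (fun _ => 2 * D) t :=
      Finset.sum_nonneg fun i _ => Set.indicator_nonneg (fun _ _ => by positivity) _
    by_cases hS : ∀ i ∈ S, h < circleRep (t i - (t z + u))
    · exact (hK t (t z + u) h hh hS).trans (le_add_of_nonneg_right hnn)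
    · push Not at hS
      obtain ⟨i, hi, hih⟩ := hS
      have h1 : 2 * D ≤ ∑ i ∈ S, (B i).indicator (fun _ => 2 * D) t := by
        refine le_trans (le_of_eq ?_) (Finset.single_le_sum
          (f := fun i => (B i).indicator (fun _ => 2 * D) t)
          (fun i _ => Set.indicator_nonneg (fun _ _ => by positivity) _) hi)
        rw [Set.indicator_of_mem]
        show circleRep (t i - t z - u) ≤ h
        rwa [sub_sub]
      have h2 : ‖circleMoment A O (Function.update t y (t z + u + (h : AddCircle β)))
          (insert y (insert z S)) - circleMoment A O (Function.update t y (t z + u))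
          (insert y (insert z S))‖ ≤ D + D :=
        (norm_sub_le _ _).trans (add_le_add (hD _ _) (hD _ _))
      have h3 : 0 ≤ K * h := mul_nonneg hK0 hh.1
      linarith
  have hindint : ∀ i, Integrable ((B i).indicator fun _ => 2 * D) (timeMeasure β n) := fun i =>
    (integrable_const _).indicator (hBm i)
  unfold pairMoment
  rw [← integral_sub (hint _) (hint _)]
  refine (norm_integral_le_of_norm_le ((integrable_const (K * h)).add
    (integrable_finsetSum _ fun i _ => hindint i)) (Filter.Eventually.of_forall hbound)).trans ?_
  have e1 : ∫ t, (K * h + ∑ i ∈ S, (B i).indicator (fun _ => 2 * D) t)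
      ∂timeMeasure β n = K * h + ∑ i ∈ S, (timeMeasure β n).real (B i) * (2 * D) := by
    rw [integral_add (integrable_const _) (integrable_finsetSum _ fun i _ => hindint i),
      integral_finsetSum _ fun i _ => hindint i]
    congr 1
    · simp
    · refine Finset.sum_congr rfl fun i _ => ?_
      rw [integral_indicator (hBm i), setIntegral_const, smul_eq_mul]
  refine (le_of_eq e1).trans ?_
  rw [add_mul, Finset.sum_mul]
  refine add_le_add le_rfl (Finset.sum_le_sum fun i hi => ?_)
  have hiz : i ≠ z := fun h => hz (h ▸ hi)
  have : (timeMeasure β n).real (B i) ≤ h / β := by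
    rw [measureReal_def, timeMeasure_sub_mem hiz u (measurableSet_circleRep_le h)]
    exact haarAddCircle_circleRep_le hh.1
  calc (timeMeasure β n).real (B i) * (2 * D) ≤ h / β * (2 * D) := by gcongr
    _ = 2 * D / β * h := by ring

end PairMoments
end

noncomputable section

open MeasureTheory ProbabilityTheory

/-! ### Summing over the exchanged frequency puts two observables at the same time. -/

section CoincidingTimes

variable {β : ℝ} [hβ : Fact (0 < β)] {n : ℕ} {F : Type*} [Fintype F] [DecidableEq F]
  (A : Matrix F F ℂ)

theorem continuous_of_lipschitz_translate {g : AddCircle β → ℂ} {K : ℝ} (hK : 0 ≤ K)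
    (h : ∀ (u : AddCircle β) (s : ℝ), s ∈ Set.Ico 0 β → ‖g (u + (s : AddCircle β)) - g u‖ ≤ K * s) :
    Continuous g := by
  have hβ0 := hβ.out
  have key : ∀ u d : AddCircle β, ‖g (u + d) - g u‖ ≤ K * ‖d‖ := by
    intro u d
    obtain ⟨x, rfl⟩ := QuotientAddGroup.mk_surjective d
    change ‖g (u + (x : AddCircle β)) - g u‖ ≤ K * ‖(x : AddCircle β)‖
    have hle := AddCircle.norm_le_half_period β hβ0.ne' (x := (x : AddCircle β))
    rw [AddCircle.norm_eq] at hle ⊢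
    rw [abs_of_pos hβ0] at hle
    set r : ℝ := x - round (β⁻¹ * x) * β with hr
    have hx : (x : AddCircle β) = (r : AddCircle β) := by
      rw [hr, AddCircle.coe_sub, ← zsmul_eq_mul, AddCircle.coe_zsmul, AddCircle.coe_period]
      simp
    rw [hx]
    rcases le_or_gt 0 r with h0 | h0
    · rw [abs_of_nonneg h0] at hle ⊢
      exact h u r ⟨h0, by linarith⟩
    -- The hypothesis covers forward increments only; a backward one is a forward one from the other
    -- endpoint.
    · rw [abs_of_neg h0] at hle ⊢
      have := h (u + (r : AddCircle β)) (-r) ⟨by linarith, by linarith⟩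
      rw [add_assoc, ← AddCircle.coe_add, add_neg_cancel, AddCircle.coe_zero, add_zero] at this
      rwa [norm_sub_rev]
  refine LipschitzWith.continuous (K := K.toNNReal) (LipschitzWith.of_dist_le_mul fun u v => ?_)
  rw [Real.coe_toNNReal _ hK, dist_eq_norm, dist_eq_norm]
  have := key v (u - v)
  rwa [add_sub_cancel] at this

/-- Summing the moments over the frequency flowing from `y` to `z` makes the two times coincide. -/
theorem hasSum_fourierMoment_pairMoment {O : Fin n → Matrix F F ℂ} (w : Fin n → ℤ) {y z : Fin n}
    {S : Finset (Fin n)} (hyz : y ≠ z) (hy : y ∉ S) (hz : z ∉ S) (hcomm : Commute (O y) (O z)) :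
    HasSum (fun m : ℤ => fourierMoment A β O (Function.update (Function.update w y m) z (-m))
      (insert y (insert z S))) (pairMoment (β := β) A O w y z S 0) := by
  obtain ⟨K, hK0, hK⟩ := exists_pairMoment_lipschitz A β w hyz hy hz hcomm
  obtain ⟨D, hD⟩ := exists_norm_circleMoment_le A β O
  let g : C(AddCircle β, ℂ) :=
    ⟨pairMoment A O w y z S, continuous_of_lipschitz_translate hK0 hK⟩
  -- With opposite frequencies at `y` and `z`, the phases depend only on u = t_y - t_z, so
  -- integrating over u gives a Fourier coefficient of the pair moment.
  have hcoeff : ∀ m : ℤ, fourierMoment A β O (Function.update (Function.update w y m) z (-m))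
      (insert y (insert z S)) = fourierCoeff g m := by
    intro m
    unfold fourierMoment fourierCoeff
    rw [integral_eq_integral_update (y := y) (z := z) (f := fun t : Fin n → AddCircle β =>
        timePhase (Function.update (Function.update w y m) z (-m)) t (insert y (insert z S)) *
          circleMoment A O t (insert y (insert z S)))
      ((measurable_timePhase _ _).mul (measurable_circleMoment A O _)) (C := D) fun t => by
        rw [norm_mul, norm_timePhase, one_mul]; exact hD _ _]
    congr 1
    funext u
    rw [smul_eq_mul]
    change _ = fourier (-m) u * pairMoment A O w y z S u
    unfold pairMoment
    rw [← integral_const_mul]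
    congr 1
    funext t
    rw [← mul_assoc]
    congr 1
    unfold timePhase
    rw [Finset.prod_insert (by simp [hyz, hy]), Finset.prod_insert hz]
    simp only [Function.update_self, Function.update_of_ne hyz, Function.update_of_ne hyz.symm,
      neg_neg]
    have hS : ∏ i ∈ S, fourier (-Function.update (Function.update w y m) z (-m) i)
        (Function.update t y (t z + u) i) = ∏ i ∈ S, fourier (-w i) (t i) := by
      refine Finset.prod_congr rfl fun i hi => ?_
      have hiy : i ≠ y := fun h => hy (h ▸ hi)
      have hiz : i ≠ z := fun h => hz (h ▸ hi)
      rw [Function.update_of_ne hiz, Function.update_of_ne hiy, Function.update_of_ne hiy]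
    rw [hS, fourier_add_apply]
    have h1 : fourier (-m) (t z) * fourier m (t z) = 1 := by rw [← fourier_add]; simp
    generalize fourier (-m) (t z) = a at *
    generalize fourier m (t z) = b at *
    generalize fourier (-m) u = c at *
    generalize (∏ i ∈ S, fourier (-w i) (t i)) = d at *
    linear_combination (c * d) * h1
  have hsum := summable_fourierCoeff_of_lipschitz g K hK
  have h1 := has_pointwise_sum_fourier_series_of_summable hsum 0
  simp only [fourier_eval_zero, smul_eq_mul, mul_one] at h1
  rw [funext hcoeff]
  exact h1

theorem timeOrderedProd_insert_split (O : Fin n → Matrix F F ℂ) {t : Fin n → ℝ} {z : Fin n}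
    {S : Finset (Fin n)} (hz : z ∉ S) (ht : ∀ i ∈ S, t i ≠ t z) (X : Matrix F F ℂ) :
    timeOrderedProd A (Function.update O z X) t (insert z S) =
      timeOrderedProd A O t (S.filter fun i => t z < t i) * imagEvolve A X (t z) *
        timeOrderedProd A O t (S.filter fun i => t i < t z) := by
  have hsplit : insert z S = (S.filter fun i => t z < t i) ∪
      ({z} ∪ (S.filter fun i => t i < t z)) := by
    ext i
    simp only [Finset.mem_insert, Finset.mem_union, Finset.mem_filter, Finset.mem_singleton]
    constructor
    · rintro (h | h)
      · exact Or.inr (Or.inl h)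
      · rcases lt_or_gt_of_ne (ht i h) with h' | h'
        · exact Or.inr (Or.inr ⟨h, h'⟩)
        · exact Or.inl ⟨h, h'⟩
    · rintro (h | h | h)
      · exact Or.inr h.1
      · exact Or.inl h
      · exact Or.inr h.1
  have hcongr : ∀ P ⊆ S, timeOrderedProd A (Function.update O z X) t P =
      timeOrderedProd A O t P := fun P hP =>
    timeOrderedProd_congr A P (fun a ha => Function.update_of_ne
      (fun h : a = z => hz (h ▸ hP ha)) _ _) fun _ _ => rfl
  rw [hsplit, timeOrderedProd_union A, timeOrderedProd_union A, timeOrderedProd_singleton,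
    Function.update_self, hcongr _ (Finset.filter_subset _ _),
    hcongr _ (Finset.filter_subset _ _), mul_assoc]
  · intro a ha b hb
    rw [Finset.mem_singleton.1 ha]
    exact Or.inl (Finset.mem_filter.1 hb).2
  · intro a ha b hb
    have ha' := (Finset.mem_filter.1 ha).2
    refine Or.inl ?_
    rcases Finset.mem_union.1 hb with hb | hb
    · rwa [Finset.mem_singleton.1 hb]
    · exact (Finset.mem_filter.1 hb).2.trans ha'

/-- The labels decide the order of the two simultaneous factors; commutativity makes it immaterial
and merges them into one evolved product. -/
theorem timeOrderedProd_coinciding {O : Fin n → Matrix F F ℂ} {t : Fin n → ℝ} {y z : Fin n}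
    {S : Finset (Fin n)} (hyz : y ≠ z) (hy : y ∉ S) (ht : ∀ i ∈ S, t i ≠ t z)
    (hcomm : Commute (O y) (O z)) :
    timeOrderedProd A O (Function.update t y (t z)) (insert y (insert z S)) =
      timeOrderedProd A O t (S.filter fun i => t z < t i) * imagEvolve A (O y * O z) (t z) *
        timeOrderedProd A O t (S.filter fun i => t i < t z) := by
  have hsplit : insert y (insert z S) = (S.filter fun i => t z < t i) ∪
      ({y, z} ∪ (S.filter fun i => t i < t z)) := by
    ext i
    simp only [Finset.mem_insert, Finset.mem_union, Finset.mem_filter, Finset.mem_singleton]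
    constructor
    · rintro (h | h | h)
      · exact Or.inr (Or.inl (Or.inl h))
      · exact Or.inr (Or.inl (Or.inr h))
      · rcases lt_or_gt_of_ne (ht i h) with h' | h'
        · exact Or.inr (Or.inr ⟨h, h'⟩)
        · exact Or.inl ⟨h, h'⟩
    · rintro (h | (h | h) | h)
      · exact Or.inr (Or.inr h.1)
      · exact Or.inl h
      · exact Or.inr (Or.inl h)
      · exact Or.inr (Or.inr h.1)
  have hpair : timeOrderedProd A O (Function.update t y (t z)) {y, z} =
      imagEvolve A (O y * O z) (t z) := by
    rw [imagEvolve_mul]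
    rcases timeOrderedProd_pair A O (Function.update t y (t z)) hyz with e | e <;>
      rw [e, Function.update_self, Function.update_of_ne hyz.symm]
    exact (commute_imagEvolve A hcomm (t z)).symm.eq
  have hcongr : ∀ P ⊆ S, timeOrderedProd A O (Function.update t y (t z)) P =
      timeOrderedProd A O t P := fun P hP =>
    timeOrderedProd_update_of_notMem A O t _ fun h => hy (hP h)
  have hyval : ∀ b ∈ ({y, z} : Finset (Fin n)), Function.update t y (t z) b = t z := by
    intro b hb
    rcases Finset.mem_insert.1 hb with rfl | hb
    · rw [Function.update_self]
    · rw [Finset.mem_singleton.1 hb, Function.update_of_ne hyz.symm]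
  have hSval : ∀ b ∈ S, Function.update t y (t z) b = t b := fun b hb =>
    Function.update_of_ne (fun h : b = y => hy (h ▸ hb)) _ _
  rw [hsplit, timeOrderedProd_union A, timeOrderedProd_union A, hpair,
    hcongr _ (Finset.filter_subset _ _), hcongr _ (Finset.filter_subset _ _), mul_assoc]
  · intro a ha b hb
    refine Or.inl ?_
    rw [hyval a ha, hSval b (Finset.mem_filter.1 hb).1]
    exact (Finset.mem_filter.1 hb).2
  · intro a ha b hb
    have ha' := (Finset.mem_filter.1 ha).2
    refine Or.inl ?_
    rw [hSval a (Finset.mem_filter.1 ha).1]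
    rcases Finset.mem_union.1 hb with hb | hb
    · rwa [hyval b hb]
    · rw [hSval b (Finset.mem_filter.1 hb).1]
      exact (Finset.mem_filter.1 hb).2.trans ha'

theorem imagEvolve_sum_smul {Λ : Type*} [Fintype Λ] (c : Λ → ℂ) (X : Λ → Matrix F F ℂ) (t : ℝ) :
    imagEvolve A (∑ l, c l • X l) t = ∑ l, c l • imagEvolve A (X l) t := by
  unfold imagEvolve
  rw [Finset.mul_sum, Finset.sum_mul]
  simp

/-- The Schwinger–Dyson equation for moments: an observable `∑_l c_l Y_l Z_l` at the label `z` is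
expanded in moments with the observables `Y_l`, `Z_l` at the labels `y`, `z`, summed over the
frequency exchanged between them. -/
theorem hasSum_fourierMoment {Λ : Type*} [Fintype Λ] (O : Fin n → Matrix F F ℂ) (w : Fin n → ℤ)
    {y z : Fin n} {S : Finset (Fin n)} (hyz : y ≠ z) (hy : y ∉ S) (hz : z ∉ S) (c : Λ → ℂ)
    (Y Z : Λ → Matrix F F ℂ) (hcomm : ∀ l, Commute (Y l) (Z l)) :
    HasSum (fun m : ℤ => ∑ l, c l * fourierMoment A β
      (Function.update (Function.update O y (Y l)) z (Z l))
      (Function.update (Function.update w y m) z (-m)) (insert y (insert z S)))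
      (fourierMoment A β (Function.update O z (∑ l, c l • (Y l * Z l))) (Function.update w z 0)
        (insert z S)) := by
  set OO : Λ → Fin n → Matrix F F ℂ := fun l =>
    Function.update (Function.update O y (Y l)) z (Z l) with hOO
  have hOy : ∀ l, OO l y = Y l := fun l => by simp [hOO, hyz]
  have hOz : ∀ l, OO l z = Z l := fun l => by simp [hOO]
  have hOS : ∀ l, ∀ i ∈ S, OO l i = O i := fun l i hi => by
    have hiy : i ≠ y := fun h => hy (h ▸ hi)
    have hiz : i ≠ z := fun h => hz (h ▸ hi)
    simp [hOO, hiy, hiz]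
  have hcomm' : ∀ l, Commute (OO l y) (OO l z) := fun l => by
    rw [hOy, hOz]; exact hcomm l
  have h1 : HasSum (fun m : ℤ => ∑ l, c l * fourierMoment A β (OO l)
      (Function.update (Function.update w y m) z (-m)) (insert y (insert z S)))
      (∑ l, c l * pairMoment (β := β) A (OO l) w y z S 0) :=
    hasSum_sum fun l _ =>
      (hasSum_fourierMoment_pairMoment A w hyz hy hz (hcomm' l)).mul_left (c l)
  convert h1 using 1
  have hint : ∀ l, Integrable (fun t : Fin n → AddCircle β => timePhase w t S *
      circleMoment A (OO l) (Function.update t y (t z + 0)) (insert y (insert z S)))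
      (timeMeasure β n) := fun l => by
    obtain ⟨D, hD⟩ := exists_norm_circleMoment_le A β (OO l)
    refine integrable_of_bounded (C := D) ((measurable_timePhase w S).mul
      ((measurable_circleMoment A (OO l) _).comp (measurable_update_add y z 0))) fun t => ?_
    rw [norm_mul, norm_timePhase, one_mul]
    exact hD _ _
  unfold fourierMoment pairMoment
  simp_rw [← integral_const_mul]
  rw [← integral_finsetSum _ fun l _ => (hint l).const_mul (c l)]
  refine integral_congr_ae ?_
  -- Off this null set every other factor stands strictly before or after the merged vertex, so the
  -- product and the vertex are inserted at the same place.
  have hae : ∀ᵐ t ∂timeMeasure β n, ∀ i ∈ S, t i ≠ t z := by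
    rw [Filter.eventually_all_finset]
    exact fun i hi => ae_ne fun h => hz (h ▸ hi)
  filter_upwards [hae] with t ht
  have ht' : ∀ i ∈ S, circleRep (t i) ≠ circleRep (t z) := fun i hi h =>
    ht i hi (circleRep_injective h)
  have hphase : timePhase (Function.update w z 0) t (insert z S) = timePhase w t S := by
    unfold timePhase
    rw [Finset.prod_insert hz]
    simp only [Function.update_self, neg_zero, fourier_zero, one_mul]
    refine Finset.prod_congr rfl fun i hi => ?_
    rw [Function.update_of_ne fun h : i = z => hz (h ▸ hi)]
  have hM : ∀ l, circleMoment A (OO l) (Function.update t y (t z + 0)) (insert y (insert z S)) =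
      gibbsAvg A β (timeOrderedProd A O (fun i => circleRep (t i))
          (S.filter fun i => circleRep (t z) < circleRep (t i)) *
        imagEvolve A (Y l * Z l) (circleRep (t z)) *
        timeOrderedProd A O (fun i => circleRep (t i))
          (S.filter fun i => circleRep (t i) < circleRep (t z))) := by
    intro l
    unfold circleMoment
    rw [if_neg (Finset.insert_ne_empty _ _), add_zero, circleRep_update,
      timeOrderedProd_coinciding (t := fun i => circleRep (t i)) A hyz hy ht' (hcomm' l), hOy, hOz]
    rw [timeOrderedProd_congr (O' := O) A _
        (fun a ha => hOS l a (Finset.mem_filter.1 ha).1) fun _ _ => rfl,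
      timeOrderedProd_congr (O' := O) A _
        (fun a ha => hOS l a (Finset.mem_filter.1 ha).1) fun _ _ => rfl]
  rw [hphase]
  simp only [hM]
  unfold circleMoment
  rw [if_neg (Finset.insert_ne_empty _ _),
    timeOrderedProd_insert_split (t := fun i => circleRep (t i)) A O hz ht',
    imagEvolve_sum_smul, Finset.mul_sum, Finset.sum_mul, gibbsAvg_sum, Finset.mul_sum]
  refine Finset.sum_congr rfl fun l _ => ?_
  rw [mul_smul_comm, smul_mul_assoc, gibbsAvg_smul]
  ring

end CoincidingTimes
end

noncomputable section

/-! ### Second quantization of permutations of the modes. -/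

section FockSpace

variable {M : Type*} [Fintype M] [DecidableEq M]

theorem fockCreate_apply (m : M) (S T : Finset M) : fockCreate m S T =
    if m ∉ T ∧ S = insert m T then
      (-1 : ℂ) ^ (T.filter fun m' => Fintype.equivFin M m' < Fintype.equivFin M m).card
    else 0 := rfl

theorem neg_one_pow_card_filter {ι : Type*} (T : Finset ι) (p : ι → Prop) [DecidablePred p] :
    (-1 : ℂ) ^ (T.filter p).card = ∏ a ∈ T, if p a then (-1 : ℂ) else 1 := by
  rw [Finset.prod_ite, Finset.prod_const, Finset.prod_const_one, mul_one]

/-- Occupation numbers are diagonal in the occupation-number basis. -/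
theorem fockCreate_mul_fockAnnihilate (m : M) :
    fockCreate m * fockAnnihilate m =
      Matrix.diagonal fun S : Finset M => if m ∈ S then (1 : ℂ) else 0 := by
  ext S T
  rw [Matrix.mul_apply, Matrix.diagonal_apply]
  simp only [fockAnnihilate, Matrix.conjTranspose_apply, fockCreate_apply]
  by_cases hm : m ∈ S
  · rw [Finset.sum_eq_single (S.erase m)]
    · by_cases hST : S = T
      · subst hST
        simp only [Finset.mem_erase, ne_eq, not_true_eq_false, false_and, not_false_eq_true,
          Finset.insert_erase hm, and_self, if_true, hm]
        rw [star_pow, star_neg, star_one, ← mul_pow]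
        simp
      · have hTS : T ≠ S := fun h => hST h.symm
        simp [hST, hTS, Finset.insert_erase hm]
    · intro R _ hR
      rw [if_neg, zero_mul]
      rintro ⟨h1, rfl⟩
      exact hR (Finset.erase_insert h1).symm
    · simp
  · rw [Finset.sum_eq_zero]
    · simp [hm]
    · intro R _
      rw [if_neg, zero_mul]
      rintro ⟨h1, rfl⟩
      exact hm (Finset.mem_insert_self _ _)

/-- The sign picked up by a pair of modes which is inverted by the permutation `π`. -/
def inversionSign (π : Equiv.Perm M) (a b : M) : ℂ :=
  if Fintype.equivFin M a < Fintype.equivFin M b ∧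
    Fintype.equivFin M (π b) < Fintype.equivFin M (π a) then -1 else 1

/-- The second quantization of a permutation of the modes. -/
def permOp (π : Equiv.Perm M) : FockOp M :=
  Matrix.of fun S T => if S = T.map π.toEmbedding then ∏ a ∈ T, ∏ b ∈ T, inversionSign π a b else 0

theorem permOp_apply (π : Equiv.Perm M) (S T : Finset M) : permOp π S T =
    if S = T.map π.toEmbedding then ∏ a ∈ T, ∏ b ∈ T, inversionSign π a b else 0 := rfl

theorem inversionSign_mul_self {M : Type*} [Fintype M] (π : Equiv.Perm M) (a b : M) :
    inversionSign π a b * inversionSign π a b = 1 := by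
  unfold inversionSign; split_ifs <;> simp

theorem star_inversionSign {M : Type*} [Fintype M] (π : Equiv.Perm M) (a b : M) :
    star (inversionSign π a b) = inversionSign π a b := by
  unfold inversionSign; split_ifs <;> simp

/-- For each `a` in `T`, the pair with `m` is inverted exactly when the ordering signs of (a, m) and
(π a, π m) differ, so the new inversions convert one creation sign into the other. -/
theorem prod_inversionSign_insert (π : Equiv.Perm M) {m : M} {T : Finset M} (hm : m ∉ T) :
    (∏ a ∈ insert m T, ∏ b ∈ insert m T, inversionSign π a b) *
      ∏ a ∈ T, (if Fintype.equivFin M a < Fintype.equivFin M m then (-1 : ℂ) else 1) =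
    (∏ a ∈ T, (if Fintype.equivFin M (π a) < Fintype.equivFin M (π m) then (-1 : ℂ) else 1)) *
      ∏ a ∈ T, ∏ b ∈ T, inversionSign π a b := by
  have hmm : inversionSign π m m = 1 := by simp [inversionSign]
  rw [Finset.prod_insert hm, Finset.prod_insert hm, hmm, one_mul]
  have : ∀ a ∈ T, ∏ b ∈ insert m T, inversionSign π a b =
      inversionSign π a m * ∏ b ∈ T, inversionSign π a b := fun a _ => Finset.prod_insert hm
  rw [Finset.prod_congr rfl this, Finset.prod_mul_distrib, ← mul_assoc,
    ← Finset.prod_mul_distrib, mul_right_comm, ← Finset.prod_mul_distrib]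
  congr 1
  refine Finset.prod_congr rfl fun a ha => ?_
  have ham : a ≠ m := fun h => hm (h ▸ ha)
  have h1 : Fintype.equivFin M a ≠ Fintype.equivFin M m := by simpa using ham
  have h2 : Fintype.equivFin M (π a) ≠ Fintype.equivFin M (π m) := by simpa using ham
  unfold inversionSign
  rcases lt_or_gt_of_ne h1 with h1 | h1 <;> rcases lt_or_gt_of_ne h2 with h2 | h2 <;>
    simp [h1, h2, h1.not_gt, h2.not_gt]

/-- The inversion sign is chosen so that covariance holds without a residual sign, although the
enumeration of the modes is not invariant under `π`. -/
theorem permOp_mul_fockCreate (π : Equiv.Perm M) (m : M) :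
    permOp π * fockCreate m = fockCreate (π m) * permOp π := by
  ext S T
  rw [Matrix.mul_apply, Matrix.mul_apply, Finset.sum_eq_single (insert m T),
    Finset.sum_eq_single (T.map π.toEmbedding)]
  · simp only [permOp_apply, fockCreate_apply]
    by_cases hm : m ∈ T
    · simp [hm]
    · simp only [hm, not_false_eq_true, and_self, if_true, Finset.map_insert, Finset.mem_map_equiv,
        Equiv.symm_apply_apply, true_and, Equiv.coe_toEmbedding]
      by_cases hS : S = insert (π m) (T.map π.toEmbedding)
      · rw [if_pos hS, if_pos hS, neg_one_pow_card_filter, neg_one_pow_card_filter,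
          prod_inversionSign_insert π hm, Finset.prod_map]
        rfl
      · rw [if_neg hS, if_neg hS]; simp
  · intro R _ hR
    rw [permOp_apply, if_neg hR, mul_zero]
  · simp
  · intro R _ hR
    rw [fockCreate_apply, if_neg (fun h => hR h.2), mul_zero]
  · simp

theorem conjTranspose_permOp_mul (π : Equiv.Perm M) : (permOp π)ᴴ * permOp π = 1 := by
  ext S T
  rw [Matrix.mul_apply, Finset.sum_eq_single (T.map π.toEmbedding), Matrix.one_apply]
  · simp only [Matrix.conjTranspose_apply, permOp_apply]
    by_cases hST : S = T
    · subst hST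
      simp only [if_true]
      rw [star_prod, ← Finset.prod_mul_distrib]
      refine Finset.prod_eq_one fun a _ => ?_
      rw [star_prod, ← Finset.prod_mul_distrib]
      exact Finset.prod_eq_one fun b _ => by rw [star_inversionSign, inversionSign_mul_self]
    · have : ¬ T.map π.toEmbedding = S.map π.toEmbedding := fun h =>
        hST (Finset.map_injective _ h).symm
      simp [this, hST]
  · intro R _ hR
    simp [permOp_apply, hR]
  · simp

theorem permOp_mul_fockAnnihilate (π : Equiv.Perm M) (m : M) :
    permOp π * fockAnnihilate m = fockAnnihilate (π m) * permOp π := by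
  have h1 := conjTranspose_permOp_mul π
  have h2 : permOp π * (permOp π)ᴴ = 1 := mul_eq_one_comm.1 h1
  have h3 : (fockCreate m)ᴴ * (permOp π)ᴴ = (permOp π)ᴴ * (fockCreate (π m))ᴴ := by
    rw [← Matrix.conjTranspose_mul, ← Matrix.conjTranspose_mul, permOp_mul_fockCreate]
  unfold fockAnnihilate
  calc permOp π * (fockCreate m)ᴴ
      = permOp π * ((fockCreate m)ᴴ * (permOp π)ᴴ) * permOp π := by
        rw [mul_assoc, mul_assoc, h1, mul_one]
    _ = (permOp π * (permOp π)ᴴ) * (fockCreate (π m))ᴴ * permOp π := by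
        rw [h3]; simp only [mul_assoc]
    _ = _ := by rw [h2, one_mul]

end FockSpace
end

noncomputable section

namespace LatticeModel

/-! ### Characters of the discrete torus. -/

section Characters

variable {L : ℕ} [NeZero L]

/-- The character `x ↦ e^{i p·x}` of the torus, for the momentum `p = ∑ (n_i/L) G_i`. -/
def torusChar (k x : TorusSite L) : ℂ := ∏ i, ZMod.stdAddChar (k i * x i)

theorem torusChar_add_right (k x y : TorusSite L) :
    torusChar k (x + y) = torusChar k x * torusChar k y := by
  simp only [torusChar, Pi.add_apply, mul_add, AddChar.map_add_eq_mul, Finset.prod_mul_distrib]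

theorem torusChar_comm (k x : TorusSite L) : torusChar k x = torusChar x k := by
  simp only [torusChar, mul_comm]

theorem torusChar_add_left (k l x : TorusSite L) :
    torusChar (k + l) x = torusChar k x * torusChar l x := by
  rw [torusChar_comm, torusChar_add_right, torusChar_comm, torusChar_comm x l]

theorem torusChar_zero_right (k : TorusSite L) : torusChar k 0 = 1 := by
  simp [torusChar]

theorem torusChar_neg_right_mul (k x : TorusSite L) : torusChar k (-x) * torusChar k x = 1 := by
  rw [← torusChar_add_right, neg_add_cancel, torusChar_zero_right]

theorem torusChar_neg (k x : TorusSite L) : torusChar (-k) x = torusChar k (-x) := by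
  simp [torusChar]

theorem torusChar_sum_left {ι : Type*} (s : Finset ι) (k : ι → TorusSite L) (x : TorusSite L) :
    ∏ i ∈ s, torusChar (k i) x = torusChar (∑ i ∈ s, k i) x := by
  classical
  induction s using Finset.induction_on with
  | empty => rw [Finset.prod_empty, Finset.sum_empty, torusChar_comm, torusChar_zero_right]
  | insert a s ha ih => rw [Finset.prod_insert ha, Finset.sum_insert ha, ih, torusChar_add_left]

theorem exists_torusChar_ne_one {k : TorusSite L} (hk : k ≠ 0) : ∃ x, torusChar k x ≠ 1 := by
  obtain ⟨i, hi⟩ := Function.ne_iff.1 hk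
  refine ⟨Pi.single i 1, fun h => hi ?_⟩
  have : torusChar k (Pi.single i 1) = ZMod.stdAddChar (k i) := by
    unfold torusChar
    rw [Finset.prod_eq_single i]
    · simp
    · intro j _ hj; simp [hj]
    · simp
  rw [this, ← AddChar.map_zero_eq_one (ZMod.stdAddChar (N := L))] at h
  exact ZMod.injective_stdAddChar h

theorem sum_torusChar (x : TorusSite L) :
    ∑ k : TorusSite L, torusChar k x = if x = 0 then (L : ℂ) ^ 2 else 0 := by
  unfold torusChar
  rw [← Fintype.piFinset_univ, ← Finset.prod_univ_sum (fun _ => Finset.univ)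
    (fun i (j : ZMod L) => ZMod.stdAddChar (j * x i))]
  simp only [AddChar.sum_mulShift _ (ZMod.isPrimitive_stdAddChar L), ZMod.card]
  split_ifs with h
  · subst h; simp
  · obtain ⟨i, hi⟩ := Function.ne_iff.1 h
    refine Finset.prod_eq_zero (Finset.mem_univ i) ?_
    have hi' : ¬ x i = 0 := hi
    simp [hi']

end Characters

/-! ### Translation covariance of the model and the interaction in momentum space. -/

section Translations

variable {L : ℕ} [NeZero L] {I : Type*} [Fintype I] [DecidableEq I] (S : LatticeModel L I)

/-- The momentum `∑ (n_i/L) G_i`. -/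
def momentum (n : Fin 2 → ℤ) : Plane := ∑ i, ((n i : ℝ) / L) • S.G i

/-- The class of `n ∈ ℤ²` modulo `L`. -/
def momentumClass (L : ℕ) (n : Fin 2 → ℤ) : TorusSite L := fun i => (n i : ZMod L)

theorem inner_momentum_pos (n : Fin 2 → ℤ) (x : TorusSite L) :
    inner ℝ (S.momentum n) (S.pos x) = ∑ i, 2 * Real.pi * (n i * (x i).val) / L := by
  unfold momentum pos
  rw [sum_inner]
  refine Finset.sum_congr rfl fun i _ => ?_
  rw [inner_smul_left, inner_sum]
  simp only [inner_smul_right, S.G_dual, mul_ite, mul_zero, Finset.sum_ite_eq, Finset.mem_univ,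
    if_true]
  simp only [conj_trivial]
  ring

/-- By duality of the two bases the phase is e^{2πi n·x/L}, which sees the site only modulo `L`;
this is why translations act by phases although `pos` picks representatives. -/
theorem exp_inner_momentum_pos (n : Fin 2 → ℤ) (x : TorusSite L) :
    Complex.exp (Complex.I * (inner ℝ (S.momentum n) (S.pos x) : ℝ)) =
      torusChar (momentumClass L n) x := by
  rw [inner_momentum_pos, Complex.ofReal_sum, Finset.mul_sum, Complex.exp_sum]
  unfold torusChar momentumClass
  refine Finset.prod_congr rfl fun i _ => ?_
  have : ((n i : ZMod L) * x i) = ((n i * (x i).val : ℤ) : ZMod L) := by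
    push_cast
    rw [ZMod.natCast_zmod_val]
  rw [this, ZMod.stdAddChar_coe]
  congr 1
  push_cast
  ring

theorem exp_neg_inner_momentum_pos (n : Fin 2 → ℤ) (x : TorusSite L) :
    Complex.exp (-Complex.I * (inner ℝ (S.momentum n) (S.pos x) : ℝ)) =
      torusChar (momentumClass L n) (-x) := by
  have h1 := exp_inner_momentum_pos S n x
  have h2 := torusChar_neg_right_mul (momentumClass L n) x
  rw [neg_mul, Complex.exp_neg, h1]
  exact (eq_inv_of_mul_eq_one_left h2).symm

theorem vHat_momentum (σ σ' : I) (n : Fin 2 → ℤ) :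
    S.vHat σ σ' (S.momentum n) =
      ∑ x : TorusSite L, torusChar (momentumClass L n) x * (S.v x σ σ' : ℂ) := by
  unfold vHat
  simp only [exp_inner_momentum_pos]

theorem obs_density_momentum (σ : I) (n : Fin 2 → ℤ) :
    S.obs (S.momentum n) (.density σ) =
      ∑ x : TorusSite L, torusChar (momentumClass L n) (-x) • num x σ := by
  simp only [obs, exp_neg_inner_momentum_pos]

theorem neg_momentum (n : Fin 2 → ℤ) : -S.momentum n = S.momentum (-n) := by
  unfold momentum
  rw [← Finset.sum_neg_distrib]
  refine Finset.sum_congr rfl fun i _ => ?_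
  rw [← neg_smul]; congr 1; simp [neg_div]

theorem momentum_zero : S.momentum (0 : Fin 2 → ℤ) = 0 := by simp [momentum]

theorem momentumClass_neg (n : Fin 2 → ℤ) : momentumClass L (-n) = -momentumClass L n := by
  funext i; simp [momentumClass]

theorem momentumClass_zero : momentumClass L 0 = 0 := by
  funext i; simp [momentumClass]

/-- The permutation of the modes induced by a translation of the torus. -/
def translatePerm (I : Type*) (a : TorusSite L) : Equiv.Perm (Mode L I) :=
  (Equiv.addRight a).prodCongr (Equiv.refl I)

/-- The translation operator on Fock space. -/
def translateOp (I : Type*) [Fintype I] [DecidableEq I] (a : TorusSite L) : FockOp (Mode L I) :=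
  permOp (translatePerm I a)

theorem translateOp_psiP (a x : TorusSite L) (σ : I) :
    translateOp I a * psiP x σ = psiP (x + a) σ * translateOp I a :=
  permOp_mul_fockCreate _ _

theorem translateOp_psiM (a x : TorusSite L) (σ : I) :
    translateOp I a * psiM x σ = psiM (x + a) σ * translateOp I a :=
  permOp_mul_fockAnnihilate _ _

theorem translateOp_hop (a x y : TorusSite L) (σ σ' : I) :
    translateOp I a * (psiP x σ * psiM y σ') =
      (psiP (x + a) σ * psiM (y + a) σ') * translateOp I a := by
  rw [← mul_assoc, translateOp_psiP, mul_assoc, translateOp_psiM, mul_assoc]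

theorem translateOp_num (a x : TorusSite L) (σ : I) :
    translateOp I a * num x σ = num (x + a) σ * translateOp I a :=
  translateOp_hop a x x σ σ

theorem translateOp_sum_smul {c c' : TorusSite L → ℂ} {X : TorusSite L → FockOp (Mode L I)}
    {a : TorusSite L} {e : ℂ}
    (hX : ∀ x, translateOp I a * X x = X (x + a) * translateOp I a)
    (hc : ∀ x, c x = e * c' (x + a)) :
    translateOp I a * ∑ x, c x • X x = e • ((∑ x, c' x • X x) * translateOp I a) := by
  rw [Finset.mul_sum, Finset.sum_mul, Finset.smul_sum]
  rw [← Equiv.sum_comp (Equiv.addRight a) (fun x => e • (c' x • X x * translateOp I a))]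
  refine Finset.sum_congr rfl fun x _ => ?_
  rw [mul_smul_comm, hX, hc, Equiv.coe_addRight, smul_mul_assoc, smul_smul]

theorem translateOp_sum_sum_smul {c : TorusSite L → TorusSite L → I → I → ℂ}
    {X : TorusSite L → TorusSite L → I → I → FockOp (Mode L I)} {a : TorusSite L} {e : ℂ}
    (hX : ∀ x y σ σ', translateOp I a * X x y σ σ' = X (x + a) (y + a) σ σ' * translateOp I a)
    (hc : ∀ x y σ σ', c x y σ σ' = e * c (x + a) (y + a) σ σ') :
    translateOp I a * ∑ x, ∑ y, ∑ σ, ∑ σ', c x y σ σ' • X x y σ σ' =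
      e • ((∑ x, ∑ y, ∑ σ, ∑ σ', c x y σ σ' • X x y σ σ') * translateOp I a) := by
  simp only [Finset.mul_sum, Finset.sum_mul, Finset.smul_sum]
  rw [← Equiv.sum_comp (Equiv.addRight a) (fun x => ∑ y, ∑ σ, ∑ σ',
    e • (c x y σ σ' • X x y σ σ' * translateOp I a))]
  refine Finset.sum_congr rfl fun x _ => ?_
  rw [← Equiv.sum_comp (Equiv.addRight a) (fun y => ∑ σ, ∑ σ',
    e • (c _ y σ σ' • X _ y σ σ' * translateOp I a))]
  refine Finset.sum_congr rfl fun y _ => Finset.sum_congr rfl fun σ _ =>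
    Finset.sum_congr rfl fun σ' _ => ?_
  rw [mul_smul_comm, hX, hc, Equiv.coe_addRight, smul_mul_assoc, smul_smul]

theorem translateOp_freeHam (a : TorusSite L) :
    translateOp I a * S.freeHam = S.freeHam * translateOp I a := by
  have := translateOp_sum_sum_smul (a := a) (e := 1)
    (c := fun x y σ σ' => S.hop (x - y) σ σ') (X := fun x y σ σ' => psiP x σ * psiM y σ')
    (fun x y σ σ' => translateOp_hop a x y σ σ')
    (fun x y σ σ' => by rw [add_sub_add_right_eq_sub, one_mul])
  rwa [one_smul] at this

theorem translateOp_interaction (a : TorusSite L) :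
    translateOp I a * S.interaction = S.interaction * translateOp I a := by
  have := translateOp_sum_sum_smul (a := a) (e := 1)
    (c := fun x y σ σ' => (S.v (x - y) σ σ' : ℂ)) (X := fun x y σ σ' => num x σ * num y σ')
    (fun x y σ σ' => by
      rw [← mul_assoc, translateOp_num, mul_assoc, translateOp_num, mul_assoc])
    (fun x y σ σ' => by rw [add_sub_add_right_eq_sub, one_mul])
  rwa [one_smul] at this

theorem translateOp_numberOp (a : TorusSite L) :
    translateOp I a * (numberOp : FockOp (Mode L I)) = numberOp * translateOp I a := by
  unfold numberOp
  rw [Finset.mul_sum, Finset.sum_mul]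
  rw [← Equiv.sum_comp (Equiv.addRight a) (fun x => (∑ σ : I, num x σ) * translateOp I a)]
  refine Finset.sum_congr rfl fun x _ => ?_
  rw [Finset.mul_sum, Finset.sum_mul]
  exact Finset.sum_congr rfl fun σ _ => translateOp_num a x σ

theorem commute_translateOp_grandHam (a : TorusSite L) (U : ℝ) :
    Commute (translateOp I a) (S.grandHam U) := by
  unfold grandHam
  exact (Commute.add_right (translateOp_freeHam S a)
    (Commute.smul_right (show Commute _ _ from translateOp_interaction S a) _)).sub_right
    (Commute.smul_right (show Commute (translateOp I a) numberOp from translateOp_numberOp a) _)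

theorem centered_add_mul (n k : ℤ) : centered L (n + L * k) = centered L n := by
  unfold centered
  have hL : (L : ℝ) ≠ 0 := by exact_mod_cast NeZero.ne L
  have : (((n + L * k : ℤ) : ℝ) / L + 1 / 2) = ((n : ℝ) / L + 1 / 2) + (k : ℤ) := by
    push_cast
    field_simp
    ring
  rw [this, Int.floor_add_intCast]
  ring

/-- A translation changes the difference of representatives by a multiple of `L`, which `centered`
ignores. -/
theorem disp_translate (a x y : TorusSite L) (σ σ' : I) :
    S.disp (x + a) σ (y + a) σ' = S.disp x σ y σ' := by
  unfold disp
  congr 2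
  refine Finset.sum_congr rfl fun i _ => ?_
  congr 2
  have h2 : ((((y + a) i).val : ℤ) - (((x + a) i).val : ℤ)) ≡
      (((y i).val : ℤ) - ((x i).val : ℤ)) [ZMOD L] := by
    rw [← ZMod.intCast_eq_intCast_iff]
    push_cast
    simp
  obtain ⟨k, hk⟩ := h2.symm.dvd
  have h3 : ((((y + a) i).val : ℤ) - (((x + a) i).val : ℤ)) =
      (((y i).val : ℤ) - ((x i).val : ℤ)) + L * k := by linarith
  rw [h3, centered_add_mul]

theorem translateOp_bondCurrent (a x y : TorusSite L) (σ σ' : I) :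
    translateOp I a * S.bondCurrent x σ y σ' =
      S.bondCurrent (x + a) σ (y + a) σ' * translateOp I a := by
  unfold bondCurrent
  rw [mul_smul_comm, mul_sub, mul_smul_comm, mul_smul_comm, translateOp_hop, translateOp_hop,
    smul_mul_assoc, sub_mul, smul_mul_assoc, smul_mul_assoc, add_sub_add_right_eq_sub,
    add_sub_add_right_eq_sub]

/-- Observables at momentum `p` are eigenvectors of the translations. -/
theorem translateOp_obs_current (n : Fin 2 → ℤ) (i : Fin 2) (a : TorusSite L) :
    translateOp I a * S.obs (S.momentum n) (.current i) =
      torusChar (momentumClass L n) a • (S.obs (S.momentum n) (.current i) * translateOp I a) := by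
  have hsplit : ∀ x (σ : I), Complex.exp (-Complex.I *
      (inner ℝ (S.momentum n) (S.pos x + S.r σ) : ℝ)) =
      torusChar (momentumClass L n) (-x) *
        Complex.exp (-Complex.I * (inner ℝ (S.momentum n) (S.r σ) : ℝ)) := by
    intro x σ
    rw [inner_add_right, Complex.ofReal_add, mul_add, Complex.exp_add, exp_neg_inner_momentum_pos]
  have := translateOp_sum_sum_smul (a := a) (e := torusChar (momentumClass L n) a)
    (c := fun x y σ σ' => Complex.exp (-Complex.I * (inner ℝ (S.momentum n) (S.pos x + S.r σ) : ℝ))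
        * (S.disp x σ y σ' i : ℂ) * eta (S.momentum n) (S.disp x σ y σ'))
    (X := fun x y σ σ' => S.bondCurrent x σ y σ')
    (fun x y σ σ' => S.translateOp_bondCurrent a x y σ σ')
    (fun x y σ σ' => by
      simp only
      rw [disp_translate, hsplit, hsplit, neg_add, torusChar_add_right]
      have := torusChar_neg_right_mul (momentumClass L n) a
      linear_combination (-torusChar (momentumClass L n) (-x) *
        Complex.exp (-Complex.I * (inner ℝ (S.momentum n) (S.r σ) : ℝ)) *
        (S.disp x σ y σ' i : ℂ) * eta (S.momentum n) (S.disp x σ y σ')) * this)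
  unfold obs
  rw [mul_smul_comm, this, smul_mul_assoc, smul_comm]

theorem num_eq_diagonal (x : TorusSite L) (σ : I) :
    num x σ = Matrix.diagonal fun T : Finset (Mode L I) => if (x, σ) ∈ T then (1 : ℂ) else 0 :=
  fockCreate_mul_fockAnnihilate _

theorem commute_num (x y : TorusSite L) (σ σ' : I) :
    Commute (num x σ : FockOp (Mode L I)) (num y σ') := by
  rw [num_eq_diagonal, num_eq_diagonal]
  unfold Commute SemiconjBy
  rw [Matrix.diagonal_mul_diagonal, Matrix.diagonal_mul_diagonal]
  simp only [mul_comm]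

/-- The integer representative in `[0, L)²` of a class of momenta. -/
def classRep (k : TorusSite L) : Fin 2 → ℤ := fun i => ((k i).val : ℤ)

theorem momentumClass_classRep (k : TorusSite L) : momentumClass L (classRep k) = k := by
  funext i
  simp [momentumClass, classRep]

/-- The interaction in momentum space. -/
theorem interaction_eq_sum_momentum :
    S.interaction = ∑ l : TorusSite L × I × I,
      (1 / (L : ℂ) ^ 2 * S.vHat l.2.1 l.2.2 (S.momentum (classRep l.1))) •
        (S.obs (S.momentum (classRep l.1)) (.density l.2.1) *
          S.obs (-S.momentum (classRep l.1)) (.density l.2.2)) := by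
  have hL : (L : ℂ) ≠ 0 := by exact_mod_cast NeZero.ne L
  simp only [Fintype.sum_prod_type]
  rw [Finset.sum_comm, Finset.sum_congr rfl fun σ _ => Finset.sum_comm]
  unfold interaction
  have hswap : ∑ x : TorusSite L, ∑ y : TorusSite L, ∑ σ : I, ∑ σ' : I,
      (S.v (x - y) σ σ' : ℂ) • (num x σ * num y σ') = ∑ σ : I, ∑ σ' : I, ∑ x : TorusSite L,
        ∑ y : TorusSite L, (S.v (x - y) σ σ' : ℂ) • (num x σ * num y σ') := by
    rw [Finset.sum_congr rfl fun x _ => Finset.sum_comm, Finset.sum_comm]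
    refine Finset.sum_congr rfl fun σ _ => ?_
    rw [Finset.sum_congr rfl fun x _ => Finset.sum_comm, Finset.sum_comm]
  rw [hswap]
  refine Finset.sum_congr rfl fun σ _ => Finset.sum_congr rfl fun σ' _ => ?_
  have hk : ∀ k : TorusSite L, (1 / (L : ℂ) ^ 2 * S.vHat σ σ' (S.momentum (classRep k))) •
      (S.obs (S.momentum (classRep k)) (.density σ) *
        S.obs (-S.momentum (classRep k)) (.density σ')) =
      ∑ x : TorusSite L, ∑ y : TorusSite L, ∑ z : TorusSite L,
        (1 / (L : ℂ) ^ 2 * (S.v z σ σ' : ℂ) * torusChar k (z - x + y)) •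
          (num x σ * num y σ') := by
    intro k
    rw [neg_momentum, vHat_momentum, obs_density_momentum, obs_density_momentum, momentumClass_neg,
      momentumClass_classRep, Finset.sum_mul, Finset.smul_sum]
    refine Finset.sum_congr rfl fun x _ => ?_
    rw [Finset.mul_sum _ _ (torusChar k (-x) • num x σ), Finset.smul_sum]
    refine Finset.sum_congr rfl fun y _ => ?_
    rw [smul_mul_smul_comm, smul_smul, ← Finset.sum_smul, Finset.mul_sum, Finset.sum_mul]
    congr 1
    refine Finset.sum_congr rfl fun z _ => ?_
    rw [torusChar_neg, neg_neg, sub_eq_add_neg, torusChar_add_right, torusChar_add_right]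
    ring
  symm
  rw [Finset.sum_congr rfl fun k _ => hk k, Finset.sum_comm]
  refine Finset.sum_congr rfl fun x _ => ?_
  rw [Finset.sum_comm]
  refine Finset.sum_congr rfl fun y _ => ?_
  rw [Finset.sum_comm]
  -- Orthogonality of the characters: the sum over momenta forces `z = x - y`.
  have hz : ∀ z : TorusSite L, ∑ k : TorusSite L,
      (1 / (L : ℂ) ^ 2 * (S.v z σ σ' : ℂ) * torusChar k (z - x + y)) • (num x σ * num y σ') =
      if z = x - y then (S.v z σ σ' : ℂ) • (num x σ * num y σ') else 0 := by
    intro z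
    rw [← Finset.sum_smul, ← Finset.mul_sum, sum_torusChar]
    have hiff : z - x + y = 0 ↔ z = x - y := by
      constructor
      · intro h
        have : z = (z - x + y) + (x - y) := by abel
        rw [this, h, zero_add]
      · rintro rfl; abel
    by_cases h : z = x - y
    · rw [if_pos (hiff.2 h), if_pos h]
      congr 1
      field_simp
    · rw [if_neg (fun h' => h (hiff.1 h')), if_neg h, mul_zero, zero_smul]
  rw [Finset.sum_congr rfl fun z _ => hz z, Finset.sum_ite_eq' Finset.univ (x - y),
    if_pos (Finset.mem_univ _)]

end Translations

end LatticeModel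
end

noncomputable section

theorem hasSum_of_eq {ι : Type*} {f g : ι → ℂ} {x y : ℂ} (h : HasSum f x) (hfg : ∀ i, f i = g i)
    (hxy : x = y) : HasSum g y :=
  (funext hfg : f = g) ▸ hxy ▸ h

/-! ### Label sets split into observables and interaction vertices. -/

section LabelSets

variable {n k : ℕ}

/-- The set of labels in `Fin (n + k)` with prescribed parts among the first `n` and the last `k`
labels. -/
def labelSet (T : Finset (Fin n)) (B : Finset (Fin k)) : Finset (Fin (n + k)) :=
  T.map (Fin.castAddEmb k) ∪ B.map (Fin.natAddEmb n)

@[simp] theorem castAdd_mem_labelSet {T : Finset (Fin n)} {B : Finset (Fin k)} {t : Fin n} :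
    Fin.castAdd k t ∈ labelSet T B ↔ t ∈ T := by
  simp only [labelSet, Finset.mem_union, Finset.mem_map, Fin.castAddEmb_apply,
    Fin.natAddEmb_apply]
  constructor
  · rintro (⟨a, ha, h⟩ | ⟨b, _, h⟩)
    · rwa [← Fin.castAdd_injective n k h]
    · exfalso
      have := congrArg Fin.val h
      simp at this
      omega
  · exact fun h => Or.inl ⟨t, h, rfl⟩

@[simp] theorem natAdd_mem_labelSet {T : Finset (Fin n)} {B : Finset (Fin k)} {b : Fin k} :
    Fin.natAdd n b ∈ labelSet T B ↔ b ∈ B := by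
  simp only [labelSet, Finset.mem_union, Finset.mem_map, Fin.castAddEmb_apply,
    Fin.natAddEmb_apply]
  constructor
  · rintro (⟨a, _, h⟩ | ⟨b', hb, h⟩)
    · exfalso
      have := congrArg Fin.val h
      simp at this
      omega
    · rwa [← Fin.natAdd_injective k n h]
  · exact fun h => Or.inr ⟨b, h, rfl⟩

theorem finset_fin_add_ext {P Q : Finset (Fin (n + k))}
    (h1 : ∀ t, Fin.castAdd k t ∈ P ↔ Fin.castAdd k t ∈ Q)
    (h2 : ∀ b, Fin.natAdd n b ∈ P ↔ Fin.natAdd n b ∈ Q) : P = Q := by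
  ext x
  induction x using Fin.addCases with
  | left t => exact h1 t
  | right b => exact h2 b

theorem natAdd_ne_castAdd (b : Fin k) (t : Fin n) : Fin.natAdd n b ≠ Fin.castAdd k t := by
  intro h
  have := congrArg Fin.val h
  simp at this
  omega

theorem insert_labelSet (t : Fin n) (T : Finset (Fin n)) (B : Finset (Fin k)) :
    insert (Fin.castAdd k t) (labelSet T B) = labelSet (insert t T) B :=
  finset_fin_add_ext (by simp) (by simp [natAdd_ne_castAdd])

theorem labelSet_sdiff (T T' : Finset (Fin n)) (B : Finset (Fin k)) :
    labelSet T Finset.univ \ labelSet T' B = labelSet (T \ T') Bᶜ :=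
  finset_fin_add_ext (by simp) (by simp)

theorem sum_powerset_labelSet {E : Type*} [AddCommMonoid E] (T : Finset (Fin n))
    (f : Finset (Fin (n + k)) → E) :
    ∑ P ∈ (labelSet T (Finset.univ : Finset (Fin k))).powerset, f P =
      ∑ T' ∈ T.powerset, ∑ B : Finset (Fin k), f (labelSet T' B) := by
  rw [← Finset.sum_product']
  symm
  refine Finset.sum_nbij (fun x => labelSet x.1 x.2) ?_ ?_ ?_ fun _ _ => rfl
  · intro x hx
    rw [Finset.mem_product, Finset.mem_powerset] at hx
    rw [Finset.mem_powerset]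
    intro y hy
    induction y using Fin.addCases with
    | left t => exact castAdd_mem_labelSet.2 (hx.1 (castAdd_mem_labelSet.1 hy))
    | right b => simp
  · intro x _ y _ h
    have h : labelSet x.1 x.2 = labelSet y.1 y.2 := h
    refine Prod.ext ?_ ?_
    · ext t
      rw [← castAdd_mem_labelSet (B := x.2), h, castAdd_mem_labelSet]
    · ext b
      rw [← natAdd_mem_labelSet (T := x.1), h, natAdd_mem_labelSet]
  · intro P hP
    have hP : P ⊆ labelSet T Finset.univ := by simpa using hP
    refine ⟨(T.filter fun t => Fin.castAdd k t ∈ P, Finset.univ.filter fun b => Fin.natAdd n b ∈ P),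
      by simp; exact fun t h => h.1, finset_fin_add_ext ?_ (by simp)⟩
    intro t
    simp only [castAdd_mem_labelSet, Finset.mem_filter, and_iff_right_iff_imp]
    exact fun h => castAdd_mem_labelSet.1 (hP h)

theorem append_update_castAdd {E : Type*} (u : Fin n → E) (v : Fin k → E) (t : Fin n) (x : E) :
    Function.update (Fin.append u v) (Fin.castAdd k t) x =
      Fin.append (Function.update u t x) v := by
  funext a
  induction a using Fin.addCases with
  | left s =>
    rw [Fin.append_left]
    by_cases h : s = t
    · subst h; simp
    · rw [Function.update_of_ne h,
        Function.update_of_ne (fun h' => h (Fin.castAdd_injective n k h')), Fin.append_left]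
  | right b =>
    rw [Fin.append_right, Function.update_of_ne (natAdd_ne_castAdd b t), Fin.append_right]

/-- The first vertex is counted as the last external label; no label changes position, so
tie-breaking is unaffected. -/
theorem append_snoc_eq_comp {r k : ℕ} (hcast : r + 1 + k = r + (k + 1)) {E : Type*} (u : Fin r → E)
    (v : E) : Fin.append (Fin.snoc (α := fun _ => E) u v) (fun _ : Fin k => v) =
      (Fin.append u fun _ : Fin (k + 1) => v) ∘ (finCongr hcast).toEmbedding := by
  funext a
  induction a using Fin.addCases with
  | left s =>
    rw [Fin.append_left]
    induction s using Fin.lastCases with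
    | last =>
      rw [Fin.snoc_last]
      have : (finCongr hcast).toEmbedding (Fin.castAdd k (Fin.last r)) =
        Fin.natAdd r (0 : Fin (k + 1)) := by ext; simp
      rw [Function.comp_apply, this, Fin.append_right]
    | cast s =>
      rw [Fin.snoc_castSucc]
      have : (finCongr hcast).toEmbedding (Fin.castAdd k s.castSucc) =
        Fin.castAdd (k + 1) s := by ext; simp
      rw [Function.comp_apply, this, Fin.append_left]
  | right b =>
    rw [Fin.append_right]
    have : (finCongr hcast).toEmbedding (Fin.natAdd (r + 1) b) =
        Fin.natAdd r b.succ := by ext; simp; omega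
    rw [Function.comp_apply, this, Fin.append_right]

theorem update_update_append_four {k : ℕ} {E : Type*} (u₁ u₂ u₃ u₄ x y : E) (v : Fin k → E) :
    Function.update (Function.update (Fin.append ![u₁, u₂, u₃, u₄] v) (Fin.castAdd k 2) x)
      (Fin.castAdd k 3) y = Fin.append ![u₁, u₂, x, y] v := by
  rw [append_update_castAdd, append_update_castAdd]
  congr 1
  funext a
  fin_cases a <;> rfl

theorem update_append_four {k : ℕ} {E : Type*} (u₁ u₂ u₃ u₄ y : E) (v : Fin k → E) :
    Function.update (Fin.append ![u₁, u₂, u₃, u₄] v) (Fin.castAdd k 3) y =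
      Fin.append ![u₁, u₂, u₃, y] v := by
  rw [append_update_castAdd]
  congr 1
  funext a
  fin_cases a <;> rfl

end LabelSets

/-! ### Cumulants with identical vertices, and the contraction of one vertex. -/

section PerturbedCumulant

variable {β : ℝ} [hβ : Fact (0 < β)] {F : Type*} [Fintype F] [DecidableEq F]
  (A V : Matrix F F ℂ)

/-- The time-averaged cumulant of the observables `O i` at the frequencies `w i` together with `k`
copies of `V` at zero frequency. -/
def perturbedCumulant (β : ℝ) [Fact (0 < β)] (k : ℕ) {r : ℕ} (O : Fin r → Matrix F F ℂ)
    (w : Fin r → ℤ) : ℂ :=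
  fourierCumulant A β (Fin.append O fun _ : Fin k => V) (Fin.append w fun _ => 0) Finset.univ

/-- The vertices are identical and carry zero frequency, so only their number matters; this is the
source of the binomial coefficients. The relabelling is the increasing one, as tie-breaking
requires. -/
theorem fourierCumulant_labelSet {r n k : ℕ} {J : Fin r → Fin n} (hJ : StrictMono J) (hr : 0 < r)
    {O : Fin n → Matrix F F ℂ} {w : Fin n → ℤ} {T : Finset (Fin n)}
    (hT : Finset.univ.image J = T) {O' : Fin r → Matrix F F ℂ} {w' : Fin r → ℤ}
    (hO : O ∘ J = O') (hw : w ∘ J = w') (B : Finset (Fin k)) :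
    fourierCumulant A β (Fin.append O fun _ : Fin k => V) (Fin.append w fun _ => 0)
      (labelSet T B) = perturbedCumulant A V β B.card O' w' := by
  subst hT hO hw
  let g : Fin (r + B.card) → Fin (n + k) :=
    Fin.addCases (fun i => Fin.castAdd k (J i)) fun b => Fin.natAdd n (B.orderEmbOfFin rfl b)
  have hg1 : ∀ i, g (Fin.castAdd _ i) = Fin.castAdd k (J i) := fun i => Fin.addCases_left i
  have hg2 : ∀ b, g (Fin.natAdd r b) = Fin.natAdd n (B.orderEmbOfFin rfl b) :=
    fun b => Fin.addCases_right b
  have hmono : StrictMono g := by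
    intro x y hxy
    induction x using Fin.addCases with
    | left s =>
      induction y using Fin.addCases with
      | left t => rw [hg1, hg1]; exact hJ hxy
      | right b =>
        rw [hg1, hg2, Fin.lt_def, Fin.val_castAdd, Fin.val_natAdd]
        exact (J s).isLt.trans_le (Nat.le_add_right _ _)
    | right a =>
      induction y using Fin.addCases with
      | left t =>
        rw [Fin.lt_def, Fin.val_castAdd, Fin.val_natAdd] at hxy
        have := t.isLt
        omega
      | right b =>
        rw [hg2, hg2, Fin.natAdd_lt_natAdd_iff]
        exact (B.orderEmbOfFin rfl).strictMono (by simpa using hxy)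
  let e : Fin (r + B.card) ↪ Fin (n + k) := ⟨g, hmono.injective⟩
  have huniv : (Finset.univ : Finset (Fin (r + B.card))).Nonempty :=
    ⟨Fin.castAdd _ ⟨0, hr⟩, Finset.mem_univ _⟩
  have hmap : Finset.univ.map e = labelSet (Finset.univ.image J) B := by
    refine Finset.Subset.antisymm ?_ ?_
    · intro x hx
      obtain ⟨a, -, rfl⟩ := Finset.mem_map.1 hx
      change g a ∈ _
      induction a using Fin.addCases with
      | left s => rw [hg1, castAdd_mem_labelSet]; exact Finset.mem_image_of_mem _ (Finset.mem_univ _)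
      | right b => rw [hg2, natAdd_mem_labelSet]; exact B.orderEmbOfFin_mem rfl b
    · intro x hx
      rw [Finset.mem_map]
      induction x using Fin.addCases with
      | left t =>
        obtain ⟨s, -, rfl⟩ := Finset.mem_image.1 (castAdd_mem_labelSet.1 hx)
        exact ⟨_, Finset.mem_univ _, hg1 s⟩
      | right b =>
        have hb := natAdd_mem_labelSet.1 hx
        rw [← Finset.mem_coe, ← B.range_orderEmbOfFin rfl] at hb
        obtain ⟨b', rfl⟩ := hb
        exact ⟨_, Finset.mem_univ _, hg2 b'⟩
  rw [← hmap, ← fourierCumulant_map A e hmono _ _ _ huniv]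
  unfold perturbedCumulant
  congr 1
  · funext a
    change Fin.append O _ (g a) = _
    induction a using Fin.addCases with
    | left s => rw [hg1, Fin.append_left, Fin.append_left]; rfl
    | right b => rw [hg2, Fin.append_right, Fin.append_right]
  · funext a
    change Fin.append w _ (g a) = _
    induction a using Fin.addCases with
    | left s => rw [hg1, Fin.append_left, Fin.append_left]; rfl
    | right b => rw [hg2, Fin.append_right, Fin.append_right]

/-- Singles out one interaction vertex as an explicit observable, which is the one to be expanded.
-/
theorem perturbedCumulant_succ (k : ℕ) {r : ℕ} (O : Fin r → Matrix F F ℂ) (w : Fin r → ℤ) :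
    perturbedCumulant A V β k (Fin.snoc (α := fun _ => Matrix F F ℂ) O V)
      (Fin.snoc (α := fun _ => ℤ) w 0) = perturbedCumulant A V β (k + 1) O w := by
  have hcast : r + 1 + k = r + (k + 1) := by omega
  have huniv : (Finset.univ : Finset (Fin (r + 1 + k))).Nonempty :=
    ⟨⟨r, by omega⟩, Finset.mem_univ _⟩
  unfold perturbedCumulant
  rw [append_snoc_eq_comp hcast, append_snoc_eq_comp hcast, fourierCumulant_map A _ (fun a b h => by simpa using h) _ _ _ huniv]
  congr 1
  simp

/-- The sum over the splittings of the perturbation vertices, for one splitting of the external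
labels. -/
theorem sum_fourierCumulant_labelSet {r r' n k : ℕ} {J : Fin r → Fin n} (hJ : StrictMono J)
    (hr : 0 < r) {J' : Fin r' → Fin n} (hJ' : StrictMono J') (hr' : 0 < r')
    {O : Fin n → Matrix F F ℂ} {w : Fin n → ℤ} {T T' : Finset (Fin n)}
    (hT : Finset.univ.image J = T) (hT' : Finset.univ.image J' = T')
    {O₁ : Fin r → Matrix F F ℂ} {w₁ : Fin r → ℤ} {O₂ : Fin r' → Matrix F F ℂ} {w₂ : Fin r' → ℤ}
    (hO : O ∘ J = O₁) (hw : w ∘ J = w₁) (hO' : O ∘ J' = O₂) (hw' : w ∘ J' = w₂) :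
    ∑ B : Finset (Fin k), fourierCumulant A β (Fin.append O fun _ : Fin k => V)
        (Fin.append w fun _ => 0) (labelSet T B) *
      fourierCumulant A β (Fin.append O fun _ : Fin k => V)
        (Fin.append w fun _ => 0) (labelSet T' Bᶜ) =
    ∑ s ∈ Finset.range (k + 1), (k.choose s : ℂ) * (perturbedCumulant A V β s O₁ w₁ *
      perturbedCumulant A V β (k - s) O₂ w₂) := by
  have h := Finset.sum_powerset_apply_card (fun s => perturbedCumulant A V β s O₁ w₁ *
      perturbedCumulant A V β (k - s) O₂ w₂) (x := (Finset.univ : Finset (Fin k)))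
  rw [Finset.card_univ, Fintype.card_fin, Finset.powerset_univ] at h
  simp only [nsmul_eq_mul] at h
  rw [← h]
  refine Finset.sum_congr rfl fun B _ => ?_
  rw [fourierCumulant_labelSet A V hJ hr hT hO hw, fourierCumulant_labelSet A V hJ' hr' hT' hO' hw',
    Finset.card_compl, Fintype.card_fin]

/-- Contracting one vertex `∑ c l Y_l Z_l` of a cumulant: the sum over the transferred frequency of
the connected part and of the products of two cumulants. -/
theorem hasSum_perturbedCumulant {Λ : Type*} [Fintype Λ] (X₁ X₂ : Matrix F F ℂ) (a₁ a₂ : ℤ)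
    (c : Λ → ℂ) (Y Z : Λ → Matrix F F ℂ) (hcomm : ∀ l, Commute (Y l) (Z l)) (k : ℕ) :
    HasSum (fun m : ℤ => ∑ l, c l * (perturbedCumulant A V β k ![X₁, X₂, Y l, Z l] ![a₁, a₂, m, -m] +
      ∑ s ∈ Finset.range (k + 1), (k.choose s : ℂ) * (
        perturbedCumulant A V β s ![Y l] ![m] *
          perturbedCumulant A V β (k - s) ![X₁, X₂, Z l] ![a₁, a₂, -m] +
        perturbedCumulant A V β s ![X₂, Y l] ![a₂, m] *
          perturbedCumulant A V β (k - s) ![X₁, Z l] ![a₁, -m] +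
        perturbedCumulant A V β s ![X₁, Y l] ![a₁, m] *
          perturbedCumulant A V β (k - s) ![X₂, Z l] ![a₂, -m] +
        perturbedCumulant A V β s ![X₁, X₂, Y l] ![a₁, a₂, m] *
          perturbedCumulant A V β (k - s) ![Z l] ![-m])))
      (perturbedCumulant A V β k ![X₁, X₂, ∑ l, c l • (Y l * Z l)] ![a₁, a₂, 0]) := by
  set W := ∑ l, c l • (Y l * Z l)
  -- The two zeros are placeholders at `y` and `z`. They are overwritten by the two factors, or,
  -- with `y` left out, by the whole vertex at `z`.
  let O : Fin (4 + k) → Matrix F F ℂ := Fin.append ![X₁, X₂, 0, 0] fun _ => V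
  let w : Fin (4 + k) → ℤ := Fin.append ![a₁, a₂, 0, 0] fun _ => 0
  let y : Fin (4 + k) := Fin.castAdd k 2
  let z : Fin (4 + k) := Fin.castAdd k 3
  let R : Finset (Fin (4 + k)) := labelSet {0, 1} Finset.univ
  have hyz : y ≠ z := fun h => by
    have := Fin.castAdd_injective 4 k h
    revert this
    decide
  have hy : y ∉ R := by rw [castAdd_mem_labelSet]; decide
  have hz : z ∉ R := by rw [castAdd_mem_labelSet]; decide
  have h0 : ∀ S ⊆ R, ∀ a ∈ S, a ≠ y ∧ a ≠ z := fun S hS a ha =>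
    ⟨fun h => hy (h ▸ hS ha), fun h => hz (h ▸ hS ha)⟩
  have key := hasSum_cumulant_of_hasSum_moment (Q := ℤ) (Λ := Λ) (M0 := fourierMoment A β O w)
    (Mw := fourierMoment A β (Function.update O z W) (Function.update w z 0))
    (Kw := fourierCumulant A β (Function.update O z W) (Function.update w z 0))
    (M := fun m l => fourierMoment A β (Function.update (Function.update O y (Y l)) z (Z l))
      (Function.update (Function.update w y m) z (-m)))
    (K := fun m l => fourierCumulant A β (Function.update (Function.update O y (Y l)) z (Z l))
      (Function.update (Function.update w y m) z (-m)))
    (c := fun _ => c) (R := R) hyz hy hz (fourierMoment_empty A O w)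
    (isCumulant_fourierCumulant A _ _) (fun _ _ => isCumulant_fourierCumulant A _ _)
    (fun S hS => fourierMoment_congr A
      (fun a ha => Function.update_of_ne (h0 S hS a ha).2 _ _)
      (fun a ha => Function.update_of_ne (h0 S hS a ha).2 _ _))
    (fun m l S hS => fourierMoment_congr A
      (fun a ha => by
        rw [Function.update_of_ne (h0 S hS a ha).2, Function.update_of_ne (h0 S hS a ha).1])
      (fun a ha => by
        rw [Function.update_of_ne (h0 S hS a ha).2, Function.update_of_ne (h0 S hS a ha).1]))
    (fun S hS => hasSum_fourierMoment A O w hyz (fun h => hy (hS h)) (fun h => hz (hS h)) c Y Z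
      hcomm) R subset_rfl
  have hW : fourierCumulant A β (Function.update O z W) (Function.update w z 0) (insert z R) =
      perturbedCumulant A V β k ![X₁, X₂, W] ![a₁, a₂, 0] := by
    rw [show Function.update O z W = _ from update_append_four _ _ _ _ _ _,
      show Function.update w z 0 = _ from update_append_four _ _ _ _ _ _,
      show insert z R = _ from insert_labelSet _ _ _,
      fourierCumulant_labelSet A V (J := ![0, 1, 3]) (by unfold StrictMono; decide) (by norm_num)
        (by decide) (O' := ![X₁, X₂, W]) (w' := ![a₁, a₂, 0]) (by funext a; fin_cases a <;> rfl)
        (by funext a; fin_cases a <;> rfl), Finset.card_univ, Fintype.card_fin]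
  rw [← hW]
  refine hasSum_of_eq key (fun m => Finset.sum_congr rfl fun l _ => ?_) rfl
  rw [show Function.update (Function.update O y (Y l)) z (Z l) = _ from
      update_update_append_four _ _ _ _ _ _ _,
    show Function.update (Function.update w y m) z (-m) = _ from
      update_update_append_four _ _ _ _ _ _ _]
  have h4 : insert y (insert z R) = labelSet Finset.univ Finset.univ := by
    rw [show insert z R = _ from insert_labelSet _ _ _, insert_labelSet]
    congr 1
    decide
  rw [h4, fourierCumulant_labelSet A V (J := id) strictMono_id (by norm_num) (Finset.image_id)
    rfl rfl, Finset.card_univ, Fintype.card_fin, sum_powerset_labelSet]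
  -- The four choices of which of `X₁`, `X₂` share the cluster of `y`.
  have hpow : ({0, 1} : Finset (Fin 4)).powerset = {∅, {1}, {0}, {0, 1}} := by decide
  have hterm : ∀ T ⊆ ({0, 1} : Finset (Fin 4)), ∀ B : Finset (Fin k),
      insert y (labelSet T B) = labelSet (insert 2 T) B ∧
      insert z (R \ labelSet T B) = labelSet (insert 3 ({0, 1} \ T)) Bᶜ := fun T _ B =>
    ⟨insert_labelSet _ _ _, by rw [labelSet_sdiff, insert_labelSet]⟩
  rw [Finset.sum_congr rfl fun T hT => Finset.sum_congr rfl fun B _ => by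
    rw [(hterm T (Finset.mem_powerset.1 hT) B).1, (hterm T (Finset.mem_powerset.1 hT) B).2]]
  rw [hpow, Finset.sum_insert (by decide), Finset.sum_insert (by decide),
    Finset.sum_insert (by decide), Finset.sum_singleton]
  rw [sum_fourierCumulant_labelSet A V (J := ![2]) (J' := ![0, 1, 3])
      (by unfold StrictMono; decide) (by norm_num) (by unfold StrictMono; decide) (by norm_num)
      (by decide) (by decide) (O₁ := ![Y l]) (w₁ := ![m]) (O₂ := ![X₁, X₂, Z l])
      (w₂ := ![a₁, a₂, -m])
      (by funext a; fin_cases a <;> rfl) (by funext a; fin_cases a <;> rfl)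
      (by funext a; fin_cases a <;> rfl) (by funext a; fin_cases a <;> rfl),
    sum_fourierCumulant_labelSet A V (J := ![1, 2]) (J' := ![0, 3])
      (by unfold StrictMono; decide) (by norm_num) (by unfold StrictMono; decide) (by norm_num)
      (by decide) (by decide) (O₁ := ![X₂, Y l]) (w₁ := ![a₂, m]) (O₂ := ![X₁, Z l])
      (w₂ := ![a₁, -m])
      (by funext a; fin_cases a <;> rfl) (by funext a; fin_cases a <;> rfl)
      (by funext a; fin_cases a <;> rfl) (by funext a; fin_cases a <;> rfl),
    sum_fourierCumulant_labelSet A V (J := ![0, 2]) (J' := ![1, 3])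
      (by unfold StrictMono; decide) (by norm_num) (by unfold StrictMono; decide) (by norm_num)
      (by decide) (by decide) (O₁ := ![X₁, Y l]) (w₁ := ![a₁, m]) (O₂ := ![X₂, Z l])
      (w₂ := ![a₂, -m])
      (by funext a; fin_cases a <;> rfl) (by funext a; fin_cases a <;> rfl)
      (by funext a; fin_cases a <;> rfl) (by funext a; fin_cases a <;> rfl),
    sum_fourierCumulant_labelSet A V (J := ![0, 1, 2]) (J' := ![3])
      (by unfold StrictMono; decide) (by norm_num) (by unfold StrictMono; decide) (by norm_num)
      (by decide) (by decide) (O₁ := ![X₁, X₂, Y l]) (w₁ := ![a₁, a₂, m]) (O₂ := ![Z l])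
      (w₂ := ![-m])
      (by funext a; fin_cases a <;> rfl) (by funext a; fin_cases a <;> rfl)
      (by funext a; fin_cases a <;> rfl) (by funext a; fin_cases a <;> rfl)]
  congr 2
  simp only [mul_add, Finset.sum_add_distrib]
  ring

end PerturbedCumulant
end

noncomputable section

/-! ### Conservation of momentum and the Schwinger–Dyson equation for cumulants. -/

/-- Summability of the totals over `K` would not exclude cancellations between fibres; summability
on each of the finitely many fibres gives the unconditional double sum. -/
theorem hasSum_prod_of_fintype {K : Type*} [Fintype K] {f : ℤ × K → ℂ} {v : ℂ}
    (h : ∀ κ, Summable fun m => f (m, κ)) (hs : HasSum (fun m => ∑ κ, f (m, κ)) v) :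
    HasSum f v := by
  classical
  have h1 : HasSum (fun m => ∑ κ, f (m, κ)) (∑ κ, ∑' m, f (m, κ)) :=
    hasSum_sum fun κ _ => (h κ).hasSum
  rw [hs.unique h1]
  have h2 : ∀ κ₀, HasSum (fun q : ℤ × K => if q.2 = κ₀ then f q else 0) (∑' m, f (m, κ₀)) := by
    intro κ₀
    have hinj : Function.Injective fun m : ℤ => (m, κ₀) := fun a b hab => (Prod.ext_iff.1 hab).1
    refine (hinj.hasSum_iff ?_).1 ?_
    · rintro ⟨m, κ⟩ hq
      refine if_neg fun hκ => hq ⟨m, ?_⟩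
      simp only at hκ
      rw [hκ]
    · have : ((fun q : ℤ × K => if q.2 = κ₀ then f q else 0) ∘ fun m : ℤ => (m, κ₀)) =
          fun m => f (m, κ₀) := by funext m; simp
      rw [this]
      exact (h κ₀).hasSum
  have h3 := hasSum_sum (s := Finset.univ) fun κ₀ _ => h2 κ₀
  have : (fun q : ℤ × K => ∑ κ₀, if q.2 = κ₀ then f q else 0) = f := by
    funext q; simp
  rwa [this] at h3

theorem sum_mul_sum_choose {I : Type*} [Fintype I] (k : ℕ) (v : I → I → ℂ) (f g : ℕ → I → ℂ) :
    ∑ σ, ∑ σ', v σ σ' * ∑ s ∈ Finset.range (k + 1), (k.choose s : ℂ) * (f s σ * g (k - s) σ') =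
      ∑ s ∈ Finset.range (k + 1), (k.choose s : ℂ) *
        ∑ σ, ∑ σ', v σ σ' * (f s σ * g (k - s) σ') := by
  simp only [Finset.mul_sum]
  rw [Finset.sum_congr rfl fun σ _ => Finset.sum_comm, Finset.sum_comm]
  refine Finset.sum_congr rfl fun s _ => Finset.sum_congr rfl fun σ _ =>
    Finset.sum_congr rfl fun σ' _ => ?_
  ring

/-- Reflecting s ↦ k - s and exchanging the colors carries a disconnected term into its mirror
image, in which the two densities exchange roles. -/
theorem sum_mul_sum_choose_swap {I : Type*} [Fintype I] (k : ℕ) {v v' : I → I → ℂ}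
    (hv : ∀ σ σ', v σ σ' = v' σ' σ) (f g : ℕ → I → ℂ) :
    ∑ σ, ∑ σ', v σ σ' * ∑ s ∈ Finset.range (k + 1), (k.choose s : ℂ) * (f s σ * g (k - s) σ') =
      ∑ s ∈ Finset.range (k + 1), (k.choose s : ℂ) *
        ∑ σ, ∑ σ', v' σ σ' * (g s σ * f (k - s) σ') := by
  rw [sum_mul_sum_choose, ← Finset.sum_range_reflect]
  refine Finset.sum_congr rfl fun s hs => ?_
  have hs' : s ≤ k := Nat.lt_succ_iff.1 (Finset.mem_range.1 hs)
  rw [show k + 1 - 1 - s = k - s by omega, Nat.choose_symm hs', Nat.sub_sub_self hs',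
    Finset.sum_comm]
  congr 1
  refine Finset.sum_congr rfl fun σ _ => Finset.sum_congr rfl fun σ' _ => ?_
  rw [hv, mul_comm (f _ _)]

namespace LatticeModel

section SchwingerDyson

variable {L : ℕ} [NeZero L] {I : Type*} [Fintype I] [DecidableEq I] (S : LatticeModel L I)

/-- The density of the color `σ` at the momentum class `κ`. -/
def densityAt (κ : TorusSite L) (σ : I) : FockOp (Mode L I) :=
  ∑ x : TorusSite L, torusChar κ (-x) • num x σ

/-- The Fourier transform of the pair interaction at the momentum class `κ`. -/
def pairHat (κ : TorusSite L) (σ σ' : I) : ℂ :=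
  ∑ x : TorusSite L, torusChar κ x * (S.v x σ σ' : ℂ)

theorem pairHat_symm (κ : TorusSite L) (σ σ' : I) : S.pairHat κ σ σ' = S.pairHat (-κ) σ' σ := by
  unfold pairHat
  rw [← Equiv.sum_comp (Equiv.neg (TorusSite L))]
  refine Finset.sum_congr rfl fun x _ => ?_
  rw [Equiv.neg_apply, torusChar_neg, S.v_symm (-x), neg_neg]

theorem interaction_eq_sum_densityAt :
    S.interaction = ∑ l : TorusSite L × I × I, (1 / (L : ℂ) ^ 2 * S.pairHat l.1 l.2.1 l.2.2) •
      (densityAt l.1 l.2.1 * densityAt (-l.1) l.2.2) := by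
  rw [interaction_eq_sum_momentum]
  refine Finset.sum_congr rfl fun l _ => ?_
  rw [neg_momentum, vHat_momentum, obs_density_momentum, obs_density_momentum, momentumClass_neg,
    momentumClass_classRep]
  rfl

theorem commute_densityAt (κ κ' : TorusSite L) (σ σ' : I) :
    Commute (densityAt κ σ : FockOp (Mode L I)) (densityAt κ' σ') :=
  Commute.sum_left _ _ _ fun x _ => Commute.sum_right _ _ _ fun y _ =>
    ((commute_num x y σ σ').smul_left _).smul_right _

/-- The observable `X` carries the momentum class `κ`. -/
def HasMomentum (X : FockOp (Mode L I)) (κ : TorusSite L) : Prop :=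
  ∀ a, translateOp I a * X = torusChar κ a • (X * translateOp I a)

theorem hasMomentum_densityAt (κ : TorusSite L) (σ : I) :
    HasMomentum (densityAt κ σ : FockOp (Mode L I)) κ := by
  intro a
  refine translateOp_sum_smul (fun x => translateOp_num a x σ) fun x => ?_
  rw [neg_add, torusChar_add_right]
  have := torusChar_neg_right_mul κ a
  linear_combination (-torusChar κ (-x)) * this

variable {β : ℝ} [hβ : Fact (0 < β)]

/-- The vertices have zero frequency and are translation invariant, so only the external labels
count. For a nonzero total momentum some translation has phase ≠ 1, and invariance forces the
cumulant to vanish. -/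
theorem perturbedCumulant_eq_zero_of_sum_ne (k : ℕ) {r : ℕ} (hr : 0 < r)
    {O : Fin r → FockOp (Mode L I)} {κ : Fin r → TorusSite L} (hO : ∀ i, HasMomentum (O i) (κ i))
    {w : Fin r → ℤ} (h : ∑ i, w i ≠ 0 ∨ ∑ i, κ i ≠ 0) :
    perturbedCumulant (S.grandHam 0) S.interaction β k O w = 0 := by
  have huniv : (Finset.univ : Finset (Fin (r + k))).Nonempty := ⟨⟨0, by omega⟩, Finset.mem_univ _⟩
  rcases h with h | h
  · refine fourierCumulant_eq_zero_of_sum_ne _ _ _ huniv ?_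
    simpa [Fin.sum_univ_add] using h
  · obtain ⟨a, ha⟩ := exists_torusChar_ne_one h
    have key := fourierCumulant_intertwine (β := β) (S.grandHam 0) (U := translateOp I a)
      (V := (translateOp I a)ᴴ) (commute_translateOp_grandHam S a 0) (conjTranspose_permOp_mul _)
      (O := Fin.append O fun _ : Fin k => S.interaction)
      (c := Fin.append (fun i => torusChar (κ i) a) fun _ => 1) (fun i => by
        induction i using Fin.addCases with
        | left i => rw [Fin.append_left, Fin.append_left]; exact hO i a
        | right b =>
          rw [Fin.append_right, Fin.append_right, one_smul]; exact translateOp_interaction S a)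
      (Fin.append w fun _ => 0) huniv
    rw [Fin.prod_univ_add] at key
    simp only [Fin.append_left, Fin.append_right, Finset.prod_const_one, mul_one,
      torusChar_sum_left] at key
    by_contra hne
    exact ha (mul_right_cancel₀ hne (key.symm.trans (one_mul _).symm))

/-- The Schwinger-Dyson equation for time-averaged cumulants. -/
theorem hasSum_schwingerDyson (k : ℕ) {X₁ X₂ : FockOp (Mode L I)} {κ : TorusSite L}
    (h₁ : HasMomentum X₁ κ) (h₂ : HasMomentum X₂ (-κ)) (m : ℤ) :
    HasSum (fun q : ℤ × TorusSite L => ∑ σ, ∑ σ', S.pairHat q.2 σ σ' *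
      perturbedCumulant (S.grandHam 0) S.interaction β k
        ![X₁, X₂, densityAt q.2 σ, densityAt (-q.2) σ'] ![m, -m, q.1, -q.1])
      ((L : ℂ) ^ 2 * perturbedCumulant (S.grandHam 0) S.interaction β (k + 1) ![X₁, X₂] ![m, -m]
        - 2 * ∑ s ∈ Finset.range (k + 1), (k.choose s : ℂ) * ∑ σ, ∑ σ', S.pairHat 0 σ σ' *
          (perturbedCumulant (S.grandHam 0) S.interaction β s ![X₁, X₂, densityAt 0 σ] ![m, -m, 0] *
            perturbedCumulant (S.grandHam 0) S.interaction β (k - s) ![densityAt 0 σ'] ![0])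
        - 2 * ∑ s ∈ Finset.range (k + 1), (k.choose s : ℂ) * ∑ σ, ∑ σ', S.pairHat (-κ) σ σ' *
          (perturbedCumulant (S.grandHam 0) S.interaction β s ![X₁, densityAt (-κ) σ] ![m, -m] *
            perturbedCumulant (S.grandHam 0) S.interaction β (k - s) ![X₂, densityAt κ σ']
              ![-m, m])) := by
  have hL : (L : ℂ) ≠ 0 := by exact_mod_cast NeZero.ne L
  set C : ∀ (s : ℕ) {r : ℕ}, (Fin r → FockOp (Mode L I)) → (Fin r → ℤ) → ℂ :=
    fun s {r} O w => perturbedCumulant (S.grandHam 0) S.interaction β s O w with hC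
  let D : TorusSite L → I → FockOp (Mode L I) := densityAt
  let T : ℤ × TorusSite L → ℂ := fun q => ∑ σ, ∑ σ', S.pairHat q.2 σ σ' *
    C k ![X₁, X₂, D q.2 σ, D (-q.2) σ'] ![m, -m, q.1, -q.1]
  -- `E₁` to `E₄` are the disconnected terms, in which the first density is joined by neither
  -- current, by `X₂`, by `X₁`, and by both.
  let E₁ : ℤ × TorusSite L → ℂ := fun q => ∑ σ, ∑ σ', S.pairHat q.2 σ σ' *
    ∑ s ∈ Finset.range (k + 1), (k.choose s : ℂ) * (C s ![D q.2 σ] ![q.1] *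
      C (k - s) ![X₁, X₂, D (-q.2) σ'] ![m, -m, -q.1])
  let E₂ : ℤ × TorusSite L → ℂ := fun q => ∑ σ, ∑ σ', S.pairHat q.2 σ σ' *
    ∑ s ∈ Finset.range (k + 1), (k.choose s : ℂ) * (C s ![X₂, D q.2 σ] ![-m, q.1] *
      C (k - s) ![X₁, D (-q.2) σ'] ![m, -q.1])
  let E₃ : ℤ × TorusSite L → ℂ := fun q => ∑ σ, ∑ σ', S.pairHat q.2 σ σ' *
    ∑ s ∈ Finset.range (k + 1), (k.choose s : ℂ) * (C s ![X₁, D q.2 σ] ![m, q.1] *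
      C (k - s) ![X₂, D (-q.2) σ'] ![-m, -q.1])
  let E₄ : ℤ × TorusSite L → ℂ := fun q => ∑ σ, ∑ σ', S.pairHat q.2 σ σ' *
    ∑ s ∈ Finset.range (k + 1), (k.choose s : ℂ) * (C s ![X₁, X₂, D q.2 σ] ![m, -m, q.1] *
      C (k - s) ![D (-q.2) σ'] ![-q.1])
  let Ft : ℤ → TorusSite L → I → I → ℂ := fun n q σ σ' => S.pairHat q σ σ' * (
    C k ![X₁, X₂, D q σ, D (-q) σ'] ![m, -m, n, -n] +
      ∑ s ∈ Finset.range (k + 1), (k.choose s : ℂ) * (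
        C s ![D q σ] ![n] * C (k - s) ![X₁, X₂, D (-q) σ'] ![m, -m, -n] +
        C s ![X₂, D q σ] ![-m, n] * C (k - s) ![X₁, D (-q) σ'] ![m, -n] +
        C s ![X₁, D q σ] ![m, n] * C (k - s) ![X₂, D (-q) σ'] ![-m, -n] +
        C s ![X₁, X₂, D q σ] ![m, -m, n] * C (k - s) ![D (-q) σ'] ![-n]))
  have hFt : ∀ q : ℤ × TorusSite L, ∑ σ, ∑ σ', Ft q.1 q.2 σ σ' =
      T q + E₁ q + E₂ q + E₃ q + E₄ q := by
    intro q
    simp only [Ft, T, E₁, E₂, E₃, E₄, ← Finset.sum_add_distrib, ← mul_add, add_assoc]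
  have hsum : HasSum (fun q : ℤ × TorusSite L => ∑ σ, ∑ σ', Ft q.1 q.2 σ σ')
      ((L : ℂ) ^ 2 * C (k + 1) ![X₁, X₂] ![m, -m]) := by
    refine hasSum_prod_of_fintype (fun q => ?_) ?_
    -- Contracting the part of the vertex at one fixed momentum gives summability over the frequency
    -- on each fibre; the full vertex, below, gives the value.
    · have := (hasSum_perturbedCumulant (β := β) (S.grandHam 0) S.interaction X₁ X₂ m (-m)
        (fun l : I × I => S.pairHat q l.1 l.2) (fun l => D q l.1) (fun l => D (-q) l.2)
        (fun l => commute_densityAt _ _ _ _) k).summable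
      simpa only [Fintype.sum_prod_type] using this
    · have := (hasSum_perturbedCumulant (β := β) (S.grandHam 0) S.interaction X₁ X₂ m (-m)
        (fun l : TorusSite L × I × I => 1 / (L : ℂ) ^ 2 * S.pairHat l.1 l.2.1 l.2.2)
        (fun l => D l.1 l.2.1) (fun l => D (-l.1) l.2.2)
        (fun l => commute_densityAt _ _ _ _) k).mul_left ((L : ℂ) ^ 2)
      rw [← interaction_eq_sum_densityAt] at this
      have hv := perturbedCumulant_succ (β := β) (S.grandHam 0) S.interaction k ![X₁, X₂] ![m, -m]
      have hs1 : (Fin.snoc (α := fun _ => FockOp (Mode L I)) ![X₁, X₂] S.interaction) =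
          ![X₁, X₂, S.interaction] := by funext a; fin_cases a <;> rfl
      have hs2 : (Fin.snoc (α := fun _ => ℤ) ![m, -m] 0) = ![m, -m, 0] := by
        funext a; fin_cases a <;> rfl
      rw [hs1, hs2] at hv
      rw [hv] at this
      refine hasSum_of_eq this (fun n => ?_) rfl
      simp only [← Fintype.sum_prod_type (f := fun κ : TorusSite L × I × I =>
        Ft n κ.1 κ.2.1 κ.2.2), ← Fintype.sum_prod_type']
      rw [Finset.mul_sum]
      refine Finset.sum_congr rfl fun l _ => ?_
      simp only [Ft, hC]
      rw [← mul_assoc, ← mul_assoc, mul_one_div_cancel (pow_ne_zero 2 hL), one_mul]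
  have hzero : ∀ {s r : ℕ} (hr : 0 < r) {O : Fin r → FockOp (Mode L I)} {κ' : Fin r → TorusSite L}
      (hO : ∀ i, HasMomentum (O i) (κ' i)) {w : Fin r → ℤ} (h : ∑ i, w i ≠ 0 ∨ ∑ i, κ' i ≠ 0),
      C s O w = 0 := fun hr _ _ hO _ h => S.perturbedCumulant_eq_zero_of_sum_ne _ hr hO h
  have hD := fun q σ => hasMomentum_densityAt (I := I) (L := L) q σ
  have hne : ∀ {q q₀ : ℤ × TorusSite L}, q ≠ q₀ → q.1 - q₀.1 ≠ 0 ∨ q.2 - q₀.2 ≠ 0 := by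
    intro q q₀ h
    by_contra! hc
    exact h (Prod.ext (sub_eq_zero.1 hc.1) (sub_eq_zero.1 hc.2))
  -- Conservation in the first factor of each product leaves one transferred momentum: zero for `E₁`
  -- and `E₄`, and the opposite of the momentum of the attached current for `E₂` and `E₃`.
  have hE₁ : HasSum E₁ (E₁ (0, 0)) := by
    refine hasSum_single _ fun q hq => Finset.sum_eq_zero fun σ _ => Finset.sum_eq_zero fun σ' _ => ?_
    rw [Finset.sum_eq_zero fun s _ => ?_, mul_zero]
    rw [hzero one_pos (κ' := ![q.2]) (fun i => by fin_cases i; exact hD _ _)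
      (by simpa using hne hq), zero_mul, mul_zero]
  have hE₂ : HasSum E₂ (E₂ (m, κ)) := by
    refine hasSum_single _ fun q hq => Finset.sum_eq_zero fun σ _ => Finset.sum_eq_zero fun σ' _ => ?_
    rw [Finset.sum_eq_zero fun s _ => ?_, mul_zero]
    rw [hzero two_pos (κ' := ![-κ, q.2]) (fun i => by fin_cases i; exacts [h₂, hD _ _])
      (by simpa [neg_add_eq_sub] using hne hq), zero_mul, mul_zero]
  have hE₃ : HasSum E₃ (E₃ (-m, -κ)) := by
    refine hasSum_single _ fun q hq => Finset.sum_eq_zero fun σ _ => Finset.sum_eq_zero fun σ' _ => ?_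
    rw [Finset.sum_eq_zero fun s _ => ?_, mul_zero]
    rw [hzero two_pos (κ' := ![κ, q.2]) (fun i => by fin_cases i; exacts [h₁, hD _ _])
      (by simpa [add_comm] using hne hq), zero_mul, mul_zero]
  have hE₄ : HasSum E₄ (E₄ (0, 0)) := by
    refine hasSum_single _ fun q hq => Finset.sum_eq_zero fun σ _ => Finset.sum_eq_zero fun σ' _ => ?_
    rw [Finset.sum_eq_zero fun s _ => ?_, mul_zero]
    rw [hzero three_pos (κ' := ![κ, -κ, q.2]) (fun i => by fin_cases i; exacts [h₁, h₂, hD _ _])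
      (by simpa [Fin.sum_univ_three] using hne hq), zero_mul, mul_zero]
  have hT := (((hsum.sub hE₁).sub hE₂).sub hE₃).sub hE₄
  refine hasSum_of_eq hT (fun q => ?_) ?_
  · rw [hFt]
    simp only [T, D, hC]
    ring
  -- `E₁`, `E₄` and `E₂`, `E₃` are mirror pairs, equal by the symmetry of the pair interaction;
  -- hence the factors 2.
  · have e₁ : E₁ (0, 0) = ∑ s ∈ Finset.range (k + 1), (k.choose s : ℂ) * ∑ σ, ∑ σ',
        S.pairHat 0 σ σ' * (C s ![X₁, X₂, D 0 σ] ![m, -m, 0] * C (k - s) ![D 0 σ'] ![0]) := by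
      refine (sum_mul_sum_choose_swap k (fun σ σ' => S.pairHat_symm _ σ σ')
        (fun s σ => C s ![D 0 σ] ![0])
        (fun s σ => C s ![X₁, X₂, D (-0) σ] ![m, -m, -0])).trans ?_
      simp only [neg_zero]
    have e₄ : E₄ (0, 0) = ∑ s ∈ Finset.range (k + 1), (k.choose s : ℂ) * ∑ σ, ∑ σ',
        S.pairHat 0 σ σ' * (C s ![X₁, X₂, D 0 σ] ![m, -m, 0] * C (k - s) ![D 0 σ'] ![0]) := by
      refine (sum_mul_sum_choose k (fun σ σ' => S.pairHat 0 σ σ')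
        (fun s σ => C s ![X₁, X₂, D 0 σ] ![m, -m, 0])
        (fun s σ => C s ![D (-0) σ] ![-0])).trans ?_
      simp only [neg_zero]
    have e₂ : E₂ (m, κ) = ∑ s ∈ Finset.range (k + 1), (k.choose s : ℂ) * ∑ σ, ∑ σ',
        S.pairHat (-κ) σ σ' * (C s ![X₁, D (-κ) σ] ![m, -m] * C (k - s) ![X₂, D κ σ'] ![-m, m]) :=
      sum_mul_sum_choose_swap k (fun σ σ' => S.pairHat_symm _ σ σ')
        (fun s σ => C s ![X₂, D κ σ] ![-m, m]) (fun s σ => C s ![X₁, D (-κ) σ] ![m, -m])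
    have e₃ : E₃ (-m, -κ) = ∑ s ∈ Finset.range (k + 1), (k.choose s : ℂ) * ∑ σ, ∑ σ',
        S.pairHat (-κ) σ σ' * (C s ![X₁, D (-κ) σ] ![m, -m] * C (k - s) ![X₂, D κ σ'] ![-m, m]) := by
      refine (sum_mul_sum_choose k (fun σ σ' => S.pairHat (-κ) σ σ')
        (fun s σ => C s ![X₁, D (-κ) σ] ![m, -m])
        (fun s σ => C s ![X₂, D (- -κ) σ] ![-m, - -m])).trans ?_
      simp only [neg_neg]
    rw [e₁, e₂, e₃, e₄]
    simp only [D, hC]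
    ring

end SchwingerDyson

end LatticeModel
end

noncomputable section

/-! ### From normalized cumulants to the coefficients of the proposition. -/

/-- The powers `a + s` and `b + (k - s)` add up to an exponent independent of `s`, so the
normalizations leave the sum. -/
theorem sum_choose_mul_scaled {I : Type*} [Fintype I] (k a b : ℕ) (c t : ℂ) (v : I → I → ℂ)
    (f g : ℕ → I → ℂ) :
    ∑ s ∈ Finset.range (k + 1), (k.choose s : ℂ) * ∑ σ, ∑ σ',
        v σ σ' * (c * (t ^ (a + s) * f s σ)) * (c * (t ^ (b + (k - s)) * g (k - s) σ')) =
      c ^ 2 * t ^ (a + b + k) * ∑ s ∈ Finset.range (k + 1), (k.choose s : ℂ) *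
        ∑ σ, ∑ σ', v σ σ' * (f s σ * g (k - s) σ') := by
  simp only [Finset.mul_sum]
  refine Finset.sum_congr rfl fun s hs => Finset.sum_congr rfl fun σ _ =>
    Finset.sum_congr rfl fun σ' _ => ?_
  have hs' : s ≤ k := Nat.lt_succ_iff.1 (Finset.mem_range.1 hs)
  have ht : t ^ (a + b + k) = t ^ (a + s) * t ^ (b + (k - s)) := by
    rw [← pow_add]; congr 1; omega
  rw [ht]
  ring

namespace LatticeModel

section Coefficients

variable {L : ℕ} [NeZero L] {I : Type*} [Fintype I] [DecidableEq I] (S : LatticeModel L I)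

theorem obs_density_momentum_eq (σ : I) (n : Fin 2 → ℤ) :
    S.obs (S.momentum n) (.density σ) = densityAt (momentumClass L n) σ :=
  S.obs_density_momentum σ n

theorem vHat_momentum_eq (σ σ' : I) (n : Fin 2 → ℤ) :
    S.vHat σ σ' (S.momentum n) = S.pairHat (momentumClass L n) σ σ' :=
  S.vHat_momentum σ σ' n

/-- The order-`k` coefficients in terms of time-averaged cumulants. -/
theorem KHat_eq {β : ℝ} [hβ : Fact (0 < β)] (k : ℕ) {n : ℕ} {α : Fin (n + 1) → ObsLabel I}
    {pp : Fin n → ℝ × Plane} (full : Fin (n + 1) → ℝ × Plane)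
    (hfull : Fin.snoc (α := fun _ => ℝ × Plane) pp (-∑ i, pp i) = full)
    {O : Fin (n + 1) → FockOp (Mode L I)} (hO : ∀ i, S.obs (full i).2 (α i) = O i)
    {w : Fin (n + 1) → ℤ} (hw : ∀ i, (full i).1 = 2 * Real.pi / β * w i) :
    S.KHat β k α pp = 1 / ((β : ℂ) * (L : ℂ) ^ 2) *
      ((β : ℂ) ^ (n + 1 + k) * perturbedCumulant (S.grandHam 0) S.interaction β k O w) := by
  unfold KHat perturbedCumulant
  simp only [hfull]
  rw [← truncatedCorrFourier_eq _ _ _ (by omega)]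
  congr 2
  · congr 1
    funext i
    exact hO i
  · funext i
    induction i using Fin.addCases with
    | left i => rw [Fin.append_left, Fin.append_left, hw]
    | right b => simp

theorem inner_momentum_ell (n : Fin 2 → ℤ) (j : Fin 2) :
    inner ℝ (S.momentum n) (S.ell j) = 2 * Real.pi * n j / L := by
  unfold momentum
  rw [sum_inner, Finset.sum_eq_single j]
  · rw [inner_smul_left, S.G_dual, if_pos rfl, conj_trivial]
    ring
  · intro i _ hij
    rw [inner_smul_left, S.G_dual, if_neg hij, mul_zero]
  · simp

/-- Pairing with the direct basis recovers the coordinates; this is what turns the sum over the set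
`brillouin` into one over classes modulo `L`, without repetitions. -/
theorem momentum_injective : Function.Injective S.momentum := by
  intro n n' h
  have hL : (L : ℝ) ≠ 0 := by exact_mod_cast NeZero.ne L
  funext j
  have h1 := S.inner_momentum_ell n j
  rw [h, S.inner_momentum_ell n' j, div_left_inj' hL,
    mul_right_inj' (by positivity : (2 * Real.pi : ℝ) ≠ 0)] at h1
  exact_mod_cast h1.symm

theorem classRep_injective : Function.Injective (classRep : TorusSite L → Fin 2 → ℤ) :=
  Function.LeftInverse.injective momentumClass_classRep

theorem classRep_momentumClass {n : Fin 2 → ℤ} (hn : ∀ i, 0 ≤ n i ∧ n i < L) :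
    classRep (momentumClass L n) = n := by
  funext i
  unfold classRep momentumClass
  rw [ZMod.val_intCast, Int.emod_eq_of_lt (hn i).1 (hn i).2]

theorem momentum_classRep_mem (κ : TorusSite L) : S.momentum (classRep κ) ∈ S.brillouin :=
  ⟨classRep κ, fun i => ⟨Int.natCast_nonneg _, by
    unfold classRep; exact_mod_cast ZMod.val_lt (κ i)⟩, rfl⟩

/-- The Matsubara frequencies and the momenta of the Brillouin zone, in integer coordinates. -/
def spacetimeMomentumEquiv {β : ℝ} (hβ : 0 < β) :
    ℤ × TorusSite L ≃ ↥(matsubara β ×ˢ S.brillouin) :=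
  Equiv.ofBijective (fun q => ⟨(2 * Real.pi / β * q.1, S.momentum (classRep q.2)),
    ⟨⟨q.1, rfl⟩, S.momentum_classRep_mem q.2⟩⟩) <| by
    have hc : 2 * Real.pi / β ≠ 0 := by positivity
    constructor
    · intro q q' h
      have h' := Prod.ext_iff.1 (Subtype.ext_iff.1 h)
      refine Prod.ext ?_ (classRep_injective (S.momentum_injective h'.2))
      exact_mod_cast mul_left_cancel₀ hc h'.1
    · rintro ⟨⟨ω, q⟩, ⟨m, hm⟩, ⟨n, hn, hq⟩⟩
      refine ⟨(m, momentumClass L n), Subtype.ext (Prod.ext hm.symm ?_)⟩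
      change S.momentum (classRep (momentumClass L n)) = q
      rw [classRep_momentumClass hn]
      exact hq.symm

theorem hasMomentum_obs_current (n : Fin 2 → ℤ) (i : Fin 2) :
    HasMomentum (S.obs (S.momentum n) (.current i)) (momentumClass L n) :=
  S.translateOp_obs_current n i

theorem hasSum_KHat {β : ℝ} (hβ : 0 < β) (k : ℕ) (i j : Fin 2) {pp : ℝ × Plane}
    (hpp : pp ∈ matsubara β ×ˢ S.momenta) :
    HasSum (fun qq : ↥(matsubara β ×ˢ S.brillouin) => ∑ σ, ∑ σ', S.vHat σ σ' qq.1.2 *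
        S.KHat β k ![.current i, .current j, .density σ, .density σ'] ![pp, -pp, qq.1])
      ((β : ℂ) * (L : ℂ) ^ 2 * (S.KHat β (k + 1) ![.current i, .current j] ![pp]
        - 2 * ∑ s ∈ Finset.range (k + 1), (k.choose s : ℂ) * ∑ σ, ∑ σ', S.vHat σ σ' 0 *
          S.KHat β s ![.current i, .current j, .density σ] ![pp, -pp] *
            S.KHat β (k - s) ![.density σ'] ![]
        - 2 * ∑ s ∈ Finset.range (k + 1), (k.choose s : ℂ) * ∑ σ, ∑ σ', S.vHat σ σ' (-pp.2) *
          S.KHat β s ![.current i, .density σ] ![pp] *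
            S.KHat β (k - s) ![.current j, .density σ'] ![-pp])) := by
  have : Fact (0 < β) := ⟨hβ⟩
  obtain ⟨ω, p⟩ := pp
  obtain ⟨⟨m, hm⟩, ⟨n, hn⟩⟩ := hpp
  simp only at hm hn
  have hp : p = S.momentum n := hn
  clear hn
  subst hm hp
  have hL : (L : ℂ) ≠ 0 := by exact_mod_cast NeZero.ne L
  have hβ' : (β : ℂ) ≠ 0 := by exact_mod_cast hβ.ne'
  set κ := momentumClass L n with hκ
  set X₁ := S.obs (S.momentum n) (.current i) with hX₁
  set X₂ := S.obs (S.momentum (-n)) (.current j) with hX₂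
  have h₁ : HasMomentum X₁ κ := S.hasMomentum_obs_current n i
  have h₂ : HasMomentum X₂ (-κ) := momentumClass_neg (L := L) n ▸ S.hasMomentum_obs_current (-n) j
  have hρ : ∀ σ, S.obs (S.momentum n) (.density σ) = densityAt κ σ :=
    fun σ => S.obs_density_momentum_eq σ n
  have hρ' : ∀ σ, S.obs (-S.momentum n) (.density σ) = densityAt (-κ) σ := fun σ => by
    rw [neg_momentum, obs_density_momentum_eq, momentumClass_neg]
  have hρ₀ : ∀ σ, S.obs 0 (.density σ) = densityAt 0 σ := fun σ => by
    rw [← S.momentum_zero, obs_density_momentum_eq, momentumClass_zero]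
  have key := S.hasSum_schwingerDyson (β := β) k h₁ h₂ m
  set C : ∀ (s : ℕ) {r : ℕ}, (Fin r → FockOp (Mode L I)) → (Fin r → ℤ) → ℂ :=
    fun s {r} O w => perturbedCumulant (S.grandHam 0) S.interaction β s O w with hC
  set pp : ℝ × Plane := (2 * Real.pi / β * m, S.momentum n) with hpp
  have hX₂' : S.obs (-S.momentum n) (.current j) = X₂ := by rw [neg_momentum]
  have k₂ : ∀ s, S.KHat β s ![.current i, .current j] ![pp] = 1 / ((β : ℂ) * (L : ℂ) ^ 2) *
      ((β : ℂ) ^ (2 + s) * C s ![X₁, X₂] ![m, -m]) := fun s =>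
    S.KHat_eq s ![pp, -pp] (by funext a; fin_cases a <;> simp [Fin.snoc])
      (fun a => by fin_cases a; exacts [rfl, hX₂']) (fun a => by fin_cases a <;> simp [pp])
  have k₄ : ∀ s (q : ℤ × TorusSite L) σ σ',
      S.KHat β s ![.current i, .current j, .density σ, .density σ']
        ![pp, -pp, (2 * Real.pi / β * q.1, S.momentum (classRep q.2))] =
      1 / ((β : ℂ) * (L : ℂ) ^ 2) * ((β : ℂ) ^ (4 + s) *
        C s ![X₁, X₂, densityAt q.2 σ, densityAt (-q.2) σ'] ![m, -m, q.1, -q.1]) :=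
    fun s q σ σ' =>
    S.KHat_eq s ![pp, -pp, (2 * Real.pi / β * q.1, S.momentum (classRep q.2)),
        -(2 * Real.pi / β * q.1, S.momentum (classRep q.2))]
      (by funext a; fin_cases a <;> simp [Fin.snoc, Fin.sum_univ_three] <;> rfl)
      (fun a => by
        fin_cases a
        · rfl
        · exact hX₂'
        · exact (S.obs_density_momentum_eq _ _).trans (by rw [momentumClass_classRep]; rfl)
        · refine (congrArg (S.obs · (.density σ')) (S.neg_momentum _)).trans ?_
          rw [obs_density_momentum_eq, momentumClass_neg, momentumClass_classRep]; rfl)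
      (fun a => by fin_cases a <;> simp [pp])
  have k₃ : ∀ s σ, S.KHat β s ![.current i, .current j, .density σ] ![pp, -pp] =
      1 / ((β : ℂ) * (L : ℂ) ^ 2) * ((β : ℂ) ^ (3 + s) *
        C s ![X₁, X₂, densityAt 0 σ] ![m, -m, 0]) := fun s σ =>
    S.KHat_eq s ![pp, -pp, 0]
      (by funext a; fin_cases a <;> simp [Fin.snoc])
      (fun a => by fin_cases a; exacts [rfl, hX₂', hρ₀ σ])
      (fun a => by fin_cases a <;> simp [pp])
  have k₁ : ∀ s σ, S.KHat β s ![.density σ] ![] =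
      1 / ((β : ℂ) * (L : ℂ) ^ 2) * ((β : ℂ) ^ (1 + s) * C s ![densityAt 0 σ] ![0]) :=
    fun s σ => S.KHat_eq s ![0]
      (by funext a; fin_cases a; simp [Fin.snoc])
      (fun a => by fin_cases a; exact hρ₀ σ)
      (fun a => by fin_cases a; simp)
  have k₅ : ∀ s σ, S.KHat β s ![.current i, .density σ] ![pp] =
      1 / ((β : ℂ) * (L : ℂ) ^ 2) * ((β : ℂ) ^ (2 + s) *
        C s ![X₁, densityAt (-κ) σ] ![m, -m]) := fun s σ =>
    S.KHat_eq s ![pp, -pp] (by funext a; fin_cases a <;> simp [Fin.snoc])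
      (fun a => by fin_cases a; exacts [rfl, hρ' σ]) (fun a => by fin_cases a <;> simp [pp])
  have k₆ : ∀ s σ, S.KHat β s ![.current j, .density σ] ![-pp] =
      1 / ((β : ℂ) * (L : ℂ) ^ 2) * ((β : ℂ) ^ (2 + s) *
        C s ![X₂, densityAt κ σ] ![-m, m]) := fun s σ =>
    S.KHat_eq s ![-pp, pp] (by funext a; fin_cases a <;> simp [Fin.snoc])
      (fun a => by fin_cases a; exacts [hX₂', hρ σ]) (fun a => by fin_cases a <;> simp [pp])
  have hv₀ : ∀ σ σ', S.vHat σ σ' 0 = S.pairHat 0 σ σ' := fun σ σ' => by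
    rw [← S.momentum_zero, vHat_momentum_eq, momentumClass_zero]
  have hv : ∀ σ σ', S.vHat σ σ' (-pp.2) = S.pairHat (-κ) σ σ' := fun σ σ' => by
    rw [neg_momentum, vHat_momentum_eq, momentumClass_neg]
  rw [← (S.spacetimeMomentumEquiv hβ).hasSum_iff]
  -- This is the normalization of the four-point coefficient at order `k`. The products carry the
  -- same power of β, from 3 + 1 or 2 + 2 external times and `k` vertices in all, but one more
  -- factor 1/(βL²).
  refine hasSum_of_eq (key.mul_left (1 / ((β : ℂ) * (L : ℂ) ^ 2) * (β : ℂ) ^ (4 + k)))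
    (fun q => ?_) ?_
  · change _ = ∑ σ, ∑ σ', S.vHat σ σ' (S.momentum (classRep q.2)) *
      S.KHat β k ![.current i, .current j, .density σ, .density σ']
        ![pp, -pp, (2 * Real.pi / β * q.1, S.momentum (classRep q.2))]
    rw [Finset.mul_sum]
    refine Finset.sum_congr rfl fun σ _ => ?_
    rw [Finset.mul_sum]
    refine Finset.sum_congr rfl fun σ' _ => ?_
    rw [k₄, vHat_momentum_eq, momentumClass_classRep]
    ring
  · have e₁ : ∑ s ∈ Finset.range (k + 1), (k.choose s : ℂ) * ∑ σ, ∑ σ', S.vHat σ σ' 0 *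
        S.KHat β s ![.current i, .current j, .density σ] ![pp, -pp] *
          S.KHat β (k - s) ![.density σ'] ![] = _ :=
      (by simp only [hv₀, k₃, k₁] : _ = _).trans (sum_choose_mul_scaled k 3 1
        (1 / ((β : ℂ) * (L : ℂ) ^ 2)) β (S.pairHat 0)
        (fun s σ => C s ![X₁, X₂, densityAt 0 σ] ![m, -m, 0])
        (fun s σ => C s ![densityAt 0 σ] ![0]))
    have e₂ : ∑ s ∈ Finset.range (k + 1), (k.choose s : ℂ) * ∑ σ, ∑ σ', S.vHat σ σ' (-pp.2) *
        S.KHat β s ![.current i, .density σ] ![pp] *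
          S.KHat β (k - s) ![.current j, .density σ'] ![-pp] = _ :=
      (by simp only [hv, k₅, k₆] : _ = _).trans (sum_choose_mul_scaled k 2 2
        (1 / ((β : ℂ) * (L : ℂ) ^ 2)) β (S.pairHat (-κ))
        (fun s σ => C s ![X₁, densityAt (-κ) σ] ![m, -m])
        (fun s σ => C s ![X₂, densityAt κ σ] ![-m, m]))
    rw [e₁, e₂, k₂]
    simp only [hC]
    field_simp
    ring

end Coefficients

end LatticeModel
end

theorem proposition3p4 {L : ℕ} [NeZero L] {I : Type*} [Fintype I] [DecidableEq I]
    (S : LatticeModel L I) (β : ℝ) (hβ : 0 < β) (k : ℕ) (hk : 1 ≤ k) (i j : Fin 2)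
    (pp : ℝ × Plane) (hpp : pp ∈ LatticeModel.matsubara β ×ˢ S.momenta) :
    Summable (fun qq : ↥(LatticeModel.matsubara β ×ˢ S.brillouin) =>
      ∑ σ : I, ∑ σ' : I, S.vHat σ σ' qq.1.2 *
        S.KHat β (k - 1) ![.current i, .current j, .density σ, .density σ'] ![pp, -pp, qq.1]) ∧
    S.KHat β k ![.current i, .current j] ![pp] =
      1 / ((β : ℂ) * (L : ℂ) ^ 2) *
        ∑' qq : ↥(LatticeModel.matsubara β ×ˢ S.brillouin), ∑ σ : I, ∑ σ' : I,
          S.vHat σ σ' qq.1.2 *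
            S.KHat β (k - 1) ![.current i, .current j, .density σ, .density σ'] ![pp, -pp, qq.1]
      + 2 * ∑ m ∈ Finset.range k, ((k - 1).choose m : ℂ) * ∑ σ : I, ∑ σ' : I,
          S.vHat σ σ' 0 * S.KHat β m ![.current i, .current j, .density σ] ![pp, -pp] *
            S.KHat β (k - 1 - m) ![.density σ'] ![]
      + 2 * ∑ m ∈ Finset.range k, ((k - 1).choose m : ℂ) * ∑ σ : I, ∑ σ' : I,
          S.vHat σ σ' (-pp.2) * S.KHat β m ![.current i, .density σ] ![pp] *
            S.KHat β (k - 1 - m) ![.current j, .density σ'] ![-pp] := by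
  obtain ⟨k, rfl⟩ : ∃ k', k = k' + 1 := ⟨k - 1, by omega⟩
  rw [Nat.add_sub_cancel]
  have key := S.hasSum_KHat hβ k i j hpp
  refine ⟨key.summable, ?_⟩
  rw [key.tsum_eq, ← mul_assoc, one_div_mul_cancel
    (mul_ne_zero (by exact_mod_cast hβ.ne') (pow_ne_zero 2 (by exact_mod_cast NeZero.ne L)))]
  ring
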